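/- Theorem. Let $n\ge 1$, $0\le\varrho\le 1$, and write $\langle\xi\rangle=(1+|\xi|^2)^{1/2}$. For $m\in\mathbf R$ let $L^\infty S^m_\varrho$ be the set of functions $a:\mathbf R^n\times\mathbf R^n\to\mathbf C$, $(x,\xi)\mapsto a(x,\xi)$, that are measurable in $x$ and $C^\infty$ in $\xi$ and satisfy $\sup_{\xi}\langle\xi\rangle^{-m+\varrho|\alpha|}\|\partial_\xi^\alpha a(\cdot,\xi)\|_{L^\infty(\mathbf R^n)}<\infty$ for every multi-index $\alpha$. Let $\Phi^2$ be the set of real-valued functions $\varphi\in C^\infty(\mathbf R^n\times(\mathbf R^n\setminus 0))$ that are positively homogeneous of degree $1$ in $\xi$ and satisfy $\sup_{x\in\mathbf R^n,\,\xi\ne 0}|\xi|^{-1+|\alpha|}|\partial_\xi^\alpha\partial_x^\beta\varphi(x,\xi)|<\infty$ for all multi-indices with $|\alpha|+|\beta|\ge 2$. Call $\varphi$ strongly non-degenerate if there is $c>0$ with $|\det(\partial^2\varphi(x,\xi)/\partial x_j\partial\xi_k)|\ge c$ for all $x\in\mathbf R^n$ and $\xi\ne 0$. For a Schwartz function $u$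 put $$T_{a,\varphi}u(x)=\frac1{(2\pi)^n}\int_{\mathbf R^n}a(x,\xi)\,e^{i\varphi(x,\xi)}\,\widehat u(\xi)\,d\xi,\qquad \widehat u(\xi)=\int_{\mathbf R^n}e^{-i\langle y,\xi\rangle}u(y)\,dy.$$ (i) If $m<\frac n2(\varrho-1)$, $a\in L^\infty S^m_\varrho$, and $\varphi\in\Phi^2$ is strongly non-degenerate, then $T_{a,\varphi}$ extends to a bounded linear operator from $L^2(\mathbf R^n)$ to itself. (ii) The bound on $m$ is sharp: for every $m\ge\frac n2(\varrho-1)$ there are an amplitude $a\in L^\infty S^m_\varrho$ and a strongly non-degenerate phase $\varphi\in\Phi^2$ for which $T_{a,\varphi}$ does not extend to a bounded linear operator from $L^2(\mathbf R^n)$ to itself. -/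

import Mathlib

open MeasureTheory SchwartzMap
open scoped ContDiff

noncomputable section

namespace RoughFIO

/-- The Euclidean space `ℝⁿ`. -/
abbrev Rn (n : ℕ) : Type := EuclideanSpace ℝ (Fin n)

/-- The Japanese bracket `⟨ξ⟩ = (1 + |ξ|²)^{1/2}`. -/
def bracket {n : ℕ} (ξ : Rn n) : ℝ := Real.sqrt (1 + ‖ξ‖ ^ 2)

/-- The class `L^∞ S^m_ρ` of rough amplitudes: `a(x, ξ)` is measurable in `x`, smooth in `ξ`, and
`‖∂_ξ^α a(·, ξ)‖_{L^∞} ≤ C_α ⟨ξ⟩^{m - ρ|α|}` for all `ξ` and all multi-indices `α`.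
The partial derivatives of order `|α| = k` are bundled in the `k`-th total derivative in `ξ`, whose
norm is comparable to the maximum of the `|∂_ξ^α a|` over `|α| = k`. -/
structure MemRoughAmplitude {n : ℕ} (m ρ : ℝ) (a : Rn n → Rn n → ℂ) : Prop where
  smooth : ∀ x, ContDiff ℝ ∞ (a x)
  measurable : ∀ ξ, AEStronglyMeasurable (fun x => a x ξ) volume
  bound : ∀ k : ℕ, ∃ C : ℝ, ∀ ξ, ∀ᵐ x ∂(volume : Measure (Rn n)),
    ‖iteratedFDeriv ℝ k (a x) ξ‖ ≤ C * bracket ξ ^ (m - ρ * k)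

/-- The class `Φ^N` of phase functions: `φ` is real valued, smooth on `ℝⁿ × (ℝⁿ \ 0)`, positively
homogeneous of degree one in `ξ`, and `|∂_ξ^α ∂_x^β φ(x, ξ)| ≤ C_{αβ} |ξ|^{1 - |α|}` for all `x`,
all `ξ ≠ 0` and all `|α| + |β| ≥ N`. The partial derivatives with `|α| = k`, `|β| = l` are bundled
in the `k`-th total derivative in `ξ` of the `l`-th total derivative in `x`. The values of `φ` at
`ξ = 0` play no role. -/
structure MemPhase {n : ℕ} (N : ℕ) (φ : Rn n → Rn n → ℝ) : Prop where
  smooth : ContDiffOn ℝ ∞ (fun p : Rn n × Rn n => φ p.1 p.2) {p | p.2 ≠ 0}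
  homogeneous : ∀ x ξ, ξ ≠ 0 → ∀ t : ℝ, 0 < t → φ x (t • ξ) = t * φ x ξ
  bound : ∀ k l : ℕ, N ≤ k + l → ∃ C : ℝ, ∀ x ξ, ξ ≠ 0 →
    ‖iteratedFDeriv ℝ k (fun η => iteratedFDeriv ℝ l (fun y => φ y η) x) ξ‖
      ≤ C * ‖ξ‖ ^ (1 - (k : ℤ))

/-- The mixed Hessian matrix `(∂²φ / ∂x_j ∂ξ_k)(x, ξ)`. -/
def mixedHessian {n : ℕ} (φ : Rn n → Rn n → ℝ) (x ξ : Rn n) : Matrix (Fin n) (Fin n) ℝ :=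
  Matrix.of fun j k =>
    fderiv ℝ (fun y => fderiv ℝ (φ y) ξ (EuclideanSpace.single k 1)) x (EuclideanSpace.single j 1)

/-- The strong non-degeneracy condition: `|det ∂²φ/∂x_j∂ξ_k| ≥ c > 0` on `ℝⁿ × (ℝⁿ \ 0)`. -/
def StronglyNondegenerate {n : ℕ} (φ : Rn n → Rn n → ℝ) : Prop :=
  ∃ c : ℝ, 0 < c ∧ ∀ x ξ, ξ ≠ 0 → c ≤ |(mixedHessian φ x ξ).det|

/-- The Fourier transform `û(ξ) = ∫ e^{-i⟨y, ξ⟩} u(y) dy`. -/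
def hat {n : ℕ} (u : Rn n → ℂ) (ξ : Rn n) : ℂ :=
  ∫ y, Complex.exp (-Complex.I * (inner ℝ y ξ : ℝ)) * u y

/-- The Fourier integral operator
`T_{a,φ} u(x) = (2π)^{-n} ∫ a(x, ξ) e^{iφ(x, ξ)} û(ξ) dξ`. -/
def fio {n : ℕ} (a : Rn n → Rn n → ℂ) (φ : Rn n → Rn n → ℝ) (u : 𝓢(Rn n, ℂ)) (x : Rn n) : ℂ :=
  ((2 * Real.pi : ℝ) ^ n : ℂ)⁻¹ *
    ∫ ξ, a x ξ * Complex.exp (Complex.I * (φ x ξ : ℝ)) * hat u ξ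

/-- An operator `T`, given on Schwartz functions, is bounded on `L²(ℝⁿ)`: it is the restriction of
a continuous linear operator of `L²(ℝⁿ)` into itself. As Schwartz functions are dense, for a linear
`T` this is the estimate `‖T u‖_{L²} ≤ C ‖u‖_{L²}` for all Schwartz functions `u`. -/
def BoundedOnL2 {n : ℕ} (T : 𝓢(Rn n, ℂ) → Rn n → ℂ) : Prop :=
  ∃ A : Lp ℂ 2 (volume : Measure (Rn n)) →L[ℂ] Lp ℂ 2 (volume : Measure (Rn n)),
    ∀ u : 𝓢(Rn n, ℂ), A (u.toLp 2 volume) =ᵐ[volume] T u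

end RoughFIO

end

noncomputable section

namespace RoughFIO

open Filter Topology

/-! ### Symbol estimates uniform over a family: weight, rate of derivatives, algebra. -/

section SymbolCalculus

variable {ι E F G H : Type*} [NormedAddCommGroup E] [NormedSpace ℝ E]
  [NormedAddCommGroup F] [NormedSpace ℝ F] [NormedAddCommGroup G] [NormedSpace ℝ G]
  [NormedAddCommGroup H] [NormedSpace ℝ H]

/-! Boundedness. By Plancherel it suffices to bound f ↦ ∫ a(x,ξ) e^{iφ(x,ξ)} f(ξ) dξ on L². The
amplitude has no regularity in x, so every integration by parts must take place in ξ. This is what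
TT* allows: its kernel is ∫ a(x,ξ) conj(a(y,ξ)) e^{i(φ(x,ξ)-φ(y,ξ))} dξ, and a Schur bound for it
controls T (`lintegral_sq_le_of_TTstar`).

The phase difference is nonstationary: |∇_ξφ(x,ξ) - ∇_ξφ(y,ξ)| ≥ c|x-y| for all x, y
(`MemPhase.gradient_bounded_below`). For fixed ξ the map x ↦ ∇_ξφ(x,ξ) has a Jacobian that is
uniformly invertible, by the determinant condition and the bounds on mixed derivatives, and
Lipschitz. A quantitative global inverse theorem (`norm_sub_le_of_fderiv_bounded_below`) then turns
the infinitesimal bound into a global one.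

Suppose the amplitude has size A, lives on a set of volume Vol, and each ξ-derivative costs a factor
t. Then n+1 integrations by parts bound the kernel by A² Vol (1+|x-y|/t)^{-(n+1)}, so the squared
operator norm is at most a constant times A² Vol tⁿ (`oscillatory_bound`). On the shell |ξ| ~ 2^j,
with j ≥ 0, one has A = 2^{jm}, Vol ~ 2^{jn}, t = 2^{-jρ}. The operator norm is then of order 2^{j(m
- n(ρ-1)/2)}, which is summable exactly when m < n(ρ-1)/2.

Near ξ = 0 the same count gives only O(1) per shell, because φ is singular at the origin. On a cone
around a unit vector e, write φ = L + θ with L(x,ξ) = ⟨∇_ξφ(x,e), ξ⟩. The class Φ² does not bound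
∇_ξφ, but subtracting L removes the unbounded part, and θ behaves like |ξ| uniformly in x. The phase
L inherits the lower gradient bound and is smooth at 0, so its contribution is a single piece. The
error e^{iL}(e^{iθ} - 1) has amplitude of size λ on |ξ| ~ λ, hence norm O(λ), which sums over dyadic
λ → 0. The cones around e and -e suffice.

Sharpness. Take φ = ⟨x,ξ⟩ and let a be a sum of separated bumps at points z_i, of heights w_i,
modulated by e^{-i⟨x,z_i⟩}. If û = Σ w_i ψ(ξ - z_i) over a finite set, the modulations bring all
packets back to the same place: Tu is a fixed function times Σ w_i², whereas ‖u‖² is a constant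
times Σ w_i². Boundedness would therefore bound Σ w_i². Placing about 2^{jn(1-ρ)} points at spacing
2^{jρ} in the shell 2^j, with w = 2^{jm} and m = n(ρ-1)/2, every shell contributes at least a fixed
amount and the sum diverges. Larger m follows by inclusion of the classes. -/

theorem norm_iteratedFDeriv_le_of_bilinear_at (B : F →L[ℝ] G →L[ℝ] H) {f : E → F} {g : E → G}
    {x : E} {n : ℕ} (hf : ContDiffAt ℝ n f x) (hg : ContDiffAt ℝ n g x) :
    ‖iteratedFDeriv ℝ n (fun y => B (f y) (g y)) x‖ ≤ ‖B‖ * ∑ i ∈ Finset.range (n + 1),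
      (n.choose i : ℝ) * ‖iteratedFDeriv ℝ i f x‖ * ‖iteratedFDeriv ℝ (n - i) g x‖ := by
  have h := (hf.eventually (by simp)).and (hg.eventually (by simp))
  obtain ⟨u, hu, huo, hxu⟩ := eventually_nhds_iff.1 h
  have := B.norm_iteratedFDerivWithin_le_of_bilinear (f := f) (g := g) (N := n) (s := u) (x := x)
    (fun y hy => (hu y hy).1.contDiffWithinAt) (fun y hy => (hu y hy).2.contDiffWithinAt)
    huo.uniqueDiffOn hxu (n := n) le_rfl
  simpa only [iteratedFDerivWithin_of_isOpen _ huo hxu] using this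

/-- A family of functions `f i`, smooth to order `k` at the points of `S i`, whose derivatives
satisfy `‖D^j (f i)‖ ≤ C A_i t_i^j` there for `j ≤ k`, with `C` independent of `i`. -/
structure SymFam (S : ι → Set E) (t A : ι → ℝ) (k : ℕ) (f : ι → E → F) : Prop where
  contDiffAt : ∀ i, ∀ ξ ∈ S i, ContDiffAt ℝ k (f i) ξ
  bound : ∃ C, 0 ≤ C ∧ ∀ i, ∀ ξ ∈ S i, ∀ j ≤ k, ‖iteratedFDeriv ℝ j (f i) ξ‖ ≤ C * A i * t i ^ j

namespace SymFam

variable {S : ι → Set E} {t A A' : ι → ℝ} {k : ℕ} {f : ι → E → F}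

theorem mono {k' : ℕ} (h : SymFam S t A k f) (hk : k' ≤ k) : SymFam S t A k' f := by
  obtain ⟨C, hC, hb⟩ := h.bound
  exact ⟨fun i ξ hξ => (h.contDiffAt i ξ hξ).of_le (by exact_mod_cast hk),
    C, hC, fun i ξ hξ j hj => hb i ξ hξ j (hj.trans hk)⟩

theorem reindex {κ : Type*} (h : SymFam S t A k f) (e : κ → ι) :
    SymFam (fun i => S (e i)) (fun i => t (e i)) (fun i => A (e i)) k (fun i => f (e i)) := by
  obtain ⟨C, hC, hb⟩ := h.bound
  exact ⟨fun i ξ hξ => h.contDiffAt _ ξ hξ, C, hC, fun i ξ hξ j hj => hb _ ξ hξ j hj⟩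

theorem weaken {t' : ι → ℝ} (h : SymFam S t A k f) (ht : ∀ i, 0 ≤ t i) (htt : ∀ i, t i ≤ t' i)
    (hA : ∀ i, 0 ≤ A i) {K : ℝ} (hK : 0 ≤ K) (hAA : ∀ i, A i ≤ K * A' i) :
    SymFam S t' A' k f := by
  obtain ⟨C, hC, hb⟩ := h.bound
  refine ⟨h.contDiffAt, C * K, by positivity, fun i ξ hξ j hj => (hb i ξ hξ j hj).trans ?_⟩
  have h1 : t i ^ j ≤ t' i ^ j := pow_le_pow_left₀ (ht i) (htt i) j
  have h2 := hAA i
  have h3 := hA i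
  have h4 := pow_nonneg (ht i) j
  rw [mul_assoc C K]
  exact mul_le_mul (mul_le_mul_of_nonneg_left h2 hC) h1 h4
    (mul_nonneg hC (h3.trans h2))

theorem congr {g : ι → E → F} (h : SymFam S t A k f)
    (hfg : ∀ i, ∀ ξ ∈ S i, g i =ᶠ[𝓝 ξ] f i) : SymFam S t A k g := by
  obtain ⟨C, hC, hb⟩ := h.bound
  refine ⟨fun i ξ hξ => (h.contDiffAt i ξ hξ).congr_of_eventuallyEq (hfg i ξ hξ),
    C, hC, fun i ξ hξ j hj => ?_⟩
  rw [((hfg i ξ hξ).iteratedFDeriv ℝ j).eq_of_nhds]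
  exact hb i ξ hξ j hj

theorem add {g : ι → E → F} (h : SymFam S t A k f) (h' : SymFam S t A k g) :
    SymFam S t A k (fun i ξ => f i ξ + g i ξ) := by
  obtain ⟨C, hC, hb⟩ := h.bound
  obtain ⟨C', hC', hb'⟩ := h'.bound
  refine ⟨fun i ξ hξ => (h.contDiffAt i ξ hξ).add (h'.contDiffAt i ξ hξ),
    C + C', by positivity, fun i ξ hξ j hj => ?_⟩
  have hj' : ((j : ℕ∞) : WithTop ℕ∞) ≤ (k : WithTop ℕ∞) := by exact_mod_cast hj
  have : iteratedFDeriv ℝ j (fun ξ => f i ξ + g i ξ) ξ =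
      iteratedFDeriv ℝ j (f i) ξ + iteratedFDeriv ℝ j (g i) ξ :=
    iteratedFDeriv_add_apply ((h.contDiffAt i ξ hξ).of_le hj') ((h'.contDiffAt i ξ hξ).of_le hj')
  rw [this, add_mul, add_mul]
  exact (norm_add_le _ _).trans (add_le_add (hb i ξ hξ j hj) (hb' i ξ hξ j hj))

theorem const (hA : ∀ i, 0 ≤ A i) (ht : ∀ i, 0 ≤ t i) {c : ι → F} {K : ℝ} (hK : 0 ≤ K)
    (hc : ∀ i, ‖c i‖ ≤ K * A i) :
    SymFam S t A k (fun i _ => c i) := by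
  refine ⟨fun i ξ _ => contDiffAt_const, K, hK, fun i ξ _ j _ => ?_⟩
  rcases j with - | j
  · simpa using hc i
  · rw [iteratedFDeriv_const_of_ne (by simp)]
    simpa using mul_nonneg (mul_nonneg hK (hA i)) (pow_nonneg (ht i) _)

theorem sum {α : Type*} (s : Finset α) {g : α → ι → E → F} (hA : ∀ i, 0 ≤ A i) (ht : ∀ i, 0 ≤ t i)
    (h : ∀ a ∈ s, SymFam S t A k (g a)) : SymFam S t A k (fun i ξ => ∑ a ∈ s, g a i ξ) := by
  classical
  induction s using Finset.induction_on with
  | empty =>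
    simpa using SymFam.const (S := S) (c := fun _ => (0 : F)) hA ht le_rfl (by simp)
  | insert a s ha ih =>
    have h1 := h a (Finset.mem_insert_self a s)
    have h2 := ih fun b hb => h b (Finset.mem_insert_of_mem hb)
    simpa [Finset.sum_insert ha] using h1.add h2

theorem clm (L : F →L[ℝ] G) (h : SymFam S t A k f) : SymFam S t A k (fun i ξ => L (f i ξ)) := by
  obtain ⟨C, hC, hb⟩ := h.bound
  refine ⟨fun i ξ hξ => L.contDiff.contDiffAt.comp ξ (h.contDiffAt i ξ hξ),
    ‖L‖ * C, by positivity, fun i ξ hξ j hj => ?_⟩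
  have := L.norm_iteratedFDeriv_comp_left (h.contDiffAt i ξ hξ) (n := j) (by exact_mod_cast hj)
  refine (this.trans (mul_le_mul_of_nonneg_left (hb i ξ hξ j hj) (norm_nonneg _))).trans_eq ?_
  ring

/-- Leibniz rule: weights multiply and the rate t is unchanged, since t^l t^{j-l} = t^j; the
binomial coefficients add up to at most 2^k. -/
theorem bilin (B : F →L[ℝ] G →L[ℝ] H) {g : ι → E → G} (h : SymFam S t A k f)
    (h' : SymFam S t A' k g) : SymFam S t (fun i => A i * A' i) k (fun i ξ => B (f i ξ) (g i ξ)) := by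
  obtain ⟨C, hC, hb⟩ := h.bound
  obtain ⟨C', hC', hb'⟩ := h'.bound
  refine ⟨fun i ξ hξ => ?_, ‖B‖ * (C * C') * 2 ^ k, by positivity, fun i ξ hξ j hj => ?_⟩
  · exact (B.isBoundedBilinearMap.contDiff.contDiffAt (x := (f i ξ, g i ξ))).comp ξ
      ((h.contDiffAt i ξ hξ).prodMk (h'.contDiffAt i ξ hξ))
  have hj' : ((j : ℕ∞) : WithTop ℕ∞) ≤ (k : WithTop ℕ∞) := by exact_mod_cast hj
  refine (norm_iteratedFDeriv_le_of_bilinear_at B ((h.contDiffAt i ξ hξ).of_le hj')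
    ((h'.contDiffAt i ξ hξ).of_le hj')).trans ?_
  have h0 : 0 ≤ C * A i * t i ^ j * (C' * A' i) := by
    have h1 := (norm_nonneg _).trans (hb i ξ hξ j hj)
    have h2 := (norm_nonneg _).trans (hb' i ξ hξ 0 (by simp))
    simp only [pow_zero, mul_one] at h2
    positivity
  have key : ∑ l ∈ Finset.range (j + 1), (j.choose l : ℝ) * ‖iteratedFDeriv ℝ l (f i) ξ‖ *
      ‖iteratedFDeriv ℝ (j - l) (g i) ξ‖ ≤
      ∑ l ∈ Finset.range (j + 1), (j.choose l : ℝ) * (C * A i * t i ^ j * (C' * A' i)) := by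
    refine Finset.sum_le_sum fun l hl => ?_
    have hl' : l ≤ j := by simpa [Nat.lt_succ_iff] using hl
    have e : C * A i * t i ^ j * (C' * A' i) = C * A i * t i ^ l * (C' * A' i * t i ^ (j - l)) := by
      rw [← Nat.sub_add_cancel hl', pow_add, Nat.sub_add_cancel hl']; ring
    rw [e, mul_assoc]
    gcongr
    · exact (norm_nonneg _).trans (hb i ξ hξ l (hl'.trans hj))
    · exact hb i ξ hξ l (hl'.trans hj)
    · exact hb' i ξ hξ _ ((Nat.sub_le _ _).trans hj)
  rw [← Finset.sum_mul] at key
  have h2 : (∑ l ∈ Finset.range (j + 1), (j.choose l : ℝ)) = 2 ^ j := by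
    exact_mod_cast Nat.sum_range_choose j
  rw [h2] at key
  have h3 : (2 : ℝ) ^ j ≤ 2 ^ k := pow_le_pow_right₀ (by norm_num) hj
  calc _ ≤ ‖B‖ * (2 ^ j * (C * A i * t i ^ j * (C' * A' i))) := by gcongr
    _ ≤ ‖B‖ * (2 ^ k * (C * A i * t i ^ j * (C' * A' i))) := by gcongr
    _ = _ := by ring

theorem smul {𝕜 : Type*} [NormedField 𝕜] [NormedAlgebra ℝ 𝕜] [NormedSpace 𝕜 G]
    [IsScalarTower ℝ 𝕜 G] {c : ι → E → 𝕜} {g : ι → E → G} (h : SymFam S t A k c)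
    (h' : SymFam S t A' k g) : SymFam S t (fun i => A i * A' i) k (fun i ξ => c i ξ • g i ξ) :=
  h.bilin (ContinuousLinearMap.lsmul ℝ 𝕜) h'

theorem mul {𝕜 : Type*} [NormedField 𝕜] [NormedAlgebra ℝ 𝕜] {c g : ι → E → 𝕜}
    (h : SymFam S t A k c) (h' : SymFam S t A' k g) :
    SymFam S t (fun i => A i * A' i) k (fun i ξ => c i ξ * g i ξ) :=
  h.bilin (ContinuousLinearMap.mul ℝ 𝕜) h'

theorem fderiv (h : SymFam S t A (k + 1) f) :
    SymFam S t (fun i => A i * t i) k (fun i ξ => fderiv ℝ (f i) ξ) := by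
  obtain ⟨C, hC, hb⟩ := h.bound
  refine ⟨fun i ξ hξ => (h.contDiffAt i ξ hξ).fderiv_right (by norm_cast), C, hC,
    fun i ξ hξ j hj => ?_⟩
  have := hb i ξ hξ (j + 1) (by omega)
  rw [← norm_iteratedFDeriv_fderiv] at this
  exact this.trans_eq (by ring)

theorem fderiv_apply (h : SymFam S t A (k + 1) f) (v : E) :
    SymFam S t (fun i => A i * t i) k (fun i ξ => _root_.fderiv ℝ (f i) ξ v) :=
  h.fderiv.clm (ContinuousLinearMap.apply ℝ F v)

/-- The induction step for `inv`, `cexp` and `cexp_sub_one`: each of these functions has a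
derivative expressed through itself, to which the estimate of one order less applies. -/
theorem of_fderiv (h0 : ∀ i, ∀ ξ ∈ S i, ContDiffAt ℝ (k + 1 : ℕ) (f i) ξ) {C : ℝ} (hC : 0 ≤ C)
    (h1 : ∀ i, ∀ ξ ∈ S i, ‖f i ξ‖ ≤ C * A i) (hA : ∀ i, 0 ≤ A i) (ht : ∀ i, 0 ≤ t i)
    (h2 : SymFam S t (fun i => A i * t i) k (fun i ξ => _root_.fderiv ℝ (f i) ξ)) :
    SymFam S t A (k + 1) f := by
  obtain ⟨C', hC', hb⟩ := h2.bound
  refine ⟨h0, C + C', by positivity, fun i ξ hξ j hj => ?_⟩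
  have hAi := hA i
  rcases j with - | j
  · rw [norm_iteratedFDeriv_zero]
    refine (h1 i ξ hξ).trans ?_
    rw [pow_zero, mul_one, add_mul]
    exact le_add_of_nonneg_right (by positivity)
  · rw [← norm_iteratedFDeriv_fderiv]
    refine (hb i ξ hξ j (by omega)).trans ?_
    have : C' * (A i * t i) * t i ^ j = C' * A i * t i ^ (j + 1) := by ring
    have h4 : 0 ≤ C * A i * t i ^ (j + 1) := by have := ht i; positivity
    rw [this, add_mul, add_mul]
    exact le_add_of_nonneg_left h4

theorem norm_le (h : SymFam S t A k f) : ∃ C, 0 ≤ C ∧ ∀ i, ∀ ξ ∈ S i, ‖f i ξ‖ ≤ C * A i := by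
  obtain ⟨C, hC, hb⟩ := h.bound
  exact ⟨C, hC, fun i ξ hξ => by simpa using hb i ξ hξ 0 (by simp)⟩

theorem of_norm_le {C : ℝ} (hC : 0 ≤ C)
    (h : ∀ i, ∀ ξ ∈ S i, ‖f i ξ‖ ≤ C * A i) (hd : ∀ i, ∀ ξ ∈ S i, ContDiffAt ℝ 0 (f i) ξ) :
    SymFam S t A 0 f :=
  ⟨by simpa using hd, C, hC, fun i ξ hξ j hj => by
    obtain rfl : j = 0 := by omega
    simpa using h i ξ hξ⟩

/-- Induction on the order through (1/q)' = -q⁻² q': the right-hand side has weight A⁻² · A t = A⁻¹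
t. -/
theorem inv {q : ι → E → ℝ} (h : SymFam S t A k q) (hA : ∀ i, 0 < A i) (ht : ∀ i, 0 ≤ t i)
    {c : ℝ} (hc : 0 < c) (hq : ∀ i, ∀ ξ ∈ S i, c * A i ≤ q i ξ) :
    SymFam S t (fun i => (A i)⁻¹) k (fun i ξ => (q i ξ)⁻¹) := by
  have hpos : ∀ i, ∀ ξ ∈ S i, 0 < q i ξ := fun i ξ hξ =>
    (mul_pos hc (hA i)).trans_le (hq i ξ hξ)
  have hle : ∀ i, ∀ ξ ∈ S i, ‖(q i ξ)⁻¹‖ ≤ c⁻¹ * (A i)⁻¹ := fun i ξ hξ => by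
    rw [norm_inv, Real.norm_of_nonneg (hpos i ξ hξ).le, ← mul_inv]
    exact inv_anti₀ (mul_pos hc (hA i)) (hq i ξ hξ)
  induction k with
  | zero =>
    have hd : ∀ i, ∀ ξ ∈ S i, ContDiffAt ℝ 0 (fun ξ => (q i ξ)⁻¹) ξ := fun i ξ hξ =>
      ContDiffAt.inv (by simpa using h.contDiffAt i ξ hξ) (hpos i ξ hξ).ne'
    exact of_norm_le (inv_nonneg.2 hc.le) hle hd
  | succ k ih =>
    have ih' := ih (h.mono (Nat.le_succ k))
    have hd : ∀ i, ∀ ξ ∈ S i, ContDiffAt ℝ (k + 1 : ℕ) (fun ξ => (q i ξ)⁻¹) ξ := fun i ξ hξ =>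
      ContDiffAt.inv (h.contDiffAt i ξ hξ) (hpos i ξ hξ).ne'
    refine of_fderiv hd (inv_nonneg.2 hc.le) hle (fun i => (inv_pos.2 (hA i)).le) ht ?_
    have h2 := ((ih'.mul ih').clm (-ContinuousLinearMap.id ℝ ℝ)).smul h.fderiv
    refine (h2.weaken ht (fun _ => le_rfl) (fun i => ?_) zero_le_one (A' := fun i => (A i)⁻¹ * t i)
      fun i => ?_).congr fun i ξ hξ => ?_
    · have := hA i
      have := ht i
      positivity
    · have := (hA i).ne'
      field_simp
      exact le_rfl
    · have h3 : ∀ᶠ η in 𝓝 ξ, ContDiffAt ℝ (k + 1 : ℕ) (q i) η :=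
        (h.contDiffAt i ξ hξ).eventually (by simp)
      have h4 : ∀ᶠ η in 𝓝 ξ, q i η ≠ 0 :=
        (h.contDiffAt i ξ hξ).continuousAt.eventually_ne (hpos i ξ hξ).ne'
      filter_upwards [h3, h4] with η h5 h6
      have h7 := (h5.differentiableAt (by simp)).hasFDerivAt
      have h8 := (hasDerivAt_inv h6).comp_hasFDerivAt η h7
      rw [show (fun ξ => (q i ξ)⁻¹) = (fun y => y⁻¹) ∘ q i from rfl, h8.fderiv]
      simp [pow_two]

/-- Since (e^{iθ})' = i e^{iθ} θ', powers of A appear with the powers of t; the assumption A ≤ 1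
lets them be discarded. -/
theorem cexp {θ : ι → E → ℝ} (h : SymFam S t A k θ) (hA : ∀ i, 0 ≤ A i) (hA1 : ∀ i, A i ≤ 1)
    (ht : ∀ i, 0 ≤ t i) :
    SymFam S t (fun _ => 1) k (fun i ξ => Complex.exp (Complex.I * (θ i ξ : ℝ))) := by
  have hle : ∀ i, ∀ ξ ∈ S i, ‖Complex.exp (Complex.I * (θ i ξ : ℝ))‖ ≤ 1 * 1 := fun i ξ _ => by
    rw [mul_comm, Complex.norm_exp_ofReal_mul_I, one_mul]
  have hE : ContDiff ℝ ∞ fun x : ℝ => Complex.exp (Complex.I * (x : ℂ)) :=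
    (contDiff_const.mul Complex.ofRealCLM.contDiff).cexp
  induction k with
  | zero =>
    have hd : ∀ i, ∀ ξ ∈ S i,
        ContDiffAt ℝ 0 (fun ξ => Complex.exp (Complex.I * (θ i ξ : ℝ))) ξ := fun i ξ hξ =>
      (hE.contDiffAt.of_le (by simp)).comp ξ (by simpa using h.contDiffAt i ξ hξ)
    exact of_norm_le zero_le_one hle hd
  | succ k ih =>
    have ih' := ih (h.mono (Nat.le_succ k))
    have hd : ∀ i, ∀ ξ ∈ S i, ContDiffAt ℝ (k + 1 : ℕ)
        (fun ξ => Complex.exp (Complex.I * (θ i ξ : ℝ))) ξ := fun i ξ hξ =>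
      (hE.contDiffAt.of_le (by exact_mod_cast le_top)).comp ξ (h.contDiffAt i ξ hξ)
    refine of_fderiv hd zero_le_one hle (fun i => zero_le_one) ht ?_
    have h1 := h.fderiv.clm (ContinuousLinearMap.compL ℝ E ℝ ℂ Complex.ofRealCLM)
    have h2 := (ih'.clm (ContinuousLinearMap.mul ℝ ℂ Complex.I)).smul h1
    refine (h2.weaken ht (fun _ => le_rfl) (fun i => ?_) zero_le_one (A' := fun i => 1 * t i)
      fun i => ?_).congr fun i ξ hξ => ?_
    · have := hA i
      have := ht i
      positivity
    · have := hA1 i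
      have := ht i
      simp only [one_mul]
      exact mul_le_of_le_one_left (ht i) (hA1 i)
    · have h3 : ∀ᶠ η in 𝓝 ξ, ContDiffAt ℝ (k + 1 : ℕ) (θ i) η :=
        (h.contDiffAt i ξ hξ).eventually (by simp)
      filter_upwards [h3] with η h5
      have h7 := (h5.differentiableAt (by simp)).hasFDerivAt
      have h8 : HasFDerivAt (fun ξ => Complex.I * (θ i ξ : ℂ))
          (Complex.I • Complex.ofRealCLM.comp (_root_.fderiv ℝ (θ i) η)) η :=
        (Complex.ofRealCLM.hasFDerivAt.comp η h7).const_mul Complex.I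
      rw [h8.cexp.fderiv]
      ext v
      simp
      ring

/-- Here one factor A is kept: |e^{iθ} - 1| ≤ |θ|, and every derivative contains a derivative of θ.
This gain makes the low-frequency series converge. -/
theorem cexp_sub_one {θ : ι → E → ℝ} (h : SymFam S t A k θ) (hA : ∀ i, 0 ≤ A i)
    (hA1 : ∀ i, A i ≤ 1) (ht : ∀ i, 0 ≤ t i) :
    SymFam S t A k (fun i ξ => Complex.exp (Complex.I * (θ i ξ : ℝ)) - 1) := by
  have h0 := h.cexp hA hA1 ht
  obtain ⟨C, hC, hb⟩ := h.norm_le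
  have hle : ∀ i, ∀ ξ ∈ S i, ‖Complex.exp (Complex.I * (θ i ξ : ℝ)) - 1‖ ≤ C * A i :=
    fun i ξ hξ => (Real.norm_exp_I_mul_ofReal_sub_one_le).trans (hb i ξ hξ)
  have hd : ∀ i, ∀ ξ ∈ S i, ContDiffAt ℝ k
        (fun ξ => Complex.exp (Complex.I * (θ i ξ : ℝ)) - 1) ξ := fun i ξ hξ =>
      (h0.contDiffAt i ξ hξ).sub contDiffAt_const
  rcases k with - | k
  · exact of_norm_le hC hle (by simpa using hd)
  refine of_fderiv hd hC hle hA ht ?_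
  have h1 := h.fderiv.clm (ContinuousLinearMap.compL ℝ E ℝ ℂ Complex.ofRealCLM)
  have h2 := ((h0.mono (Nat.le_succ k)).clm (ContinuousLinearMap.mul ℝ ℂ Complex.I)).smul h1
  refine (h2.weaken ht (fun _ => le_rfl) (fun i => ?_) zero_le_one (A' := fun i => A i * t i)
    fun i => ?_).congr fun i ξ hξ => ?_
  · have := hA i
    have := ht i
    positivity
  · simp
  · have h3 : ∀ᶠ η in 𝓝 ξ, ContDiffAt ℝ (k + 1 : ℕ) (θ i) η :=
      (h.contDiffAt i ξ hξ).eventually (by simp)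
    filter_upwards [h3] with η h5
    have h7 := (h5.differentiableAt (by simp)).hasFDerivAt
    have h8 : HasFDerivAt (fun ξ => Complex.I * (θ i ξ : ℂ))
        (Complex.I • Complex.ofRealCLM.comp (_root_.fderiv ℝ (θ i) η)) η :=
      (Complex.ofRealCLM.hasFDerivAt.comp η h7).const_mul Complex.I
    rw [(h8.cexp.sub_const 1).fderiv]
    ext v
    simp
    ring

/-- Dilates of a fixed smooth compactly supported function. -/
theorem dilation {g : E → F} (hg : ContDiff ℝ ∞ g) (hgc : HasCompactSupport g)
    (ht : ∀ i, 0 ≤ t i) :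
    SymFam S t (fun _ => 1) k (fun i ξ => g (t i • ξ)) := by
  have hcont : ∀ j : ℕ, ∃ C, 0 ≤ C ∧ ∀ ξ, ‖iteratedFDeriv ℝ j g ξ‖ ≤ C := fun j => by
    obtain ⟨C, hC⟩ := (hg.continuous_iteratedFDeriv (m := j)
      (by exact_mod_cast le_top)).bounded_above_of_compact_support (hgc.iteratedFDeriv j)
    exact ⟨C, (norm_nonneg _).trans (hC 0), hC⟩
  choose C hC0 hC using hcont
  refine ⟨fun i ξ _ => ?_, ∑ j ∈ Finset.range (k + 1), C j, Finset.sum_nonneg fun j _ => hC0 j,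
    fun i ξ _ j hj => ?_⟩
  · exact ((hg.of_le (by exact_mod_cast le_top)).comp (contDiff_const_smul (t i))).contDiffAt
  · let L : E →L[ℝ] E := t i • ContinuousLinearMap.id ℝ E
    have h1 : (fun ξ => g (t i • ξ)) = g ∘ L := by ext; simp [L]
    rw [h1, L.iteratedFDeriv_comp_right (hg.of_le (m := j) (by exact_mod_cast le_top)) ξ le_rfl]
    refine (ContinuousMultilinearMap.norm_compContinuousLinearMap_le _ _).trans ?_
    have h2 : ‖L‖ ≤ t i := by
      refine L.opNorm_le_bound (ht i) fun v => ?_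
      simp [L, norm_smul, abs_of_nonneg (ht i)]
    have h3 : C j ≤ ∑ j ∈ Finset.range (k + 1), C j :=
      Finset.single_le_sum (f := C) (fun j _ => hC0 j) (by simp; omega)
    simp only [Finset.prod_const, Finset.card_univ, Fintype.card_fin, mul_one]
    exact mul_le_mul ((hC j _).trans h3) (pow_le_pow_left₀ (norm_nonneg _) h2 j)
      (by positivity) ((hC0 j).trans h3)

end SymFam

end SymbolCalculus

end RoughFIO

namespace RoughFIO

open Filter Topology

/-! ### Nonstationary phase by repeated integration by parts. -/

section NonstationaryPhase

/-- Phases are controlled only where the amplitude lives, since they may be singular at ξ = 0. Off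
the support the product vanishes locally, so nothing is required of f there. -/
theorem continuous_mul_of_tsupport {E : Type*} [TopologicalSpace E] {f g : E → ℂ}
    (hf : ∀ x ∈ tsupport g, ContinuousAt f x)
    (hg : Continuous g) : Continuous fun x => f x * g x := by
  refine continuous_iff_continuousAt.2 fun x => ?_
  by_cases hx : x ∈ tsupport g
  · exact (hf x hx).mul hg.continuousAt
  · refine (continuousAt_const (y := (0 : ℂ))).congr ?_
    filter_upwards [notMem_tsupport_iff_eventuallyEq.1 hx] with y hy
    simp [hy]

theorem integrable_mul_of_tsupport {E : Type*} [TopologicalSpace E] [MeasurableSpace E]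
    [OpensMeasurableSpace E] {μ : Measure E} [IsFiniteMeasureOnCompacts μ] {f g : E → ℂ}
    (hf : ∀ x ∈ tsupport g, ContinuousAt f x)
    (hg : Continuous g) (hgc : HasCompactSupport g) : Integrable (fun x => f x * g x) μ :=
  (continuous_mul_of_tsupport hf hg).integrable_of_hasCompactSupport hgc.mul_left

variable {ι κ E : Type*} [NormedAddCommGroup E] [NormedSpace ℝ E] [FiniteDimensional ℝ E]
  [MeasurableSpace E] [BorelSpace E] {μ : Measure E} [μ.IsAddHaarMeasure]

theorem integral_cexp_mul_fderiv {Ψ : E → ℝ} {w : E → ℂ} (hw : ContDiff ℝ 1 w)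
    (hwc : HasCompactSupport w) (hΨ : ∀ ξ ∈ tsupport w, ContDiffAt ℝ 2 Ψ ξ) (v : E) :
    ∫ ξ, Complex.exp (Complex.I * (Ψ ξ : ℝ)) * fderiv ℝ w ξ v ∂μ =
      -∫ ξ, Complex.I * Complex.exp (Complex.I * (Ψ ξ : ℝ)) * (fderiv ℝ Ψ ξ v • w ξ) ∂μ := by
  have hd : ∀ ξ ∈ tsupport w, HasFDerivAt (fun ξ => Complex.exp (Complex.I * (Ψ ξ : ℝ)))
      (Complex.exp (Complex.I * (Ψ ξ : ℝ)) •
        (Complex.I • Complex.ofRealCLM.comp (fderiv ℝ Ψ ξ))) ξ := fun ξ hξ => by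
    have h7 := ((hΨ ξ hξ).differentiableAt (by simp)).hasFDerivAt
    exact HasFDerivAt.cexp ((Complex.ofRealCLM.hasFDerivAt.comp ξ h7).const_mul Complex.I)
  have hcont : ∀ ξ ∈ tsupport w, ContinuousAt (fun ξ => Complex.exp (Complex.I * (Ψ ξ : ℝ))) ξ :=
    fun ξ hξ => (hd ξ hξ).continuousAt
  have hsub : ∀ v, tsupport (fun ξ => fderiv ℝ w ξ v) ⊆ tsupport w := fun v =>
    tsupport_fderiv_apply_subset ℝ v
  have hwv : Continuous fun ξ => fderiv ℝ w ξ v :=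
    (hw.continuous_fderiv (by simp)).clm_apply continuous_const
  have heq : ∀ ξ, fderiv ℝ (fun ξ => Complex.exp (Complex.I * (Ψ ξ : ℝ))) ξ v * w ξ =
      Complex.I * Complex.exp (Complex.I * (Ψ ξ : ℝ)) * (fderiv ℝ Ψ ξ v • w ξ) := fun ξ => by
    by_cases hξ : ξ ∈ tsupport w
    · rw [(hd ξ hξ).fderiv]
      simp
      ring
    · simp [image_eq_zero_of_notMem_tsupport hξ]
  have hint : Integrable (fun ξ => Complex.I * Complex.exp (Complex.I * (Ψ ξ : ℝ)) *
      (fderiv ℝ Ψ ξ v • w ξ)) μ := by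
    have : ∀ ξ, Complex.I * Complex.exp (Complex.I * (Ψ ξ : ℝ)) * (fderiv ℝ Ψ ξ v • w ξ) =
      (Complex.I * Complex.exp (Complex.I * (Ψ ξ : ℝ)) * ((fderiv ℝ Ψ ξ v : ℝ) : ℂ)) * w ξ :=
      fun ξ => by rw [Complex.real_smul]; ring
    simp_rw [this]
    refine integrable_mul_of_tsupport (fun ξ hξ => ?_) hw.continuous hwc
    refine (continuousAt_const.mul (hcont ξ hξ)).mul ?_
    exact Complex.continuous_ofReal.continuousAt.comp
      (((hΨ ξ hξ).fderiv_right (m := 1) (by norm_num)).continuousAt.clm_apply continuousAt_const)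
  rw [integral_mul_fderiv_eq_neg_fderiv_mul_of_integrable (𝕜 := ℂ) (μ := μ)
    (f := fun ξ => Complex.exp (Complex.I * (Ψ ξ : ℝ))) (g := w) (v := v)]
  · simp_rw [heq]
  · simp_rw [heq]
    exact hint
  · exact integrable_mul_of_tsupport (fun ξ hξ => hcont ξ (hsub v hξ)) hwv (hwc.fderiv_apply ℝ v)
  · exact integrable_mul_of_tsupport hcont hw.continuous hwc
  · exact fun ξ hξ => (hd ξ hξ).differentiableAt
  · exact fun ξ _ => hw.differentiable (by simp) ξ

/-- Nonstationary phase, uniformly over a family of phases and amplitudes. -/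
theorem nonstationary_phase [Fintype κ] (e : κ → E) {S : ι → Set E} {t R Vol : ι → ℝ}
    {Ψ : ι → E → ℝ} (ht : ∀ i, 0 ≤ t i) (hR : ∀ i, 0 < R i) (hVol : ∀ i, 0 ≤ Vol i)
    (hS : ∀ i, μ (S i) ≤ ENNReal.ofReal (Vol i))
    (hΨ : ∀ i, ∀ ξ ∈ S i, ContDiffAt ℝ 2 (Ψ i) ξ)
    (hgrad : ∀ N k, SymFam S t R N (fun i ξ => fderiv ℝ (Ψ i) ξ (e k)))
    {c : ℝ} (hc : 0 < c) (hq : ∀ i, ∀ ξ ∈ S i, c * R i ^ 2 ≤ ∑ k, fderiv ℝ (Ψ i) ξ (e k) ^ 2)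
    (N : ℕ) : ∀ (A : ι → ℝ) (β : ι → E → ℂ), (∀ i, 0 ≤ A i) → SymFam S t A N β →
      (∀ i, HasCompactSupport (β i)) → (∀ i, tsupport (β i) ⊆ S i) →
      ∃ C, 0 ≤ C ∧ ∀ i, ‖∫ ξ, Complex.exp (Complex.I * (Ψ i ξ : ℝ)) * β i ξ ∂μ‖ ≤
        C * A i * Vol i * (t i / R i) ^ N := by
  induction N with
  | zero =>
    intro A β hA hβ _ hβS
    obtain ⟨C, hC, hb⟩ := hβ.norm_le
    refine ⟨C, hC, fun i => ?_⟩
    have h0 : ∀ ξ, ξ ∉ S i → Complex.exp (Complex.I * (Ψ i ξ : ℝ)) * β i ξ = 0 := fun ξ hξ => by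
      rw [image_eq_zero_of_notMem_tsupport fun h => hξ (hβS i h), mul_zero]
    rw [← setIntegral_eq_integral_of_forall_compl_eq_zero h0]
    have hfin : μ (S i) < ⊤ := (hS i).trans_lt ENNReal.ofReal_lt_top
    refine (norm_setIntegral_le_of_norm_le_const hfin (C := C * A i) fun ξ hξ => ?_).trans ?_
    · rw [norm_mul, mul_comm Complex.I, Complex.norm_exp_ofReal_mul_I, one_mul]
      exact hb i ξ hξ
    · rw [pow_zero, mul_one]
      refine mul_le_mul_of_nonneg_left ?_ (mul_nonneg hC (hA i))
      exact ENNReal.toReal_le_of_le_ofReal (hVol i) (hS i)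
  | succ N ih =>
    intro A β hA hβ hβc hβS
    -- q = |∇Ψ|², which is at least cR² on S. The vector field w = (∇Ψ/q) β satisfies ∇Ψ · w = β,
    -- hence ∫ e^{iΨ} β = i ∫ e^{iΨ} div w. The new amplitude div w has weight A t/R, so each round
    -- gains t/R.
    set q : ι → E → ℝ := fun i ξ => ∑ k, fderiv ℝ (Ψ i) ξ (e k) ^ 2 with hqdef
    have hqsym : SymFam S t (fun i => R i ^ 2) (N + 1) q := by
      refine SymFam.sum _ (fun i => by positivity) ht fun k _ => ?_
      simpa only [pow_two] using (hgrad (N + 1) k).mul (hgrad (N + 1) k)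
    have hqpos : ∀ i, ∀ ξ ∈ S i, 0 < q i ξ := fun i ξ hξ =>
      (mul_pos hc (pow_pos (hR i) 2)).trans_le (hq i ξ hξ)
    have hqinv := hqsym.inv (fun i => pow_pos (hR i) 2) ht hc hq
    set w : κ → ι → E → ℂ := fun k i ξ => (fderiv ℝ (Ψ i) ξ (e k) * (q i ξ)⁻¹) • β i ξ with hwdef
    have hw : ∀ k, SymFam S t (fun i => (R i)⁻¹ * A i) (N + 1) (w k) := fun k => by
      refine (((hgrad (N + 1) k).mul hqinv).smul hβ).weaken ht (fun _ => le_rfl) (fun i => ?_)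
        zero_le_one fun i => ?_
      · have := hR i
        have := hA i
        positivity
      · have := (hR i).ne'
        rw [one_mul]
        refine le_of_eq ?_
        field_simp
    have hwsub : ∀ k i, tsupport (w k i) ⊆ tsupport (β i) := fun k i =>
      tsupport_smul_subset_right _ _
    have hwc : ∀ k i, HasCompactSupport (w k i) := fun k i => (hβc i).mono' <|
      (subset_tsupport _).trans (hwsub k i)
    have hwd : ∀ k i, ContDiff ℝ 1 (w k i) := fun k i => by
      refine contDiff_iff_contDiffAt.2 fun ξ => ?_
      by_cases hξ : ξ ∈ tsupport (w k i)
      · exact ((hw k).contDiffAt i ξ (hβS i (hwsub k i hξ))).of_le (by norm_cast; omega)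
      · exact (contDiffAt_const (c := (0 : ℂ))).congr_of_eventuallyEq
          (notMem_tsupport_iff_eventuallyEq.1 hξ)
    set β' : ι → E → ℂ := fun i ξ => ∑ k, fderiv ℝ (w k i) ξ (e k) with hβ'
    have hβ's : SymFam S t (fun i => (R i)⁻¹ * A i * t i) N β' :=
      SymFam.sum _ (fun i => mul_nonneg (mul_nonneg (inv_nonneg.2 (hR i).le) (hA i)) (ht i)) ht
        fun k _ => (hw k).fderiv_apply (e k)
    have hβ'supp : ∀ i, tsupport (β' i) ⊆ tsupport (β i) := fun i => by
      refine closure_minimal (fun ξ hξ => ?_) (isClosed_tsupport _)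
      by_contra hcon
      refine hξ (Finset.sum_eq_zero fun k _ => ?_)
      exact image_eq_zero_of_notMem_tsupport (f := fun ξ => fderiv ℝ (w k i) ξ (e k))
        fun h => hcon (hwsub k i (tsupport_fderiv_apply_subset ℝ (e k) h))
    obtain ⟨C, hC, hb⟩ := ih _ β'
      (fun i => mul_nonneg (mul_nonneg (inv_nonneg.2 (hR i).le) (hA i)) (ht i)) hβ's
      (fun i => (hβc i).mono' ((subset_tsupport _).trans (hβ'supp i)))
      (fun i => (hβ'supp i).trans (hβS i))
    refine ⟨C, hC, fun i => ?_⟩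
    have hΨc : ∀ ξ ∈ tsupport (β i),
        ContinuousAt (fun ξ => Complex.exp (Complex.I * (Ψ i ξ : ℝ))) ξ := fun ξ hξ =>
      (Complex.continuous_exp.continuousAt.comp (continuousAt_const.mul
        (Complex.continuous_ofReal.continuousAt.comp (hΨ i ξ (hβS i hξ)).continuousAt)))
    have hΨd : ∀ k, ∀ ξ ∈ tsupport (β i), ContinuousAt (fun ξ => fderiv ℝ (Ψ i) ξ (e k)) ξ :=
      fun k ξ hξ => ((hgrad 0 k).contDiffAt i ξ (hβS i hξ)).continuousAt
    have key : ∫ ξ, Complex.exp (Complex.I * (Ψ i ξ : ℝ)) * β' i ξ ∂μ =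
        -(Complex.I * ∫ ξ, Complex.exp (Complex.I * (Ψ i ξ : ℝ)) * β i ξ ∂μ) := by
      simp_rw [hβ', Finset.mul_sum]
      rw [integral_finsetSum]
      · simp_rw [fun k => integral_cexp_mul_fderiv (μ := μ) (hwd k i) (hwc k i)
          (fun ξ hξ => hΨ i ξ (hβS i (hwsub k i hξ))) (e k)]
        rw [Finset.sum_neg_distrib, ← integral_finsetSum, ← integral_const_mul]
        · congr 2
          ext ξ
          by_cases hξ : ξ ∈ tsupport (β i)
          · rw [← Finset.mul_sum, mul_assoc]
            congr 2
            simp_rw [hwdef, smul_smul, ← Finset.sum_smul]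
            have : ∑ k, fderiv ℝ (Ψ i) ξ (e k) * (fderiv ℝ (Ψ i) ξ (e k) * (q i ξ)⁻¹) = 1 := by
              simp_rw [← mul_assoc, ← Finset.sum_mul, ← pow_two]
              exact mul_inv_cancel₀ (hqpos i ξ (hβS i hξ)).ne'
            rw [this, one_smul]
          · have h0 := image_eq_zero_of_notMem_tsupport hξ
            simp [hwdef, h0]
        · intro k _
          have : ∀ ξ, Complex.I * Complex.exp (Complex.I * (Ψ i ξ : ℝ)) *
              (fderiv ℝ (Ψ i) ξ (e k) • w k i ξ) = (Complex.I *
              Complex.exp (Complex.I * (Ψ i ξ : ℝ)) * ((fderiv ℝ (Ψ i) ξ (e k) : ℝ) : ℂ)) *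
              w k i ξ := fun ξ => by rw [Complex.real_smul]; ring
          simp_rw [this]
          refine integrable_mul_of_tsupport (fun ξ hξ => ?_) (hwd k i).continuous (hwc k i)
          exact (continuousAt_const.mul (hΨc ξ (hwsub k i hξ))).mul
            (Complex.continuous_ofReal.continuousAt.comp (hΨd k ξ (hwsub k i hξ)))
      · intro k _
        refine integrable_mul_of_tsupport (fun ξ hξ => hΨc ξ (hwsub k i
          (tsupport_fderiv_apply_subset ℝ (e k) hξ))) ?_ ((hwc k i).fderiv_apply ℝ (e k))
        exact ((hwd k i).continuous_fderiv (by simp)).clm_apply continuous_const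
    have h1 := hb i
    rw [key, norm_neg, norm_mul, Complex.norm_I, one_mul] at h1
    refine h1.trans_eq ?_
    rw [pow_succ]
    ring

end NonstationaryPhase

end RoughFIO

namespace RoughFIO

open Filter Topology
open scoped ENNReal ComplexConjugate

/-! ### The TT* method with Schur's test. -/

section TTstar

variable {X Y : Type*} [MeasurableSpace X] [MeasurableSpace Y] {μ : Measure X} {ν : Measure Y}

theorem ofReal_integral_norm_sq {g : X → ℂ} (hg : Integrable (fun x => ‖g x‖ ^ 2) μ) :
    ∫⁻ x, ‖g x‖ₑ ^ 2 ∂μ = ‖∫ x, conj (g x) * g x ∂μ‖ₑ := by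
  have h : ∀ x, conj (g x) * g x = ((‖g x‖ ^ 2 : ℝ) : ℂ) := fun x => by
    rw [mul_comm, Complex.mul_conj, Complex.normSq_eq_norm_sq]
  simp_rw [h]
  rw [integral_complex_ofReal, ← ofReal_norm, Complex.norm_real,
    Real.norm_of_nonneg (integral_nonneg fun x => by positivity),
    ofReal_integral_eq_lintegral_ofReal hg (ae_of_all _ fun x => by positivity)]
  refine lintegral_congr fun x => ?_
  rw [ENNReal.ofReal_pow (norm_nonneg _), ofReal_norm]

theorem Integrable.norm_sq_of_bdd {g : X → ℂ} (hg : Integrable g μ) {H : ℝ}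
    (hH : ∀ x, ‖g x‖ ≤ H) : Integrable (fun x => ‖g x‖ ^ 2) μ := by
  refine (hg.norm.mul_const H).mono' (hg.aestronglyMeasurable.norm.pow 2) (ae_of_all _ fun x => ?_)
  rw [norm_pow, norm_norm, pow_two]
  exact mul_le_mul_of_nonneg_left (hH x) (norm_nonneg _)

variable [SigmaFinite μ] [SigmaFinite ν]

theorem two_mul_enorm_mul_le (a b : ℂ) {M : ℝ} (hM : 0 < M) :
    2 * (‖a‖ₑ * ‖b‖ₑ) ≤ ENNReal.ofReal M * ‖a‖ₑ ^ 2 + ENNReal.ofReal M⁻¹ * ‖b‖ₑ ^ 2 := by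
  rw [← ofReal_norm, ← ofReal_norm, ← ENNReal.ofReal_mul (norm_nonneg _),
    ← ENNReal.ofReal_pow (norm_nonneg _), ← ENNReal.ofReal_pow (norm_nonneg _),
    ← ENNReal.ofReal_mul hM.le, ← ENNReal.ofReal_mul (inv_nonneg.2 hM.le),
    ← ENNReal.ofReal_add (by positivity) (by positivity),
    show (2 : ℝ≥0∞) = ENNReal.ofReal 2 by simp, ← ENNReal.ofReal_mul (by norm_num)]
  refine ENNReal.ofReal_le_ofReal ?_
  have h : 0 ≤ M⁻¹ * (M * ‖a‖ - ‖b‖) ^ 2 := by positivity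
  have h2 : M⁻¹ * (M * ‖a‖ - ‖b‖) ^ 2 =
      M * ‖a‖ ^ 2 + M⁻¹ * ‖b‖ ^ 2 - 2 * (‖a‖ * ‖b‖) := by
    field_simp
    ring
  linarith

/-- Fubini with a bounded kernel; it serves to move T and its adjoint across the pairing without
constructing them as operators. -/
theorem integral_kernel_swap {k : X → Y → ℂ} (hk : StronglyMeasurable (Function.uncurry k))
    {B : ℝ} (hB : ∀ x y, ‖k x y‖ ≤ B) {g : X → ℂ} {p : Y → ℂ} (hg : Integrable g μ)
    (hp : Integrable p ν) :
    ∫ x, g x * ∫ y, k x y * p y ∂ν ∂μ = ∫ y, (∫ x, g x * k x y ∂μ) * p y ∂ν := by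
  have hint : Integrable (Function.uncurry fun x y => g x * (k x y * p y)) (μ.prod ν) := by
    have h1 := hg.mul_prod hp
    refine (h1.bdd_mul (c := B) hk.aestronglyMeasurable (ae_of_all _ fun z => hB z.1 z.2)).congr
      (ae_of_all _ fun z => ?_)
    simp only [Function.uncurry]
    ring
  simp_rw [← integral_const_mul, ← integral_mul_const]
  rw [integral_integral_swap hint]
  simp_rw [mul_assoc]

/-- The `TT*` method: a Schur bound for the kernel of `TT*` bounds `T` on `L²`. -/
theorem lintegral_sq_le_of_TTstar {k : X → Y → ℂ} (hk : StronglyMeasurable (Function.uncurry k))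
    {B : ℝ} (hB : ∀ x y, ‖k x y‖ ≤ B) {S : Set Y} (hS : ν S < ⊤)
    (hsupp : ∀ x, ∀ y ∉ S, k x y = 0) {M : ℝ} (hM0 : 0 < M)
    (hM : ∀ x, ∫⁻ x', ‖∫ y, conj (k x' y) * k x y ∂ν‖ₑ ∂μ ≤ ENNReal.ofReal M)
    {f : Y → ℂ} (hf : Integrable f ν) :
    ∫⁻ x, ‖∫ y, k x y * f y ∂ν‖ₑ ^ 2 ∂μ ≤ ENNReal.ofReal M * ∫⁻ y, ‖f y‖ₑ ^ 2 ∂ν := by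
  wlog hfm : StronglyMeasurable f generalizing f
  · have h1 := this (hf.congr hf.aestronglyMeasurable.ae_eq_mk)
      hf.aestronglyMeasurable.stronglyMeasurable_mk
    have h2 : ∀ x, ∫ y, k x y * f y ∂ν = ∫ y, k x y * hf.aestronglyMeasurable.mk f y ∂ν :=
      fun x => integral_congr_ae (hf.aestronglyMeasurable.ae_eq_mk.mono fun y hy => by
        simp only [← hy])
    simp_rw [h2]
    refine h1.trans_eq ?_
    congr 1
    exact lintegral_congr_ae (hf.aestronglyMeasurable.ae_eq_mk.mono fun y hy => by
        simp only [← hy])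
  set h : X → ℂ := fun x => ∫ y, k x y * f y ∂ν with hh
  have hhm : StronglyMeasurable h :=
    StronglyMeasurable.integral_prod_right
      (f := fun x y => k x y * f y) (hk.mul (hfm.comp_measurable measurable_snd))
  set H : ℝ := ∫ y, B * ‖f y‖ ∂ν with hHdef
  have hhb : ∀ x, ‖h x‖ ≤ H := fun x => by
    refine norm_integral_le_of_norm_le (hf.norm.const_mul B) (ae_of_all _ fun y => ?_)
    rw [norm_mul]
    exact mul_le_mul_of_nonneg_right (hB x y) (norm_nonneg _)
  have hkconj : StronglyMeasurable (Function.uncurry fun x y => conj (k x y)) :=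
    Complex.continuous_conj.comp_stronglyMeasurable hk
  have hkint : ∀ x, Integrable (k x) ν := fun x => by
    have hkx : StronglyMeasurable (k x) := hk.comp_measurable measurable_prodMk_left
    have h1 : IntegrableOn (k x) S ν := by
      refine Measure.integrableOn_of_bounded hS.ne hkx.aestronglyMeasurable (M := B)
        (ae_of_all _ fun y => hB x y)
    exact (integrableOn_iff_integrable_of_support_subset fun y hy => by
      by_contra hc; exact hy (hsupp x y hc)).1 h1
  -- Truncating Tf to a set of finite measure makes its L² norm A finite, so that A can be
  -- subtracted at the end; D then exhausts X.
  have key : ∀ D : Set X, MeasurableSet D → μ D < ⊤ →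
      ∫⁻ x in D, ‖h x‖ₑ ^ 2 ∂μ ≤ ENNReal.ofReal M * ∫⁻ y, ‖f y‖ₑ ^ 2 ∂ν := by
    intro D hD hDfin
    set g : X → ℂ := D.indicator h with hg
    have hgm : StronglyMeasurable g := hhm.indicator hD
    have hgb : ∀ x, ‖g x‖ ≤ H := fun x => by
      rw [hg, norm_indicator_eq_indicator_norm]
      by_cases hx : x ∈ D
      · simpa [hx] using hhb x
      · simpa [hx] using (norm_nonneg _).trans (hhb x)
    have hgi : Integrable g μ := by
      rw [hg, integrable_indicator_iff hD]
      exact Measure.integrableOn_of_bounded hDfin.ne hhm.aestronglyMeasurable (M := H)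
        (ae_of_all _ hhb)
    have hgci : Integrable (fun x => conj (g x)) μ :=
      Complex.conjLIE.integrable_comp_iff.2 hgi
    set A : ℝ≥0∞ := ∫⁻ x, ‖g x‖ₑ ^ 2 ∂μ with hA
    have hAD : A = ∫⁻ x in D, ‖h x‖ₑ ^ 2 ∂μ := by
      rw [hA, ← lintegral_indicator hD]
      refine lintegral_congr fun x => ?_
      by_cases hx : x ∈ D <;> simp [hg, hx]
    have hgsq := Integrable.norm_sq_of_bdd hgi hgb
    have hAfin : A ≠ ⊤ := by
      rw [hA, ofReal_integral_norm_sq hgsq]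
      exact enorm_ne_top
    set P : Y → ℂ := fun y => ∫ x, conj (g x) * k x y ∂μ with hP
    have hPm : StronglyMeasurable P :=
      StronglyMeasurable.integral_prod_left
        (f := fun x y => conj (g x) * k x y)
        ((Complex.continuous_conj.comp_stronglyMeasurable
          (hgm.comp_measurable measurable_fst)).mul hk)
    set H' : ℝ := ∫ x, ‖g x‖ * B ∂μ with hH'
    have hPb : ∀ y, ‖P y‖ ≤ H' := fun y => by
      refine norm_integral_le_of_norm_le (hgi.norm.mul_const B) (ae_of_all _ fun x => ?_)
      rw [norm_mul, RCLike.norm_conj]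
      exact mul_le_mul_of_nonneg_left (hB x y) (norm_nonneg _)
    have hPi : Integrable P ν := by
      have h1 : IntegrableOn P S ν :=
        Measure.integrableOn_of_bounded hS.ne hPm.aestronglyMeasurable (M := H')
          (ae_of_all _ fun y => hPb y)
      refine (integrableOn_iff_integrable_of_support_subset fun y hy => ?_).1 h1
      by_contra hc
      exact hy (by simp [hP, hsupp _ y hc])
    have hPci : Integrable (fun y => conj (P y)) ν := Complex.conjLIE.integrable_comp_iff.2 hPi
    have step1 : A ≤ ∫⁻ y, ‖P y‖ₑ * ‖f y‖ₑ ∂ν := by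
      have e : ∫ x, conj (g x) * g x ∂μ = ∫ y, P y * f y ∂ν := by
        rw [hP, ← integral_kernel_swap hk hB hgci hf]
        refine integral_congr_ae (ae_of_all _ fun x => ?_)
        by_cases hx : x ∈ D <;> simp [hg, hx, hh]
      rw [hA, ofReal_integral_norm_sq hgsq, e]
      refine (enorm_integral_le_lintegral_enorm _).trans_eq ?_
      simp_rw [enorm_mul]
    -- P is the conjugate of T*g, so ‖P‖² is the quadratic form of TT* at g. Schur's test needs the
    -- kernel bound in one variable only, because K is Hermitian.
    have step2 : ∫⁻ y, ‖P y‖ₑ ^ 2 ∂ν ≤ ENNReal.ofReal M * A := by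
      set K : X → X → ℂ := fun x x' => ∫ y, conj (k x' y) * k x y ∂ν with hK
      have hKm : StronglyMeasurable (Function.uncurry K) := by
        have h3 : StronglyMeasurable (Function.uncurry
            fun (z : X × X) (y : Y) => conj (k z.2 y) * k z.1 y) := by
          refine (hkconj.comp_measurable
            ((measurable_snd.comp measurable_fst).prodMk measurable_snd)).mul (hk.comp_measurable
            ((measurable_fst.comp measurable_fst).prodMk measurable_snd))
        exact h3.integral_prod_right
      have hKsymm : ∀ x x', ‖K x x'‖ₑ = ‖K x' x‖ₑ := fun x x' => by
        have : K x x' = conj (K x' x) := by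
          rw [hK]
          simp only
          rw [← integral_conj]
          refine integral_congr_ae (ae_of_all _ fun y => ?_)
          simp [mul_comm]
        rw [this, ← ofReal_norm, RCLike.norm_conj, ofReal_norm]
      have e : ∫ y, conj (P y) * P y ∂ν = ∫ x, conj (g x) * ∫ x', g x' * K x x' ∂μ ∂μ := by
        have e1 : ∫ y, conj (P y) * P y ∂ν = ∫ y, P y * conj (P y) ∂ν := by simp_rw [mul_comm]
        rw [e1]
        have e2 := integral_kernel_swap hk hB hgci hPci
        rw [← e2]
        refine integral_congr_ae (ae_of_all _ fun x => ?_)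
        simp only
        congr 1
        have e3 := integral_kernel_swap hkconj (fun x y => (RCLike.norm_conj _).trans_le (hB x y))
          hgi (hkint x)
        rw [hK, e3]
        refine integral_congr_ae (ae_of_all _ fun y => ?_)
        simp only [hP]
        rw [mul_comm, ← integral_conj]
        simp
      rw [ofReal_integral_norm_sq (Integrable.norm_sq_of_bdd hPi hPb), e]
      have e4 : ‖∫ x, conj (g x) * ∫ x', g x' * K x x' ∂μ ∂μ‖ₑ ≤
          ∫⁻ x, ∫⁻ x', ‖g x‖ₑ * ‖g x'‖ₑ * ‖K x x'‖ₑ ∂μ ∂μ := by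
        refine (enorm_integral_le_lintegral_enorm _).trans (lintegral_mono fun x => ?_)
        rw [enorm_mul, ← ofReal_norm, RCLike.norm_conj, ofReal_norm]
        have : ∀ x', ‖g x‖ₑ * ‖g x'‖ₑ * ‖K x x'‖ₑ = ‖g x‖ₑ * ‖g x' * K x x'‖ₑ := fun x' => by
          rw [enorm_mul, mul_assoc]
        simp_rw [this]
        rw [lintegral_const_mul' _ _ enorm_ne_top]
        gcongr
        exact enorm_integral_le_lintegral_enorm _
      refine e4.trans ?_
      have hgE : Measurable fun x => ‖g x‖ₑ := hgm.measurable.enorm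
      have hKE : Measurable (Function.uncurry fun x x' => ‖K x x'‖ₑ) := hKm.measurable.enorm
      have e5 : ∫⁻ x, ∫⁻ x', ‖g x‖ₑ ^ 2 * ‖K x x'‖ₑ ∂μ ∂μ ≤ ENNReal.ofReal M * A := by
        have : ∀ x, ∫⁻ x', ‖g x‖ₑ ^ 2 * ‖K x x'‖ₑ ∂μ ≤ ‖g x‖ₑ ^ 2 * ENNReal.ofReal M :=
          fun x => by
            rw [lintegral_const_mul' _ _ (ENNReal.pow_ne_top enorm_ne_top)]
            gcongr
            exact hM x
        refine (lintegral_mono this).trans_eq ?_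
        rw [lintegral_mul_const _ (hgE.pow_const 2), mul_comm]
      have e6 : ∫⁻ x, ∫⁻ x', ‖g x'‖ₑ ^ 2 * ‖K x x'‖ₑ ∂μ ∂μ ≤ ENNReal.ofReal M * A := by
        rw [lintegral_lintegral_swap]
        · exact (lintegral_congr fun y => lintegral_congr fun x => by rw [hKsymm x y]).trans_le e5
        · exact (((hgE.comp measurable_snd).pow_const 2).mul hKE).aemeasurable
      have e7 : 2 * ∫⁻ x, ∫⁻ x', ‖g x‖ₑ * ‖g x'‖ₑ * ‖K x x'‖ₑ ∂μ ∂μ ≤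
          2 * (ENNReal.ofReal M * A) := by
        have e8 : ∀ x x', 2 * (‖g x‖ₑ * ‖g x'‖ₑ * ‖K x x'‖ₑ) ≤
            ‖g x‖ₑ ^ 2 * ‖K x x'‖ₑ + ‖g x'‖ₑ ^ 2 * ‖K x x'‖ₑ := fun x x' => by
          have := two_mul_enorm_mul_le (g x) (g x') one_pos
          simp only [inv_one, ENNReal.ofReal_one, one_mul] at this
          rw [← add_mul, ← mul_assoc]
          gcongr
        rw [← lintegral_const_mul' _ _ (by simp)]
        simp_rw [fun x => (lintegral_const_mul' (μ := μ) 2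
          (fun x' => ‖g x‖ₑ * ‖g x'‖ₑ * ‖K x x'‖ₑ) (by simp)).symm]
        refine (lintegral_mono fun x => lintegral_mono fun x' => e8 x x').trans ?_
        have hm1 : ∀ x, Measurable fun x' => ‖g x‖ₑ ^ 2 * ‖K x x'‖ₑ := fun x =>
          (hKE.comp measurable_prodMk_left).const_mul _
        simp_rw [fun x => lintegral_add_left (μ := μ) (hm1 x) (fun x' => ‖g x'‖ₑ ^ 2 * ‖K x x'‖ₑ)]
        rw [lintegral_add_left, two_mul]
        · exact add_le_add e5 e6
        · exact Measurable.lintegral_prod_right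
            (f := fun x x' => ‖g x‖ₑ ^ 2 * ‖K x x'‖ₑ)
            (((hgE.comp measurable_fst).pow_const 2).mul hKE)
      exact (ENNReal.mul_le_mul_iff_right (by simp) (by simp)).1 e7
    rw [← hAD]
    -- The weight M in the arithmetic-geometric inequality is chosen so that the term M⁻¹‖P‖² is at
    -- most A, which is absorbed on the left.
    have step3 : A + A ≤ ENNReal.ofReal M * ∫⁻ y, ‖f y‖ₑ ^ 2 ∂ν + A := by
      calc A + A = 2 * A := (two_mul A).symm
        _ ≤ 2 * ∫⁻ y, ‖P y‖ₑ * ‖f y‖ₑ ∂ν := by gcongr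
        _ = ∫⁻ y, 2 * (‖f y‖ₑ * ‖P y‖ₑ) ∂ν := by
          rw [← lintegral_const_mul' _ _ (by simp)]
          simp_rw [mul_comm ‖P _‖ₑ]
        _ ≤ ∫⁻ y, (ENNReal.ofReal M * ‖f y‖ₑ ^ 2 + ENNReal.ofReal M⁻¹ * ‖P y‖ₑ ^ 2) ∂ν :=
          lintegral_mono fun y => two_mul_enorm_mul_le _ _ hM0
        _ = ENNReal.ofReal M * ∫⁻ y, ‖f y‖ₑ ^ 2 ∂ν +
            ENNReal.ofReal M⁻¹ * ∫⁻ y, ‖P y‖ₑ ^ 2 ∂ν := by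
          rw [lintegral_add_left ((hfm.measurable.enorm.pow_const 2).const_mul _),
            lintegral_const_mul' _ _ (by simp), lintegral_const_mul' _ _ (by simp)]
        _ ≤ ENNReal.ofReal M * ∫⁻ y, ‖f y‖ₑ ^ 2 ∂ν +
            ENNReal.ofReal M⁻¹ * (ENNReal.ofReal M * A) := by gcongr
        _ = _ := by
          rw [← mul_assoc, ← ENNReal.ofReal_mul (inv_nonneg.2 hM0.le), inv_mul_cancel₀ hM0.ne',
            ENNReal.ofReal_one, one_mul]
    exact (ENNReal.add_le_add_iff_right hAfin).1 step3
  have huniv := iUnion_spanningSets μ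
  rw [← setLIntegral_univ, ← huniv, setLIntegral_iUnion_of_directed _
    (monotone_spanningSets μ).directed_le]
  exact iSup_le fun n => key _ (measurableSet_spanningSets μ n) (measure_spanningSets_lt_top μ n)

end TTstar

end RoughFIO

namespace RoughFIO

open Filter Topology
open scoped ENNReal ComplexConjugate

/-! ### The estimate at a single frequency scale. -/

section OscillatoryPieces

theorem lintegral_scaled_bracket (n : ℕ) : ∃ C : ℝ, 0 < C ∧ ∀ (t : ℝ), 0 < t → ∀ x : Rn n,
    ∫⁻ y : Rn n, ENNReal.ofReal ((1 + ‖x - y‖ / t) ^ (-(n + 1 : ℝ))) ≤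
      ENNReal.ofReal (C * t ^ n) := by
  set I : ℝ≥0∞ := ∫⁻ z : Rn n, ENNReal.ofReal ((1 + ‖z‖) ^ (-(n + 1 : ℝ))) with hI
  have hfin : I < ⊤ := finite_integral_one_add_norm (by simp)
  refine ⟨I.toReal + 1, by positivity, fun t ht x => ?_⟩
  have hm : Measurable fun z : Rn n => ENNReal.ofReal ((1 + ‖z‖) ^ (-(n + 1 : ℝ))) := by fun_prop
  have h1 : ∫⁻ y : Rn n, ENNReal.ofReal ((1 + ‖x - y‖ / t) ^ (-(n + 1 : ℝ))) =
      ∫⁻ y : Rn n, ENNReal.ofReal ((1 + ‖t⁻¹ • y‖) ^ (-(n + 1 : ℝ))) := by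
    rw [← lintegral_sub_left_eq_self _ x]
    refine lintegral_congr fun y => ?_
    rw [norm_smul, norm_inv, Real.norm_of_nonneg ht.le, div_eq_inv_mul, sub_sub_cancel]
  have h2 := lintegral_map (μ := (volume : Measure (Rn n))) hm (measurable_const_smul t⁻¹)
  rw [h1, ← h2, Measure.map_addHaar_smul _ (inv_ne_zero ht.ne'), lintegral_smul_measure, ← hI]
  rw [smul_eq_mul, ← ENNReal.ofReal_toReal hfin.ne, ← ENNReal.ofReal_mul (abs_nonneg _)]
  refine ENNReal.ofReal_le_ofReal ?_
  rw [finrank_euclideanSpace_fin, inv_pow, inv_inv, abs_of_pos (pow_pos ht n), mul_comm,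
    ENNReal.toReal_ofReal ENNReal.toReal_nonneg]
  gcongr
  linarith

/-- For R ≤ t one has 1 + R/t ≤ 2 and the trivial bound suffices; for R ≥ t one has 1 + R/t ≤ 2R/t
and the decay is used. Either case loses 2^{n+1}. -/
theorem min_one_div_pow_le {R t : ℝ} (hR : 0 < R) (ht : 0 < t) (n : ℕ) {K a : ℝ} (ha : 0 ≤ a)
    (h1 : K ≤ a) (h2 : K ≤ a * (t / R) ^ (n + 1)) :
    K ≤ a * 2 ^ (n + 1) * (1 + R / t) ^ (-(n + 1 : ℝ)) := by
  have hpos : 0 < 1 + R / t := by positivity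
  have e : (1 + R / t) ^ (-(n + 1 : ℝ)) = ((1 + R / t)⁻¹) ^ (n + 1) := by
    rw [Real.rpow_neg hpos.le, inv_pow]
    norm_cast
  rw [e, mul_assoc, ← mul_pow]
  rcases le_total R t with h | h
  · refine h1.trans (le_mul_of_one_le_right ha (one_le_pow₀ ?_))
    rw [← div_eq_mul_inv, one_le_div hpos]
    have : R / t ≤ 1 := (div_le_one ht).2 h
    linarith
  · refine h2.trans (mul_le_mul_of_nonneg_left (pow_le_pow_left₀ (by positivity) ?_ _) ha)
    rw [← div_eq_mul_inv, div_le_div_iff₀ hR hpos]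
    have : t * (1 + R / t) = t + R := by field_simp
    linarith

/-- The TT* kernel is at most a constant times A² Vol (1+|x-y|/t)^{-(n+1)}: the trivial bound near
the diagonal, nonstationary phase with R = |x-y| away from it. The last factor integrates to a
multiple of tⁿ. Both x and y belong to the index of the family, which is how uniformity without any
regularity in x is obtained. -/
theorem oscillatory_bound {ι : Type*} {n : ℕ} {S : ι → Set (Rn n)} {t A Vol : ι → ℝ}
    {φ : ι → Rn n → Rn n → ℝ} {b : ι → Rn n → Rn n → ℂ}
    (ht : ∀ i, 0 < t i) (hA : ∀ i, 0 < A i) (hVol : ∀ i, 0 < Vol i)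
    (hS : ∀ i, volume (S i) ≤ ENNReal.ofReal (Vol i))
    (hbm : ∀ i, StronglyMeasurable (Function.uncurry fun x ξ =>
      b i x ξ * Complex.exp (Complex.I * (φ i x ξ : ℝ))))
    (hb : ∀ N, SymFam (fun p : ι × Rn n => S p.1) (fun p => t p.1) (fun p => A p.1) N
      (fun p => b p.1 p.2))
    (hbc : ∀ i x, HasCompactSupport (b i x)) (hbS : ∀ i x, tsupport (b i x) ⊆ S i)
    (hφ : ∀ i x, ∀ ξ ∈ S i, ContDiffAt ℝ 2 (φ i x) ξ)
    (hgrad : ∀ N (k : Fin n), SymFam (fun p : ι × Rn n × Rn n => S p.1) (fun p => t p.1)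
      (fun p => ‖p.2.1 - p.2.2‖) N (fun p ξ => fderiv ℝ (fun η => φ p.1 p.2.1 η - φ p.1 p.2.2 η) ξ
        (EuclideanSpace.single k 1)))
    {c : ℝ} (hc : 0 < c) (hq : ∀ i x y, ∀ ξ ∈ S i, c * ‖x - y‖ ^ 2 ≤
      ∑ k : Fin n, fderiv ℝ (fun η => φ i x η - φ i y η) ξ (EuclideanSpace.single k 1) ^ 2) :
    ∃ C : ℝ, 0 < C ∧ ∀ i, ∀ f : Rn n → ℂ, Integrable f →
      ∫⁻ x, ‖∫ ξ, b i x ξ * Complex.exp (Complex.I * (φ i x ξ : ℝ)) * f ξ‖ₑ ^ 2 ≤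
        ENNReal.ofReal (C * A i ^ 2 * Vol i * t i ^ n) * ∫⁻ ξ, ‖f ξ‖ₑ ^ 2 := by
  obtain ⟨C₀, hC₀, hI⟩ := lintegral_scaled_bracket n
  obtain ⟨C₁, hC₁, hb1⟩ := (hb 0).norm_le
  -- Nonstationary phase requires R > 0, so the diagonal x = y is left out and treated by the
  -- trivial bound.
  let κ := {p : ι × Rn n × Rn n // p.2.1 ≠ p.2.2}
  obtain ⟨C₂, hC₂, hb2⟩ := nonstationary_phase (ι := κ) (μ := (volume : Measure (Rn n)))
    (fun k : Fin n => EuclideanSpace.single k (1 : ℝ))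
    (S := fun p => S p.1.1) (t := fun p => t p.1.1) (R := fun p => ‖p.1.2.1 - p.1.2.2‖)
    (Vol := fun p => Vol p.1.1) (Ψ := fun p ξ => φ p.1.1 p.1.2.1 ξ - φ p.1.1 p.1.2.2 ξ)
    (fun p => (ht _).le) (fun p => norm_pos_iff.2 (sub_ne_zero.2 p.2)) (fun p => (hVol _).le)
    (fun p => hS _) (fun p ξ hξ => (hφ _ _ ξ hξ).sub (hφ _ _ ξ hξ))
    (fun N k => (hgrad N k).reindex (fun p : κ => p.1)) hc
    (fun p ξ hξ => hq _ _ _ ξ hξ) (n + 1) (fun p => A p.1.1 * A p.1.1)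
    (fun p ξ => b p.1.1 p.1.2.1 ξ * conj (b p.1.1 p.1.2.2 ξ))
    (fun p => mul_self_nonneg _)
    (((hb (n + 1)).reindex (fun p : κ => (p.1.1, p.1.2.1))).mul
      (((hb (n + 1)).reindex (fun p : κ => (p.1.1, p.1.2.2))).clm
        (Complex.conjCLE : ℂ →L[ℝ] ℂ)))
    (fun p => (hbc _ _).mul_right) (fun p => (tsupport_mul_subset_left).trans (hbS _ _))
  set a : ℝ := C₁ ^ 2 + C₂ + 1 with ha
  have ha0 : 0 < a := by positivity
  refine ⟨a * 2 ^ (n + 1) * C₀, by positivity, fun i f hf => ?_⟩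
  set k : Rn n → Rn n → ℂ := fun x ξ => b i x ξ * Complex.exp (Complex.I * (φ i x ξ : ℝ)) with hk
  have hnorm : ∀ x ξ, ‖k x ξ‖ = ‖b i x ξ‖ := fun x ξ => by
    rw [hk, norm_mul, mul_comm Complex.I, Complex.norm_exp_ofReal_mul_I, mul_one]
  have hsupp : ∀ x, ∀ ξ ∉ S i, b i x ξ = 0 := fun x ξ hξ =>
    image_eq_zero_of_notMem_tsupport fun h => hξ (hbS i x h)
  have hbd : ∀ x ξ, ‖b i x ξ‖ ≤ C₁ * A i := fun x ξ => by
    by_cases hξ : ξ ∈ S i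
    · exact hb1 (i, x) ξ hξ
    · rw [hsupp x ξ hξ, norm_zero]
      exact mul_nonneg hC₁ (hA i).le
  have hSfin : volume (S i) < ⊤ := (hS i).trans_lt ENNReal.ofReal_lt_top
  set W : ℝ := a * (A i ^ 2 * Vol i) with hW
  have hW0 : 0 < W := by
    have := hA i
    have := hVol i
    positivity
  have hker : ∀ x x', ‖∫ ξ, conj (k x' ξ) * k x ξ‖ ≤
      W * 2 ^ (n + 1) * (1 + ‖x - x'‖ / t i) ^ (-(n + 1 : ℝ)) := fun x x' => by
    have htriv : ‖∫ ξ, conj (k x' ξ) * k x ξ‖ ≤ W := by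
      have h0 : ∀ ξ, ξ ∉ S i → conj (k x' ξ) * k x ξ = 0 := fun ξ hξ => by
        simp [hk, hsupp x ξ hξ]
      rw [← setIntegral_eq_integral_of_forall_compl_eq_zero h0]
      refine (norm_setIntegral_le_of_norm_le_const hSfin (C := (C₁ * A i) * (C₁ * A i))
        fun ξ _ => ?_).trans ?_
      · rw [norm_mul, RCLike.norm_conj, hnorm, hnorm]
        exact mul_le_mul (hbd _ _) (hbd _ _) (norm_nonneg _) (mul_nonneg hC₁ (hA i).le)
      · have h1 : (volume.real (S i)) ≤ Vol i := ENNReal.toReal_le_of_le_ofReal (hVol i).le (hS i)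
        calc _ ≤ (C₁ * A i) * (C₁ * A i) * Vol i := by
              exact mul_le_mul_of_nonneg_left h1 (mul_self_nonneg _)
          _ = C₁ ^ 2 * (A i ^ 2 * Vol i) := by ring
          _ ≤ W := by
            rw [hW]
            have := (hVol i).le
            gcongr
            rw [ha]
            linarith
    rcases eq_or_ne x x' with rfl | hx
    · refine htriv.trans ?_
      simp only [sub_self, norm_zero, zero_div, add_zero, Real.one_rpow, mul_one]
      exact le_mul_of_one_le_right hW0.le (one_le_pow₀ (by norm_num))
    · refine min_one_div_pow_le (norm_pos_iff.2 (sub_ne_zero.2 hx)) (ht i) n hW0.le htriv ?_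
      have h1 := hb2 ⟨(i, x, x'), hx⟩
      simp only at h1
      have h2 : ∀ ξ, conj (k x' ξ) * k x ξ = Complex.exp (Complex.I * ((φ i x ξ - φ i x' ξ : ℝ))) *
          (b i x ξ * conj (b i x' ξ)) := fun ξ => by
        rw [hk]
        simp only [map_mul, ← Complex.exp_conj, Complex.conj_I, Complex.conj_ofReal]
        rw [Complex.ofReal_sub, mul_sub, sub_eq_add_neg, Complex.exp_add, ← neg_mul]
        ring
      simp_rw [h2]
      refine h1.trans ?_
      have h3 : 0 ≤ (t i / ‖x - x'‖) ^ (n + 1) := by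
        have := (ht i).le
        positivity
      refine mul_le_mul_of_nonneg_right ?_ h3
      rw [hW, mul_assoc, ← pow_two]
      have := (hVol i).le
      gcongr
      rw [ha]
      nlinarith [sq_nonneg C₁]
  have hMpos : 0 < W * 2 ^ (n + 1) * (C₀ * t i ^ n) := by
    have := ht i
    positivity
  refine (lintegral_sq_le_of_TTstar (k := k) (hbm i) (fun x ξ => (hnorm x ξ).trans_le (hbd x ξ))
    hSfin (fun x ξ hξ => by simp [hk, hsupp x ξ hξ]) hMpos (fun x => ?_) hf).trans_eq ?_
  · calc ∫⁻ x', ‖∫ ξ, conj (k x' ξ) * k x ξ‖ₑ ≤ ∫⁻ x', ENNReal.ofReal (W * 2 ^ (n + 1)) *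
          ENNReal.ofReal ((1 + ‖x - x'‖ / t i) ^ (-(n + 1 : ℝ))) := by
          refine lintegral_mono fun x' => ?_
          rw [← ENNReal.ofReal_mul (by positivity), ← ofReal_norm]
          exact ENNReal.ofReal_le_ofReal (hker x x')
      _ ≤ _ := by
        rw [lintegral_const_mul' _ _ ENNReal.ofReal_ne_top,
          ENNReal.ofReal_mul (p := W * 2 ^ (n + 1)) (by positivity)]
        exact mul_le_mul_right (hI _ (ht i) x) _
  · congr 2
    rw [hW]
    ring

end OscillatoryPieces

end RoughFIO

namespace RoughFIO

open Filter Topology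

/-! ### A global inverse function theorem with constants. -/

section Hadamard

variable {E : Type*} [NormedAddCommGroup E] [NormedSpace ℝ E] [FiniteDimensional ℝ E]

/-- A quantitative global inverse function theorem, proved by a damped Newton iteration. -/
theorem norm_sub_le_of_fderiv_bounded_below {F : E → E} {F' : E → E →L[ℝ] E}
    (hF : ∀ x, HasFDerivAt F (F' x) x) {B : ℝ} (hB : 0 ≤ B)
    (hLip : ∀ x y, ‖F' x - F' y‖ ≤ B * ‖x - y‖) {c : ℝ} (hc : 0 < c)
    (hbelow : ∀ x v, c * ‖v‖ ≤ ‖F' x v‖) (x y : E) : ‖x - y‖ ≤ 2 * c⁻¹ * ‖F x - F y‖ := by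
  have : CompleteSpace E := FiniteDimensional.complete ℝ E
  have hTaylor : ∀ x v, ‖F (x + v) - F x - F' x v‖ ≤ B * ‖v‖ ^ 2 := fun x v => by
    have h := (convex_closedBall x ‖v‖).norm_image_sub_le_of_norm_hasFDerivWithin_le'
      (f := F) (f' := F') (φ := F' x) (C := B * ‖v‖) (x := x) (y := x + v)
      (fun z _ => (hF z).hasFDerivWithinAt) (fun z hz => (hLip z x).trans
        (mul_le_mul_of_nonneg_left (by simpa [dist_eq_norm] using hz) hB)) (by simp) (by simp)
    simpa [pow_two, mul_assoc] using h
  -- Two preimages of one value closer than c/(B+1) coincide, because the quadratic Taylor error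
  -- cannot cancel the linear term. The radius does not depend on the point.
  have hlocinj : ∀ z z', F z = F z' → ‖z - z'‖ < c / (B + 1) → z = z' := fun z z' h1 h2 => by
    have h3 := hTaylor z' (z - z')
    rw [add_sub_cancel, h1, sub_self, zero_sub, norm_neg] at h3
    have h4 := (hbelow z' (z - z')).trans h3
    by_contra hne
    have hpos : 0 < ‖z - z'‖ := norm_pos_iff.2 (sub_ne_zero.2 hne)
    have h5 : c ≤ B * ‖z - z'‖ := by
      rw [pow_two, ← mul_assoc] at h4
      exact le_of_mul_le_mul_right h4 hpos
    have h6 := (lt_div_iff₀ (by positivity : (0 : ℝ) < B + 1)).1 h2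
    nlinarith
  have hunit : ∀ x, IsUnit (F' x) := fun x => by
    have hinj : Function.Injective (F' x) := by
      refine (injective_iff_map_eq_zero (F' x)).2 fun v hv => ?_
      have := hbelow x v
      rw [hv, norm_zero] at this
      exact norm_le_zero_iff.1 (by nlinarith)
    let e := (LinearEquiv.ofInjectiveEndo (F' x : E →ₗ[ℝ] E) hinj).toContinuousLinearEquiv
    exact ⟨e.toUnit, by ext v; rfl⟩
  set G : E → E →L[ℝ] E := fun x => Ring.inverse (F' x) with hG
  have hFG : ∀ x w, F' x (G x w) = w := fun x w => by
    have := Ring.mul_inverse_cancel _ (hunit x)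
    exact congrArg (fun L : E →L[ℝ] E => L w) this
  have hGle : ∀ x w, ‖G x w‖ ≤ c⁻¹ * ‖w‖ := fun x w => by
    have := hbelow x (G x w)
    rw [hFG] at this
    rwa [le_inv_mul_iff₀ hc]
  have hFc : Continuous F := continuous_iff_continuousAt.2 fun x => (hF x).continuousAt
  have hF'c : Continuous F' :=
    (LipschitzWith.of_dist_le_mul (K := ⟨B, hB⟩) fun x y => by
      simpa [dist_eq_norm] using! hLip x y).continuous
  have hGc : Continuous G := continuous_iff_continuousAt.2 fun x => by
    obtain ⟨u, hu⟩ := hunit x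
    have h1 : ContinuousAt Ring.inverse (F' x) := hu ▸ NormedRing.inverse_continuousAt u
    exact h1.comp hF'c.continuousAt
  set p := F y with hp
  set w : E → E := fun x => F x - p with hw
  have hwc : Continuous w := hFc.sub continuous_const
  -- With τ‖w‖ ≤ δ the quadratic error B c⁻² (τ‖w‖)² of a Newton step is at most half of the linear
  -- decrease τ‖w‖.
  set δ : ℝ := 1 / (2 * (B * c⁻¹ ^ 2 + 1)) with hδ
  have hδ0 : 0 < δ := by positivity
  have hδB : B * c⁻¹ ^ 2 * δ ≤ 1 / 2 := by
    rw [hδ, mul_one_div, div_le_div_iff₀ (by positivity) (by norm_num)]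
    linarith
  -- The damping factor min(1, δ/‖w‖), written as a quotient so that it is visibly continuous.
  set τ : E → ℝ := fun x => δ / max δ ‖w x‖ with hτ
  have hmax : ∀ x, 0 < max δ ‖w x‖ := fun x => lt_max_of_lt_left hδ0
  have hτ0 : ∀ x, 0 < τ x := fun x => div_pos hδ0 (hmax x)
  have hτ1 : ∀ x, τ x ≤ 1 := fun x => (div_le_one (hmax x)).2 (le_max_left _ _)
  have hτw : ∀ x, τ x * ‖w x‖ ≤ δ := fun x => by
    rw [hτ, div_mul_eq_mul_div, div_le_iff₀ (hmax x)]
    exact mul_le_mul_of_nonneg_left (le_max_right _ _) hδ0.le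
  have hτc : Continuous τ := continuous_const.div (continuous_const.max hwc.norm)
    fun x => (hmax x).ne'
  set N : E → E := fun x => x - τ x • G x (w x) with hN
  have hNc : Continuous N := continuous_id.sub (hτc.smul (hGc.clm_apply hwc))
  have hstep : ∀ x, ‖N x - x‖ ≤ c⁻¹ * (τ x * ‖w x‖) := fun x => by
    rw [hN]
    simp only [sub_sub_cancel_left, norm_neg, norm_smul, Real.norm_of_nonneg (hτ0 x).le]
    have := mul_le_mul_of_nonneg_left (hGle x (w x)) (hτ0 x).le
    linarith
  have hdec : ∀ x, ‖w (N x)‖ ≤ (1 - τ x / 2) * ‖w x‖ := fun x => by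
    have h1 := hTaylor x (-(τ x • G x (w x)))
    have h2 : w (N x) = (F (x + -(τ x • G x (w x))) - F x - F' x (-(τ x • G x (w x)))) +
        (1 - τ x) • w x := by
      rw [map_neg, map_smul, hFG, hN, hw]
      simp only [sub_eq_add_neg, one_smul, add_smul, neg_smul]
      abel
    have h3 : ‖τ x • G x (w x)‖ ≤ c⁻¹ * (τ x * ‖w x‖) := by
      have := hstep x
      rwa [hN, sub_sub_cancel_left, norm_neg] at this
    rw [h2]
    refine (norm_add_le _ _).trans ?_
    rw [norm_neg] at h1
    rw [norm_smul, Real.norm_of_nonneg (sub_nonneg.2 (hτ1 x))]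
    have h4 : ‖τ x • G x (w x)‖ ^ 2 ≤ (c⁻¹ * (τ x * ‖w x‖)) ^ 2 :=
      pow_le_pow_left₀ (norm_nonneg _) h3 2
    have h5 : B * (c⁻¹ * (τ x * ‖w x‖)) ^ 2 ≤ (B * c⁻¹ ^ 2 * δ) * (τ x * ‖w x‖) := by
      have h6 : 0 ≤ B * c⁻¹ ^ 2 * (τ x * ‖w x‖) := by have := (hτ0 x).le; positivity
      nlinarith [mul_le_mul_of_nonneg_left (hτw x) h6]
    have h7 : (B * c⁻¹ ^ 2 * δ) * (τ x * ‖w x‖) ≤ 1 / 2 * (τ x * ‖w x‖) :=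
      mul_le_mul_of_nonneg_right hδB (mul_nonneg (hτ0 x).le (norm_nonneg _))
    nlinarith [mul_le_mul_of_nonneg_left h4 hB]
  -- The length of a step is controlled by the decrease of the residual, so lengths telescope along
  -- the orbit; the factor 2 is the half lost to the quadratic error.
  have hstep' : ∀ x, ‖N x - x‖ ≤ 2 * c⁻¹ * (‖w x‖ - ‖w (N x)‖) := fun x => by
    have h1 := hdec x
    have h2 : τ x * ‖w x‖ ≤ 2 * (‖w x‖ - ‖w (N x)‖) := by linarith
    refine (hstep x).trans ?_
    rw [mul_comm 2, mul_assoc]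
    exact mul_le_mul_of_nonneg_left h2 (inv_nonneg.2 hc.le)
  have hdist : ∀ x k l, ‖N^[k + l] x - N^[k] x‖ ≤
      2 * c⁻¹ * (‖w (N^[k] x)‖ - ‖w (N^[k + l] x)‖) := fun x k l => by
    induction l with
    | zero => simp
    | succ l ih =>
      have h1 := hstep' (N^[k + l] x)
      rw [← Function.iterate_succ_apply' N (k + l) x] at h1
      have h2 := norm_add_le (N^[k + l + 1] x - N^[k + l] x) (N^[k + l] x - N^[k] x)
      rw [sub_add_sub_cancel] at h2
      rw [← add_assoc]
      linarith
  -- The residual never increases along the orbit, so the damping factor never falls below its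
  -- initial value τ x, which gives a geometric rate.
  have hgeom : ∀ x k, ‖w (N^[k] x)‖ ≤ (1 - τ x / 2) ^ k * ‖w x‖ := fun x k => by
    induction k with
    | zero => simp
    | succ k ih =>
      have hr0 : 0 ≤ 1 - τ x / 2 := by linarith [hτ1 x]
      have hr1 : 1 - τ x / 2 ≤ 1 := by linarith [hτ0 x]
      have hle : ‖w (N^[k] x)‖ ≤ ‖w x‖ :=
        ih.trans (mul_le_of_le_one_left (norm_nonneg _) (pow_le_one₀ hr0 hr1))
      have hτle : τ x ≤ τ (N^[k] x) :=
        div_le_div_of_nonneg_left hδ0.le (hmax _) (max_le_max le_rfl hle)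
      rw [Function.iterate_succ_apply', pow_succ']
      refine (hdec _).trans ?_
      rw [mul_assoc]
      exact mul_le_mul (by linarith) ih (norm_nonneg _) hr0
  have hw0 : ∀ x, Tendsto (fun k => ‖w (N^[k] x)‖) atTop (𝓝 0) := fun x => by
    have h1 : Tendsto (fun k => (1 - τ x / 2) ^ k * ‖w x‖) atTop (𝓝 (0 * ‖w x‖)) :=
      (tendsto_pow_atTop_nhds_zero_of_lt_one (by linarith [hτ1 x])
        (by linarith [hτ0 x])).mul_const _
    rw [zero_mul] at h1
    exact squeeze_zero (fun k => norm_nonneg _) (hgeom x) h1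
  have hlim : ∀ x, ∃ z, Tendsto (fun k => N^[k] x) atTop (𝓝 z) := fun x => by
    refine cauchySeq_tendsto_of_complete (cauchySeq_of_le_tendsto_0'
      (fun k => 2 * c⁻¹ * ‖w (N^[k] x)‖) (fun k l hkl => ?_) ?_)
    · obtain ⟨j, rfl⟩ := Nat.exists_eq_add_of_le hkl
      rw [dist_comm, dist_eq_norm]
      refine (hdist x k j).trans ?_
      refine mul_le_mul_of_nonneg_left ?_ (by positivity)
      linarith [norm_nonneg (w (N^[k + j] x))]
    · simpa using (hw0 x).const_mul (2 * c⁻¹)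
  choose L hL using hlim
  have hFL : ∀ x, F (L x) = p := fun x => by
    have h1 : Tendsto (fun k => ‖w (N^[k] x)‖) atTop (𝓝 ‖w (L x)‖) :=
      (hwc.norm.tendsto (L x)).comp (hL x)
    have h2 := tendsto_nhds_unique h1 (hw0 x)
    exact sub_eq_zero.1 (norm_eq_zero.1 h2)
  have hLdist : ∀ x k, ‖L x - N^[k] x‖ ≤ 2 * c⁻¹ * ‖w (N^[k] x)‖ := fun x k => by
    have h1 : Tendsto (fun l => ‖N^[k + l] x - N^[k] x‖) atTop (𝓝 ‖L x - N^[k] x‖) := by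
      have h2 : Tendsto (fun l => N^[k + l] x) atTop (𝓝 (L x)) := by
        simpa only [add_comm] using (tendsto_add_atTop_iff_nat k).2 (hL x)
      exact (h2.sub_const _).norm
    refine le_of_tendsto h1 (Eventually.of_forall fun l => (hdist x k l).trans ?_)
    refine mul_le_mul_of_nonneg_left ?_ (by positivity)
    linarith [norm_nonneg (w (N^[k + l] x))]
  -- After k steps, with k fixed, the iterates from nearby starting points remain close, and each is
  -- near its own limit. Both limits solve F = p, so local injectivity identifies them. By
  -- connectedness all orbits converge to y, and the telescoped length of the orbit of x bounds |x -
  -- y|.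
  have hLconst : IsLocallyConstant L := by
    refine (IsLocallyConstant.iff_eventually_eq L).2 fun x₀ => ?_
    set r : ℝ := c / (B + 1) with hr
    have hr0 : 0 < r := by positivity
    obtain ⟨k, hk⟩ : ∃ k, 2 * c⁻¹ * ‖w (N^[k] x₀)‖ < r / 4 := by
      have h1 : Tendsto (fun k => 2 * c⁻¹ * ‖w (N^[k] x₀)‖) atTop (𝓝 0) := by
        simpa using (hw0 x₀).const_mul (2 * c⁻¹)
      exact (h1.eventually_lt_const (by positivity)).exists
    have hNk : Continuous N^[k] := hNc.iterate k
    have e1 : ∀ᶠ x in 𝓝 x₀, 2 * c⁻¹ * ‖w (N^[k] x)‖ < r / 4 :=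
      (continuous_const.mul (hwc.comp hNk).norm).continuousAt.eventually_lt continuousAt_const hk
    have e2 : ∀ᶠ x in 𝓝 x₀, ‖N^[k] x - N^[k] x₀‖ < r / 4 :=
      (hNk.sub continuous_const).norm.continuousAt.eventually_lt continuousAt_const
        (by simpa using by positivity)
    filter_upwards [e1, e2] with x h1 h2
    refine hlocinj _ _ ((hFL x).trans (hFL x₀).symm) ?_
    have h3 := hLdist x k
    have h4 := hLdist x₀ k
    have h5 : L x - L x₀ = (L x - N^[k] x) + (N^[k] x - N^[k] x₀) - (L x₀ - N^[k] x₀) := by abel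
    rw [h5]
    have h6 := norm_sub_le ((L x - N^[k] x) + (N^[k] x - N^[k] x₀)) (L x₀ - N^[k] x₀)
    have h7 := norm_add_le (L x - N^[k] x) (N^[k] x - N^[k] x₀)
    linarith
  have hLy : L y = y := by
    have h1 : N y = y := by simp [hN, hw, hp]
    have h2 : ∀ k, N^[k] y = y := fun k => Function.iterate_fixed h1 k
    have h3 := hL y
    simp_rw [h2] at h3
    exact tendsto_nhds_unique h3 tendsto_const_nhds
  have hLx : L x = y := by
    have := hLconst.apply_eq_of_preconnectedSpace x y
    rw [this, hLy]
  have h1 := hLdist x 0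
  simp only [Function.iterate_zero, id_eq] at h1
  rw [hLx, norm_sub_rev] at h1
  exact h1

end Hadamard

/-! ### Exchanging x-derivatives and ξ-derivatives. -/

section Commute

variable {E F G : Type*} [NormedAddCommGroup E] [NormedSpace ℝ E]
  [NormedAddCommGroup F] [NormedSpace ℝ F] [NormedAddCommGroup G] [NormedSpace ℝ G]

/-- Both sides are the second derivative of the joint function, restricted to one vector in each
factor; it is symmetric. -/
theorem fderiv_fderiv_comm {g : E → F → G} {x : E} {ξ : F}
    (hg : ContDiffAt ℝ 2 (Function.uncurry g) (x, ξ)) (h : E) :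
    fderiv ℝ (fun y => fderiv ℝ (g y) ξ) x h = fderiv ℝ (fun η => fderiv ℝ (fun y => g y η) x h) ξ := by
  set u : E × F → G := Function.uncurry g with hu
  have hev : ∀ᶠ p in 𝓝 (x, ξ), DifferentiableAt ℝ u p :=
    (hg.eventually (by simp)).mono fun p hp => hp.differentiableAt (by simp)
  have hd2 : DifferentiableAt ℝ (fderiv ℝ u) (x, ξ) :=
    (hg.fderiv_right (m := 1) (by norm_num)).differentiableAt (by simp)
  have h1 : ∀ y η, DifferentiableAt ℝ u (y, η) →
      fderiv ℝ (g y) η = (fderiv ℝ u (y, η)).comp (ContinuousLinearMap.inr ℝ E F) :=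
    fun y η hp => (hp.hasFDerivAt.comp η (hasFDerivAt_prodMk_right y η)).fderiv
  have h2 : ∀ y η, DifferentiableAt ℝ u (y, η) → fderiv ℝ (fun y => g y η) y =
      (fderiv ℝ u (y, η)).comp (ContinuousLinearMap.inl ℝ E F) :=
    fun y η hp => (HasFDerivAt.comp (g := u) (f := fun z => (z, η)) y hp.hasFDerivAt
      (hasFDerivAt_prodMk_left y η)).fderiv
  have e1 : (fun y => fderiv ℝ (g y) ξ) =ᶠ[𝓝 x]
      fun y => (fderiv ℝ u (y, ξ)).comp (ContinuousLinearMap.inr ℝ E F) := by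
    have : Tendsto (fun y : E => (y, ξ)) (𝓝 x) (𝓝 (x, ξ)) :=
      (Continuous.prodMk_left ξ).tendsto x
    exact (this.eventually hev).mono fun y hy => h1 y ξ hy
  have e2 : (fun η => fderiv ℝ (fun y => g y η) x h) =ᶠ[𝓝 ξ]
      fun η => fderiv ℝ u (x, η) (h, 0) := by
    have : Tendsto (fun η : F => (x, η)) (𝓝 ξ) (𝓝 (x, ξ)) :=
      (Continuous.prodMk_right x).tendsto ξ
    refine (this.eventually hev).mono fun η hη => ?_
    simp only
    rw [h2 x η hη]
    simp
  rw [e1.fderiv_eq, e2.fderiv_eq]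
  have h3 : HasFDerivAt (fun y => fderiv ℝ u (y, ξ)) ((fderiv ℝ (fderiv ℝ u) (x, ξ)).comp
      (ContinuousLinearMap.inl ℝ E F)) x :=
    hd2.hasFDerivAt.comp x (hasFDerivAt_prodMk_left x ξ)
  have h4 : HasFDerivAt (fun η => fderiv ℝ u (x, η)) ((fderiv ℝ (fderiv ℝ u) (x, ξ)).comp
      (ContinuousLinearMap.inr ℝ E F)) ξ :=
    hd2.hasFDerivAt.comp ξ (hasFDerivAt_prodMk_right x ξ)
  have hsymm : IsSymmSndFDerivAt ℝ u (x, ξ) := hg.isSymmSndFDerivAt (by simp)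
  have h5 := (ContinuousLinearMap.compL ℝ F (E × F) G).flip
    (ContinuousLinearMap.inr ℝ E F) |>.hasFDerivAt.comp x h3
  have h6 := (ContinuousLinearMap.apply ℝ G ((h, 0) : E × F)).hasFDerivAt.comp ξ h4
  have h5' := h5.fderiv
  have h6' := h6.fderiv
  simp only [Function.comp_def, ContinuousLinearMap.flip_apply, ContinuousLinearMap.compL_apply,
    ContinuousLinearMap.apply_apply] at h5' h6'
  rw [h5', h6']
  ext v
  simpa using hsymm (h, 0) (0, v)

theorem contDiffAt_fderiv_param {g : E → F → G} {p : E × F}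
    (hg : ContDiffAt ℝ ∞ (Function.uncurry g) p) :
    ContDiffAt ℝ ∞ (fun q : E × F => fderiv ℝ (g q.1) q.2) p := by
  refine ContDiffAt.fderiv (n := ∞) (f := fun (q : E × F) η => g q.1 η)
    (g := fun q => q.2) ?_ contDiffAt_snd (by simp)
  have : (Function.uncurry fun (q : E × F) η => g q.1 η) =
      Function.uncurry g ∘ fun z : (E × F) × F => (z.1.1, z.2) := rfl
  rw [this]
  exact ContDiffAt.comp (p, p.2) hg
    ((contDiffAt_fst.comp _ contDiffAt_fst).prodMk contDiffAt_snd)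

theorem contDiffAt_iteratedFDeriv_param {g : E → F → G} {U : Set (E × F)}
    (hg : ∀ p ∈ U, ContDiffAt ℝ ∞ (Function.uncurry g) p) (k : ℕ) : ∀ p ∈ U,
      ContDiffAt ℝ ∞ (fun q : E × F => iteratedFDeriv ℝ k (g q.1) q.2) p := by
  induction k with
  | zero =>
    intro p hp
    exact ((continuousMultilinearCurryFin0 ℝ F G).symm.contDiff.contDiffAt).comp p (hg p hp)
  | succ k ih =>
    intro p hp
    have h1 : ContDiffAt ℝ ∞ (fun q : E × F =>
        fderiv ℝ (fun η => iteratedFDeriv ℝ k (g q.1) η) q.2) p :=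
      contDiffAt_fderiv_param (g := fun y η => iteratedFDeriv ℝ k (g y) η) (ih p hp)
    exact ((continuousMultilinearCurryLeftEquiv ℝ (fun _ : Fin (k + 1) => F)
      G).symm.contDiff.contDiffAt).comp p h1

/-- Phase bounds are stated with the x-derivatives inside, but the mean value inequality in x needs
them outside. Induction on k, exchanging one ξ-derivative at a time; the open set U makes the
inductive identity hold near ξ, so that it can be differentiated. -/
theorem fderiv_iteratedFDeriv_comm {g : E → F → G} {U : Set (E × F)} (hU : IsOpen U)
    (hg : ∀ p ∈ U, ContDiffAt ℝ ∞ (Function.uncurry g) p) (k : ℕ) {x : E} (h : E) : ∀ {ξ : F},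
    (x, ξ) ∈ U → fderiv ℝ (fun y => iteratedFDeriv ℝ k (g y) ξ) x h =
      iteratedFDeriv ℝ k (fun η => fderiv ℝ (fun y => g y η) x h) ξ := by
  induction k with
  | zero =>
    intro ξ hξ
    set I := (continuousMultilinearCurryFin0 ℝ F G).symm with hI
    exact congrArg (fun L => L h) (I.comp_fderiv (f := fun y => g y ξ) (x := x))
  | succ k ih =>
    intro ξ hξ
    let I : (F →L[ℝ] (F [×k]→L[ℝ] G)) ≃ₗᵢ[ℝ] (F [×(k + 1)]→L[ℝ] G) :=
      (continuousMultilinearCurryLeftEquiv ℝ (fun _ : Fin (k + 1) => F) G).symm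
    have e0 : ∀ (u : F → G) η, iteratedFDeriv ℝ (k + 1) u η = I (fderiv ℝ (iteratedFDeriv ℝ k u) η) :=
      fun u η => rfl
    simp_rw [e0]
    have hgk := contDiffAt_iteratedFDeriv_param hg k
    refine (congrArg (fun L => L h) (ContinuousLinearEquiv.comp_fderiv
      (𝕜 := ℝ) (F := F [×(k + 1)]→L[ℝ] G) I.toContinuousLinearEquiv
      (f := fun y => fderiv ℝ (iteratedFDeriv ℝ k (g y)) ξ) (x := x))).trans ?_
    change I (fderiv ℝ (fun y => fderiv ℝ (iteratedFDeriv ℝ k (g y)) ξ) x h) = _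
    congr 1
    rw [fderiv_fderiv_comm (g := fun y η => iteratedFDeriv ℝ k (g y) η)
      (contDiffAt_infty.1 (hgk _ hξ) 2)]
    refine EventuallyEq.fderiv_eq ?_
    have : ∀ᶠ η in 𝓝 ξ, (x, η) ∈ U :=
      (Continuous.prodMk_right x).continuousAt.eventually (hU.mem_nhds hξ)
    exact this.mono fun η hη => ih hη

end Commute

end RoughFIO

/-! ### Consequences of the phase conditions. -/

namespace RoughFIO

open Filter Topology

theorem SymFam.of_forall {ι E F : Type*} [NormedAddCommGroup E] [NormedSpace ℝ E]
    [NormedAddCommGroup F] [NormedSpace ℝ F] {S : ι → Set E} {t A : ι → ℝ} {f : ι → E → F}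
    (hA : ∀ i, 0 ≤ A i) (ht : ∀ i, 0 ≤ t i)
    (hd : ∀ i, ∀ ξ ∈ S i, ContDiffAt ℝ ∞ (f i) ξ)
    (hb : ∀ j : ℕ, ∃ C, 0 ≤ C ∧ ∀ i, ∀ ξ ∈ S i,
      ‖iteratedFDeriv ℝ j (f i) ξ‖ ≤ C * A i * t i ^ j) (k : ℕ) : SymFam S t A k f := by
  choose C hC0 hC using hb
  refine ⟨fun i ξ hξ => contDiffAt_infty.1 (hd i ξ hξ) k, ∑ j ∈ Finset.range (k + 1), C j,
    Finset.sum_nonneg fun j _ => hC0 j, fun i ξ hξ j hj => (hC j i ξ hξ).trans ?_⟩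
  have h3 : C j ≤ ∑ j ∈ Finset.range (k + 1), C j :=
    Finset.single_le_sum (f := C) (fun j _ => hC0 j) (by simp; omega)
  have := hA i
  have := ht i
  gcongr

theorem norm_le_sum_abs {n : ℕ} (v : Rn n) : ‖v‖ ≤ ∑ i, |v i| := by
  rw [EuclideanSpace.norm_eq]
  refine Real.sqrt_le_iff.2 ⟨Finset.sum_nonneg fun i _ => abs_nonneg _, ?_⟩
  simp_rw [Real.norm_eq_abs]
  exact Finset.sum_sq_le_sq_sum_of_nonneg fun i _ => abs_nonneg _

theorem abs_apply_le_norm {n : ℕ} (v : Rn n) (i : Fin n) : |v i| ≤ ‖v‖ := by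
  simpa using PiLp.norm_apply_le v i

/-- A matrix with bounded entries and determinant bounded below is bounded below. -/
theorem mulVec_bounded_below (n : ℕ) {C c : ℝ} (hc : 0 < c) : ∃ c', 0 < c' ∧
    ∀ A : Matrix (Fin n) (Fin n) ℝ, (∀ i j, |A i j| ≤ C) → c ≤ |A.det| → ∀ v w : Rn n,
      (∀ i, w i = A.mulVec v i) → c' * ‖v‖ ≤ ‖w‖ := by
  -- Entries of the adjugate are determinants of A with one row replaced by a unit vector, hence the
  -- maximum with 1; each is at most n! Dⁿ. The bound follows from det(A) v = adj(A) A v.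
  set D : ℝ := max C 1 with hD
  set K : ℝ := (n.factorial : ℝ) * D ^ n with hK
  have hD0 : 0 < D := lt_max_of_lt_right one_pos
  have hK0 : 0 < K := by positivity
  refine ⟨c / (n * (n * K) + 1), by positivity, fun A hA hdet v w hw => ?_⟩
  have hadj : ∀ i j, |A.adjugate i j| ≤ K := fun i j => by
    rw [Matrix.adjugate_apply]
    have := Matrix.det_le (A := A.updateRow j (Pi.single i 1)) (abv := AbsoluteValue.abs) (x := D)
      (fun a b => ?_)
    · simpa [nsmul_eq_mul, hK] using this
    · rw [Matrix.updateRow_apply]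
      split_ifs
      · by_cases h : b = i
        · subst h; simp [hD]
        · simp [Pi.single_eq_of_ne h, hD0.le]
      · exact (hA a b).trans (le_max_left _ _)
  have hv : ∀ i, c * |v i| ≤ n * K * ‖w‖ := fun i => by
    have h1 : A.det * v i = (A.adjugate.mulVec (A.mulVec v)) i := by
      rw [Matrix.mulVec_mulVec, Matrix.adjugate_mul]
      simp [Matrix.smul_mulVec]
    have h2 : |(A.adjugate.mulVec (A.mulVec v)) i| ≤ ∑ j : Fin n, K * ‖w‖ := by
      rw [Matrix.mulVec, dotProduct]
      refine (Finset.abs_sum_le_sum_abs _ _).trans (Finset.sum_le_sum fun j _ => ?_)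
      rw [abs_mul, ← hw j]
      exact mul_le_mul (hadj i j) (abs_apply_le_norm w j) (abs_nonneg _) hK0.le
    rw [← h1, abs_mul] at h2
    simp only [Finset.sum_const, Finset.card_univ, Fintype.card_fin, nsmul_eq_mul] at h2
    nlinarith [mul_le_mul_of_nonneg_right hdet (abs_nonneg (v i))]
  have h3 : c * ‖v‖ ≤ n * (n * K) * ‖w‖ := by
    calc c * ‖v‖ ≤ c * ∑ i, |v i| := mul_le_mul_of_nonneg_left (norm_le_sum_abs v) hc.le
      _ = ∑ i, c * |v i| := Finset.mul_sum _ _ _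
      _ ≤ ∑ i : Fin n, n * K * ‖w‖ := Finset.sum_le_sum fun i _ => hv i
      _ = _ := by simp; ring
  rw [div_mul_eq_mul_div, div_le_iff₀ (by positivity)]
  nlinarith [norm_nonneg w]

namespace MemPhase

variable {n : ℕ} {φ : Rn n → Rn n → ℝ}

theorem isOpen_ne_zero : IsOpen {p : Rn n × Rn n | p.2 ≠ 0} :=
  isOpen_ne.preimage continuous_snd

theorem contDiffAt_uncurry (hφ : MemPhase 2 φ) (p : Rn n × Rn n)
    (hp : p ∈ {p : Rn n × Rn n | p.2 ≠ 0}) :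
    ContDiffAt ℝ ∞ (Function.uncurry φ) p :=
  hφ.smooth.contDiffAt (isOpen_ne_zero.mem_nhds hp)

theorem contDiffAt (hφ : MemPhase 2 φ) (x : Rn n) {ξ : Rn n} (hξ : ξ ≠ 0) :
    ContDiffAt ℝ ∞ (φ x) ξ :=
  (hφ.contDiffAt_uncurry (x, ξ) hξ).comp ξ (contDiffAt_const.prodMk contDiffAt_id)

theorem contDiffAt_swap (hφ : MemPhase 2 φ) (p : Rn n × Rn n)
    (hp : p ∈ {p : Rn n × Rn n | p.1 ≠ 0}) :
    ContDiffAt ℝ ∞ (Function.uncurry fun ξ x => φ x ξ) p :=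
  (hφ.contDiffAt_uncurry (p.2, p.1) hp).comp p (contDiffAt_snd.prodMk contDiffAt_fst)

theorem exists_bound (hφ : MemPhase 2 φ) (k l : ℕ) (h : 2 ≤ k + l) : ∃ C, 0 ≤ C ∧ ∀ x ξ, ξ ≠ 0 →
    ‖iteratedFDeriv ℝ k (fun η => iteratedFDeriv ℝ l (fun y => φ y η) x) ξ‖
      ≤ C * ‖ξ‖ ^ (1 - (k : ℤ)) := by
  obtain ⟨C, hC⟩ := hφ.bound k l h
  refine ⟨max C 0, le_max_right _ _, fun x ξ hξ => (hC x ξ hξ).trans ?_⟩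
  gcongr
  exact le_max_left _ _

theorem norm_iteratedFDeriv_le (hφ : MemPhase 2 φ) {k : ℕ} (hk : 2 ≤ k) : ∃ C, 0 ≤ C ∧ ∀ x ξ, ξ ≠ 0 →
    ‖iteratedFDeriv ℝ k (φ x) ξ‖ ≤ C * ‖ξ‖ ^ (1 - (k : ℤ)) := by
  obtain ⟨C, hC0, hC⟩ := hφ.exists_bound k 0 (by omega)
  refine ⟨C, hC0, fun x ξ hξ => (le_of_eq ?_).trans (hC x ξ hξ)⟩
  exact ((continuousMultilinearCurryFin0 ℝ (Rn n) ℝ).symm.norm_iteratedFDeriv_comp_left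
    (φ x) ξ k).symm

/-- Mean value inequality in x. One x-derivative and k ≥ 1 derivatives in ξ have total order at
least 2, so the difference is controlled even for k = 1, where ∇_ξφ itself may be unbounded. -/
theorem norm_iteratedFDeriv_sub_le (hφ : MemPhase 2 φ) {k : ℕ} (hk : 1 ≤ k) : ∃ C, 0 ≤ C ∧
    ∀ x y ξ, ξ ≠ 0 → ‖iteratedFDeriv ℝ k (φ x) ξ - iteratedFDeriv ℝ k (φ y) ξ‖ ≤
      C * ‖x - y‖ * ‖ξ‖ ^ (1 - (k : ℤ)) := by
  obtain ⟨C, hC0, hC⟩ := hφ.exists_bound k 1 (by omega)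
  refine ⟨C, hC0, fun x y ξ hξ => ?_⟩
  have hsm := contDiffAt_iteratedFDeriv_param hφ.contDiffAt_uncurry k
  have hd : ∀ z, DifferentiableAt ℝ (fun z => iteratedFDeriv ℝ k (φ z) ξ) z := fun z =>
    ((hsm (z, ξ) hξ).comp z (contDiffAt_id.prodMk contDiffAt_const) :
      ContDiffAt ℝ ∞ (fun z => iteratedFDeriv ℝ k (φ z) ξ) z).differentiableAt (by simp)
  have hb : ∀ z, ‖fderiv ℝ (fun z => iteratedFDeriv ℝ k (φ z) ξ) z‖ ≤
      C * ‖ξ‖ ^ (1 - (k : ℤ)) := fun z => by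
    refine ContinuousLinearMap.opNorm_le_bound _ (by positivity) fun h => ?_
    rw [fderiv_iteratedFDeriv_comm isOpen_ne_zero hφ.contDiffAt_uncurry k h (ξ := ξ) hξ]
    let L := ContinuousMultilinearMap.apply ℝ (fun _ : Fin 1 => Rn n) ℝ (fun _ => h)
    have e : (fun η => fderiv ℝ (fun y => φ y η) z h) =
        L ∘ fun η => iteratedFDeriv ℝ 1 (fun y => φ y η) z := by
      ext η
      simp [L, iteratedFDeriv_one_apply]
    have hL : ‖L‖ ≤ ‖h‖ := by
      refine ContinuousLinearMap.opNorm_le_bound _ (norm_nonneg _) fun m => ?_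
      refine (m.le_opNorm _).trans_eq ?_
      simp [mul_comm]
    have hsm' : ContDiffAt ℝ ∞ (fun η => iteratedFDeriv ℝ 1 (fun y => φ y η) z) ξ :=
      (contDiffAt_iteratedFDeriv_param hφ.contDiffAt_swap 1 (ξ, z) hξ).comp ξ
        (contDiffAt_id.prodMk contDiffAt_const)
    rw [e]
    refine (L.norm_iteratedFDeriv_comp_left hsm' (by exact_mod_cast le_top)).trans ?_
    rw [mul_comm]
    exact mul_le_mul (hC z ξ hξ) hL (norm_nonneg _) (by positivity)
  refine (convex_univ.norm_image_sub_le_of_norm_fderiv_le (fun z _ => hd z) (fun z _ => hb z)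
    (Set.mem_univ y) (Set.mem_univ x)).trans_eq ?_
  ring

theorem norm_iteratedFDeriv_fderiv_le (hφ : MemPhase 2 φ) {l : ℕ} (hl : 1 ≤ l) : ∃ C, 0 ≤ C ∧
    ∀ x ξ v, ξ ≠ 0 → ‖iteratedFDeriv ℝ l (fun y => fderiv ℝ (φ y) ξ v) x‖ ≤ C * ‖v‖ := by
  obtain ⟨C, hC0, hC⟩ := hφ.exists_bound 1 l (by omega)
  refine ⟨C, hC0, fun x ξ v hξ => ?_⟩
  have h := fderiv_iteratedFDeriv_comm (isOpen_ne.preimage continuous_fst) hφ.contDiffAt_swap l v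
    (x := ξ) (ξ := x) hξ
  rw [← h]
  refine (ContinuousLinearMap.le_opNorm _ _).trans (mul_le_mul_of_nonneg_right ?_ (norm_nonneg _))
  rw [← norm_iteratedFDeriv_one]
  simpa using hC x ξ hξ

/-- For fixed ξ, the map F(x) = ∇_ξφ(x,ξ) has the transposed mixed Hessian as Jacobian: bounded
entries and determinant bounded below, hence bounded below as a linear map. Mixed derivatives of
order one in ξ and two in x are bounded, so the Jacobian is Lipschitz. All constants are independent
of ξ because one ξ-derivative has homogeneity 0. -/
theorem gradient_bounded_below (hφ : MemPhase 2 φ) (hnd : StronglyNondegenerate φ) :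
    ∃ c, 0 < c ∧ ∀ x y ξ, ξ ≠ 0 → c * ‖x - y‖ ^ 2 ≤ ∑ k : Fin n,
      (fderiv ℝ (φ x) ξ (EuclideanSpace.single k 1) -
        fderiv ℝ (φ y) ξ (EuclideanSpace.single k 1)) ^ 2 := by
  obtain ⟨c, hc, hdet⟩ := hnd
  obtain ⟨C₁, hC₁, hb1⟩ := hφ.norm_iteratedFDeriv_fderiv_le (l := 1) le_rfl
  obtain ⟨C₂, hC₂, hb2⟩ := hφ.norm_iteratedFDeriv_fderiv_le (l := 2) (by norm_num)
  obtain ⟨c', hc', hbelow⟩ := mulVec_bounded_below n (C := C₁) hc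
  refine ⟨(2 * c'⁻¹)⁻¹ ^ 2, by positivity, fun x y ξ hξ => ?_⟩
  set g : Fin n → Rn n → ℝ := fun k x => fderiv ℝ (φ x) ξ (EuclideanSpace.single k 1) with hg
  have hgd : ∀ k z, ContDiffAt ℝ ∞ (g k) z := fun k z =>
    ((contDiffAt_fderiv_param (hφ.contDiffAt_uncurry (z, ξ) hξ)).comp z
      (contDiffAt_id.prodMk contDiffAt_const)).clm_apply contDiffAt_const
  have hgc : ∀ k, ContDiff ℝ ∞ (g k) := fun k => contDiff_iff_contDiffAt.2 (hgd k)
  set F : Rn n → Rn n := fun x => ∑ k, g k x • EuclideanSpace.single k (1 : ℝ) with hF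
  set F' : Rn n → Rn n →L[ℝ] Rn n := fun x =>
    ∑ k, (fderiv ℝ (g k) x).smulRight (EuclideanSpace.single k (1 : ℝ)) with hF'
  have hsingle : ∀ (a : Fin n → ℝ) k,
      (∑ j, a j • EuclideanSpace.single j (1 : ℝ) : Rn n) k = a k := fun a k => by
    simp [Finset.sum_apply, Pi.single_apply]
  have hFF' : ∀ x, HasFDerivAt F (F' x) x := fun x => by
    have := HasFDerivAt.fun_sum (u := Finset.univ) fun k _ =>
      (((hgd k x).differentiableAt (by simp)).hasFDerivAt.smul_const
        (EuclideanSpace.single k (1 : ℝ)))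
    exact this
  have hLip : ∀ x y, ‖F' x - F' y‖ ≤ (n * C₂) * ‖x - y‖ := fun x y => by
    rw [hF', ← Finset.sum_sub_distrib]
    refine (norm_sum_le _ _).trans ?_
    have : ∀ k, ‖(fderiv ℝ (g k) x).smulRight (EuclideanSpace.single k (1 : ℝ)) -
        (fderiv ℝ (g k) y).smulRight (EuclideanSpace.single k (1 : ℝ))‖ ≤ C₂ * ‖x - y‖ := fun k => by
      have e : (fderiv ℝ (g k) x).smulRight (EuclideanSpace.single k (1 : ℝ)) -
        (fderiv ℝ (g k) y).smulRight (EuclideanSpace.single k (1 : ℝ)) =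
          (fderiv ℝ (g k) x - fderiv ℝ (g k) y).smulRight (EuclideanSpace.single k (1 : ℝ)) := by
        ext v j
        simp only [_root_.sub_apply, ContinuousLinearMap.smulRight_apply, PiLp.sub_apply, PiLp.smul_apply,
          sub_smul]
      rw [e, ContinuousLinearMap.norm_smulRight_apply]
      simp only [PiLp.norm_single, norm_one, mul_one]
      refine convex_univ.norm_image_sub_le_of_norm_fderiv_le (𝕜 := ℝ) (f := fderiv ℝ (g k))
        (fun z _ => ?_) (fun z _ => ?_) (Set.mem_univ y) (Set.mem_univ x)
      · exact ((hgc k).fderiv_right (m := 1) (by norm_cast)).differentiable (by simp) z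
      · rw [← norm_iteratedFDeriv_one, norm_iteratedFDeriv_fderiv]
        simpa using hb2 z ξ (EuclideanSpace.single k 1) hξ
    refine (Finset.sum_le_sum fun k _ => this k).trans_eq ?_
    simp [mul_assoc]
  have hlow : ∀ x v, c' * ‖v‖ ≤ ‖F' x v‖ := fun x v => by
    refine hbelow (mixedHessian φ x ξ).transpose (fun i j => ?_) ?_ v (F' x v) fun k => ?_
    · have h1 : ‖fderiv ℝ (g i) x (EuclideanSpace.single j 1)‖ ≤ C₁ := by
        refine (ContinuousLinearMap.le_opNorm _ _).trans ?_
        rw [← norm_iteratedFDeriv_one]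
        simpa using hb1 x ξ (EuclideanSpace.single i 1) hξ
      exact h1
    · rw [Matrix.det_transpose]
      exact hdet x ξ hξ
    · have h1 : F' x v = ∑ k, fderiv ℝ (g k) x v • EuclideanSpace.single k (1 : ℝ) := by
        simp [hF']
      rw [h1, hsingle, Matrix.mulVec, dotProduct]
      have h2 : v = ∑ j, v j • EuclideanSpace.single j (1 : ℝ) := by
        ext k
        rw [hsingle]
      conv_lhs => rw [h2]
      rw [map_sum]
      refine Finset.sum_congr rfl fun j _ => ?_
      rw [map_smul, smul_eq_mul, mul_comm]
      rfl
  have hmain := norm_sub_le_of_fderiv_bounded_below hFF' (by positivity) hLip hc' hlow x y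
  have hnorm : ‖F x - F y‖ ^ 2 = ∑ k, (g k x - g k y) ^ 2 := by
    rw [EuclideanSpace.norm_sq_eq]
    refine Finset.sum_congr rfl fun k _ => ?_
    rw [PiLp.sub_apply, hF]
    simp only
    rw [hsingle (fun k => g k x), hsingle (fun k => g k y), Real.norm_eq_abs, sq_abs]
  rw [← hnorm, ← mul_pow]
  refine pow_le_pow_left₀ (by positivity) ?_ 2
  rwa [inv_mul_le_iff₀ (by positivity)]

/-- Euler's identity, from differentiating φ(x,tξ) = tφ(x,ξ) at t = 1. -/
theorem fderiv_apply_self (hφ : MemPhase 2 φ) (x : Rn n) {ξ : Rn n} (hξ : ξ ≠ 0) :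
    fderiv ℝ (φ x) ξ ξ = φ x ξ := by
  have hd : HasFDerivAt (φ x) (fderiv ℝ (φ x) ξ) ((1 : ℝ) • ξ) := by
    rw [one_smul]
    exact ((hφ.contDiffAt x hξ).differentiableAt (by simp)).hasFDerivAt
  have h1 : HasDerivAt (fun t : ℝ => t • ξ) ξ 1 := by
    simpa using (hasDerivAt_id (1 : ℝ)).smul_const ξ
  have h2 := hd.comp_hasDerivAt (1 : ℝ) h1
  have h3 : HasDerivAt (fun t : ℝ => t * φ x ξ) (φ x ξ) 1 := by
    simpa using (hasDerivAt_id (1 : ℝ)).mul_const (φ x ξ)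
  have h4 : (φ x ∘ fun t : ℝ => t • ξ) =ᶠ[𝓝 1] fun t => t * φ x ξ := by
    filter_upwards [lt_mem_nhds (zero_lt_one' ℝ)] with t ht
    exact hφ.homogeneous x ξ hξ t ht
  exact (h2.congr_of_eventuallyEq h4.symm).unique h3

theorem fderiv_smul (hφ : MemPhase 2 φ) (x : Rn n) {ξ : Rn n} (hξ : ξ ≠ 0) {t : ℝ} (ht : 0 < t) :
    fderiv ℝ (φ x) (t • ξ) = fderiv ℝ (φ x) ξ := by
  have htξ : t • ξ ≠ 0 := smul_ne_zero ht.ne' hξ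
  have h1 : HasFDerivAt (fun η : Rn n => t • η) (t • ContinuousLinearMap.id ℝ (Rn n)) ξ :=
    (hasFDerivAt_id ξ).const_smul t
  have h2 := ((hφ.contDiffAt x htξ).differentiableAt (by simp)).hasFDerivAt.comp ξ h1
  have h3 := (((hφ.contDiffAt x hξ).differentiableAt (by simp)).hasFDerivAt).const_smul t
  have h4 : (φ x ∘ fun η => t • η) =ᶠ[𝓝 ξ] fun η => t • φ x η := by
    filter_upwards [isOpen_ne.mem_nhds hξ] with η hη
    exact hφ.homogeneous x η hη t ht
  have h5 := (h2.congr_of_eventuallyEq h4.symm).unique h3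
  ext v
  have h6 := congrArg (fun L : Rn n →L[ℝ] ℝ => L v) h5
  simp only [ContinuousLinearMap.comp_smul, ContinuousLinearMap.comp_id,
    _root_.smul_apply, smul_eq_mul] at h6
  exact mul_left_cancel₀ ht.ne' h6

/-- The gradient at e equals the gradient at |ξ|e by homogeneity. The cone allows angles up to 120°
with e, so the segment from |ξ|e to ξ stays at distance at least |ξ|/2 from the origin. Second
derivatives along it are O(1/|ξ|) and its length is at most 2|ξ|. -/
theorem norm_fderiv_sub_le_cone (hφ : MemPhase 2 φ) : ∃ C, 0 ≤ C ∧ ∀ x (e ξ : Rn n), ‖e‖ = 1 →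
    ξ ≠ 0 → -(‖ξ‖ / 2) ≤ inner ℝ ξ e → ‖fderiv ℝ (φ x) ξ - fderiv ℝ (φ x) e‖ ≤ C := by
  obtain ⟨C, hC0, hC⟩ := hφ.norm_iteratedFDeriv_le (k := 2) le_rfl
  refine ⟨C * 4, by positivity, fun x e ξ he hξ hcone => ?_⟩
  set r := ‖ξ‖ with hr
  have hr0 : 0 < r := norm_pos_iff.2 hξ
  have he0 : e ≠ 0 := fun h => by simp [h] at he
  have hseg : ∀ p ∈ segment ℝ (r • e) ξ, r / 2 ≤ ‖p‖ := by
    rintro p ⟨a, b, ha, hb, hab, rfl⟩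
    have h1 : ‖a • r • e + b • ξ‖ ^ 2 = (a * r) ^ 2 + 2 * (a * r * b * inner ℝ ξ e) + (b * r) ^ 2 := by
      rw [norm_add_sq_real, norm_smul, norm_smul, norm_smul, he, inner_smul_left, inner_smul_left,
        inner_smul_right, real_inner_comm, Real.norm_of_nonneg ha, Real.norm_of_nonneg hb,
        Real.norm_of_nonneg hr0.le, ← hr]
      simp
      ring
    refine le_of_sq_le_sq ?_ (norm_nonneg _)
    rw [h1]
    have h2 : 0 ≤ a * r * b := by positivity
    have h3 := mul_le_mul_of_nonneg_left hcone h2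
    have h4 : b = 1 - a := by linarith
    subst h4
    nlinarith [mul_nonneg (sq_nonneg r) (sq_nonneg (2 * a - 1))]
  have hne : ∀ p ∈ segment ℝ (r • e) ξ, p ≠ 0 := fun p hp h0 => by
    have := hseg p hp
    rw [h0, norm_zero] at this
    linarith
  have hb := (convex_segment (𝕜 := ℝ) (r • e) ξ).norm_image_sub_le_of_norm_fderiv_le (𝕜 := ℝ)
    (f := fderiv ℝ (φ x)) (C := C * (r / 2)⁻¹)
    (fun p hp => ((hφ.contDiffAt x (hne p hp)).fderiv_right (m := 1) (by norm_cast)).differentiableAt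
      (by simp))
    (fun p hp => by
      rw [← norm_iteratedFDeriv_one, norm_iteratedFDeriv_fderiv]
      refine (hC x p (hne p hp)).trans (mul_le_mul_of_nonneg_left ?_ hC0)
      norm_num
      rw [← inv_div]
      exact inv_anti₀ (by positivity) (hseg p hp))
    (left_mem_segment ℝ _ _) (right_mem_segment ℝ _ _)
  rw [hφ.fderiv_smul x he0 hr0] at hb
  refine hb.trans ?_
  have h5 : ‖ξ - r • e‖ ≤ 2 * r := by
    refine (norm_sub_le _ _).trans ?_
    rw [norm_smul, he, Real.norm_of_nonneg hr0.le, ← hr]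
    linarith
  calc C * (r / 2)⁻¹ * ‖ξ - r • e‖ ≤ C * (r / 2)⁻¹ * (2 * r) := by gcongr
    _ = C * 4 := by field_simp; norm_num

/-- The remainder of the linearisation of the phase along a direction `e` behaves like a phase of
class `Φ^0` on the cone around `e`. -/
theorem norm_iteratedFDeriv_remainder_le (hφ : MemPhase 2 φ) (k : ℕ) : ∃ C, 0 ≤ C ∧
    ∀ x (e ξ : Rn n), ‖e‖ = 1 → ξ ≠ 0 → -(‖ξ‖ / 2) ≤ inner ℝ ξ e →
      ‖iteratedFDeriv ℝ k (fun η => φ x η - fderiv ℝ (φ x) e η) ξ‖ ≤ C * ‖ξ‖ ^ (1 - (k : ℤ)) := by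
  obtain ⟨C, hC0, hC⟩ := hφ.norm_fderiv_sub_le_cone
  have hfd : ∀ x e ξ, ξ ≠ 0 → fderiv ℝ (fun η => φ x η - fderiv ℝ (φ x) e η) ξ =
      fderiv ℝ (φ x) ξ - fderiv ℝ (φ x) e := fun x e ξ hξ => by
    rw [fderiv_fun_sub ((hφ.contDiffAt x hξ).differentiableAt (by simp))
      (ContinuousLinearMap.differentiableAt _), ContinuousLinearMap.fderiv]
  -- Order 0 comes from order 1 by Euler's identity, order 1 is the cone estimate, and from order 2
  -- on the linear part drops out.
  rcases k with - | - | k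
  · refine ⟨C, hC0, fun x e ξ he hξ hcone => ?_⟩
    rw [norm_iteratedFDeriv_zero, ← hφ.fderiv_apply_self x hξ, ← _root_.sub_apply]
    simpa using ((fderiv ℝ (φ x) ξ - fderiv ℝ (φ x) e).le_opNorm ξ).trans
      (mul_le_mul_of_nonneg_right (hC x e ξ he hξ hcone) (norm_nonneg _))
  · refine ⟨C, hC0, fun x e ξ he hξ hcone => ?_⟩
    rw [zero_add, norm_iteratedFDeriv_one, hfd x e ξ hξ]
    simpa using hC x e ξ he hξ hcone
  · obtain ⟨C', hC'0, hC'⟩ := hφ.norm_iteratedFDeriv_le (k := k + 2) (by omega)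
    refine ⟨C', hC'0, fun x e ξ he hξ hcone => (le_of_eq ?_).trans (hC' x ξ hξ)⟩
    have e0 : ∀ f : Rn n → ℝ, ‖iteratedFDeriv ℝ (k + 1 + 1) f ξ‖ =
      ‖iteratedFDeriv ℝ (k + 1) (fderiv ℝ f) ξ‖ := fun f => norm_iteratedFDeriv_fderiv.symm
    refine (e0 _).trans (Eq.trans ?_ (e0 (φ x)).symm)
    congr 1
    have h1 : fderiv ℝ (fun η => φ x η - fderiv ℝ (φ x) e η) =ᶠ[𝓝 ξ]
        fun η => fderiv ℝ (φ x) η + -fderiv ℝ (φ x) e := by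
      filter_upwards [isOpen_ne.mem_nhds hξ] with η hη
      rw [hfd x e η hη, sub_eq_add_neg]
    rw [(h1.iteratedFDeriv ℝ (k + 1)).eq_of_nhds]
    have h2 : ContDiffAt ℝ (k + 1 : ℕ) (fderiv ℝ (φ x)) ξ :=
      (hφ.contDiffAt x hξ).fderiv_right (by exact_mod_cast le_top)
    have h3 := iteratedFDeriv_add_apply (i := k + 1) h2
      (contDiffAt_const (c := -fderiv ℝ (φ x) e))
    refine h3.trans ?_
    rw [iteratedFDeriv_const_of_ne (by simp)]
    simp

theorem contDiffAt_remainder (hφ : MemPhase 2 φ) (x e : Rn n) {ξ : Rn n} (hξ : ξ ≠ 0) :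
    ContDiffAt ℝ ∞ (fun η => φ x η - fderiv ℝ (φ x) e η) ξ :=
  (hφ.contDiffAt x hξ).sub (ContinuousLinearMap.contDiff _).contDiffAt

theorem symFam_fderiv_sub (hφ : MemPhase 2 φ) {ι : Type*} {S : ι → Set (Rn n)} {t : ι → ℝ}
    (ht : ∀ i, 0 ≤ t i) {K : ℝ} (hS : ∀ i, ∀ ξ ∈ S i, ξ ≠ 0 ∧ ‖ξ‖⁻¹ ≤ K * t i) (N : ℕ) (v : Rn n) :
    SymFam (fun p : ι × Rn n × Rn n => S p.1) (fun p => t p.1) (fun p => ‖p.2.1 - p.2.2‖) N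
      (fun p ξ => fderiv ℝ (fun η => φ p.2.1 η - φ p.2.2 η) ξ v) := by
  refine SymFam.of_forall (fun _ => norm_nonneg _) (fun _ => ht _) (fun p ξ hξ => ?_)
    (fun j => ?_) N
  · exact ((((hφ.contDiffAt p.2.1 (hS _ ξ hξ).1).sub
      (hφ.contDiffAt p.2.2 (hS _ ξ hξ).1)).fderiv_right (m := ∞) (by simp))).clm_apply contDiffAt_const
  · obtain ⟨C, hC0, hC⟩ := hφ.norm_iteratedFDeriv_sub_le (k := j + 1) (by omega)
    refine ⟨‖v‖ * (C * |K| ^ j), by positivity, fun p ξ hξ => ?_⟩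
    obtain ⟨hξ0, hξK⟩ := hS _ ξ hξ
    have hcd := (hφ.contDiffAt p.2.1 hξ0).sub (hφ.contDiffAt p.2.2 hξ0)
    have h1 : ContDiffAt ℝ j (fderiv ℝ (fun η => φ p.2.1 η - φ p.2.2 η)) ξ :=
      hcd.fderiv_right (by exact_mod_cast le_top)
    refine (norm_iteratedFDeriv_clm_apply_const h1 le_rfl).trans ?_
    rw [norm_iteratedFDeriv_fderiv]
    have h2 : iteratedFDeriv ℝ (j + 1) (fun η => φ p.2.1 η - φ p.2.2 η) ξ =
        iteratedFDeriv ℝ (j + 1) (φ p.2.1) ξ - iteratedFDeriv ℝ (j + 1) (φ p.2.2) ξ :=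
      iteratedFDeriv_sub_apply (contDiffAt_infty.1 (hφ.contDiffAt p.2.1 hξ0) _)
        (contDiffAt_infty.1 (hφ.contDiffAt p.2.2 hξ0) _)
    rw [h2]
    have h3 := hC p.2.1 p.2.2 ξ hξ0
    have h4 : ‖ξ‖ ^ (1 - ((j + 1 : ℕ) : ℤ)) = ‖ξ‖⁻¹ ^ j := by
      rw [show 1 - ((j + 1 : ℕ) : ℤ) = -(j : ℤ) by push_cast; ring, zpow_neg, zpow_natCast, inv_pow]
    rw [h4] at h3
    have h5 : ‖ξ‖⁻¹ ^ j ≤ |K| ^ j * t p.1 ^ j := by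
      rw [← mul_pow]
      exact pow_le_pow_left₀ (by positivity) (hξK.trans
        (mul_le_mul_of_nonneg_right (le_abs_self K) (ht _))) j
    calc _ ≤ ‖v‖ * (C * ‖p.2.1 - p.2.2‖ * (|K| ^ j * t p.1 ^ j)) := by gcongr; exact h3.trans (by gcongr)
      _ = _ := by ring

end MemPhase

end RoughFIO

/-! ### Regular representatives, extension by density, Plancherel. -/

namespace RoughFIO

open Filter Topology
open scoped FourierTransform ENNReal

theorem bracket_pos {n : ℕ} (ξ : Rn n) : 0 < bracket ξ := Real.sqrt_pos.2 (by positivity)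

theorem one_le_bracket {n : ℕ} (ξ : Rn n) : 1 ≤ bracket ξ :=
  Real.one_le_sqrt.2 (by nlinarith [sq_nonneg ‖ξ‖])

theorem continuous_bracket {n : ℕ} : Continuous (bracket : Rn n → ℝ) := by
  unfold bracket
  fun_prop

/-- A rough amplitude agrees for almost every `x` with one which is jointly measurable and for
which the symbol estimates hold everywhere. -/
theorem MemRoughAmplitude.exists_regular {n : ℕ} {m ρ : ℝ} {a : Rn n → Rn n → ℂ}
    (ha : MemRoughAmplitude m ρ a) : ∃ a' : Rn n → Rn n → ℂ, (∀ x, ContDiff ℝ ∞ (a' x)) ∧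
      StronglyMeasurable (Function.uncurry a') ∧
      (∀ k : ℕ, ∃ C, 0 ≤ C ∧ ∀ x ξ,
        ‖iteratedFDeriv ℝ k (a' x) ξ‖ ≤ C * bracket ξ ^ (m - ρ * k)) ∧
      ∀ᵐ x, a x = a' x := by
  choose C hC using ha.bound
  set q := TopologicalSpace.denseSeq (Rn n) with hq
  have hqd : DenseRange q := TopologicalSpace.denseRange_denseSeq _
  set mk : ℕ → Rn n → ℂ := fun j => (ha.measurable (q j)).mk _ with hmk
  -- The exceptional null set depends on ξ and k; only countably many are needed, with ξ in a dense
  -- sequence. Continuity in ξ recovers the other points, and a' is set to 0 on a measurable null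
  -- set containing the bad x.
  have hP : ∀ᵐ x, (∀ j, a x (q j) = mk j x) ∧
      ∀ k j, ‖iteratedFDeriv ℝ k (a x) (q j)‖ ≤ C k * bracket (q j) ^ (m - ρ * k) :=
    (ae_all_iff.2 fun j => (ha.measurable (q j)).ae_eq_mk).and
      (ae_all_iff.2 fun k => ae_all_iff.2 fun j => hC k (q j))
  obtain ⟨G, hGP, hGm, hGae⟩ := exists_measurable_superset_of_null (ae_iff.1 hP)
  have hGc : ∀ x ∉ G, (∀ j, a x (q j) = mk j x) ∧
      ∀ k j, ‖iteratedFDeriv ℝ k (a x) (q j)‖ ≤ C k * bracket (q j) ^ (m - ρ * k) := fun x hx => by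
    by_contra hcon
    exact hx (hGP hcon)
  classical
  set a' : Rn n → Rn n → ℂ := fun x => if x ∈ G then 0 else a x with ha'
  have hsm : ∀ x, ContDiff ℝ ∞ (a' x) := fun x => by
    simp only [ha']
    split_ifs
    · exact contDiff_const
    · exact ha.smooth x
  have hmq : ∀ j, StronglyMeasurable fun x => a' x (q j) := fun j => by
    have : (fun x => a' x (q j)) = Gᶜ.indicator (mk j) := by
      ext x
      by_cases hx : x ∈ G
      · simp [ha', hx]
      · simp [ha', hx, (hGc x hx).1 j]
    rw [this]
    exact (ha.measurable (q j)).stronglyMeasurable_mk.indicator hGm.compl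
  have hmξ : ∀ ξ, StronglyMeasurable fun x => a' x ξ := fun ξ => by
    obtain ⟨s, hs, hlim⟩ := mem_closure_iff_seq_limit.1 (hqd ξ)
    choose j hj using hs
    refine stronglyMeasurable_of_tendsto atTop (fun i => hmq (j i)) ?_
    refine tendsto_pi_nhds.2 fun x => ?_
    simp_rw [hj]
    exact ((hsm x).continuous.tendsto ξ).comp hlim
  refine ⟨a', hsm, ?_, fun k => ⟨max (C k) 0, le_max_right _ _, fun x ξ => ?_⟩, ?_⟩
  · exact (stronglyMeasurable_uncurry_of_continuous_of_stronglyMeasurable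
      (u := fun ξ x => a' x ξ) (fun x => (hsm x).continuous) hmξ).comp_measurable measurable_swap
  · by_cases hx : x ∈ G
    · have : a' x = fun _ => 0 := by ext; simp [ha', hx]
      have := (bracket_pos ξ).le
      simp only [‹a' x = _›, iteratedFDeriv_fun_zero]
      simp only [Pi.zero_apply, norm_zero]
      positivity
    · have h1 : a' x = a x := by simp [ha', hx]
      rw [h1]
      have hcl : IsClosed {ξ | ‖iteratedFDeriv ℝ k (a x) ξ‖ ≤
          max (C k) 0 * bracket ξ ^ (m - ρ * k)} := by
        refine isClosed_le ((ha.smooth x).continuous_iteratedFDeriv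
          (by exact_mod_cast le_top)).norm (continuous_const.mul ?_)
        exact continuous_bracket.rpow_const fun ξ => Or.inl (bracket_pos ξ).ne'
      refine hqd.induction_on (p := fun ξ => ‖iteratedFDeriv ℝ k (a x) ξ‖ ≤
          max (C k) 0 * bracket ξ ^ (m - ρ * k)) ξ hcl fun j => ?_
      refine ((hGc x hx).2 k j).trans ?_
      have := (bracket_pos (q j)).le
      gcongr
      exact le_max_left _ _
  · have : ∀ᵐ x, x ∉ G := by rw [ae_iff]; simpa using hGae
    filter_upwards [this] with x hx
    simp [ha', hx]

theorem eLpNorm_two_sq {α : Type*} [MeasurableSpace α] {μ : Measure α} (f : α → ℂ) :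
    eLpNorm f 2 μ ^ 2 = ∫⁻ x, ‖f x‖ₑ ^ 2 ∂μ := by
  rw [eLpNorm_eq_lintegral_rpow_enorm_toReal (by simp) (by simp)]
  simp only [ENNReal.toReal_ofNat, ENNReal.rpow_ofNat]
  rw [← ENNReal.rpow_natCast, ← ENNReal.rpow_mul]
  simp

theorem eLpNorm_two_le_of_sq {α β : Type*} [MeasurableSpace α] {μ : Measure α} [MeasurableSpace β]
    {ν : Measure β} {f : α → ℂ} {g : β → ℂ} {C : ℝ} (hC : 0 ≤ C)
    (h : ∫⁻ x, ‖f x‖ₑ ^ 2 ∂μ ≤ ENNReal.ofReal (C ^ 2) * ∫⁻ x, ‖g x‖ₑ ^ 2 ∂ν) :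
    eLpNorm f 2 μ ≤ ENNReal.ofReal C * eLpNorm g 2 ν := by
  rw [← eLpNorm_two_sq, ← eLpNorm_two_sq, ENNReal.ofReal_pow hC, ← mul_pow] at h
  exact (ENNReal.pow_le_pow_left_iff (by norm_num)).1 h

/-- T' is a representative that is linear at every point. T itself may fail to be additive on the
null set of x where the amplitude is uncontrolled. The estimate then extends by density of Schwartz
functions. -/
theorem boundedOnL2_of_eLpNorm_le {n : ℕ} {T T' : 𝓢(Rn n, ℂ) → Rn n → ℂ}
    (hT : ∀ u, T' u =ᵐ[volume] T u) (hadd : ∀ u v, T' (u + v) = T' u + T' v)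
    (hsmul : ∀ (c : ℂ) u, T' (c • u) = c • T' u)
    (hm : ∀ u, AEStronglyMeasurable (T' u) volume) {C : ℝ}
    (hb : ∀ u : 𝓢(Rn n, ℂ), eLpNorm (T' u) 2 volume ≤ ENNReal.ofReal C * eLpNorm u 2 volume) :
    BoundedOnL2 T := by
  have hmem : ∀ u, MemLp (T' u) 2 volume := fun u => ⟨hm u, (hb u).trans_lt
    (ENNReal.mul_lt_top ENNReal.ofReal_lt_top (u.memLp 2 volume).2)⟩
  let f : 𝓢(Rn n, ℂ) →ₗ[ℂ] Lp ℂ 2 (volume : Measure (Rn n)) :=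
    { toFun := fun u => (hmem u).toLp
      map_add' := fun u v => by
        rw [← MemLp.toLp_add]
        exact MemLp.toLp_congr _ _ (ae_of_all _ fun x => congrFun (hadd u v) x)
      map_smul' := fun c u => by
        rw [RingHom.id_apply, ← MemLp.toLp_const_smul]
        exact MemLp.toLp_congr _ _ (ae_of_all _ fun x => congrFun (hsmul c u) x) }
  let e : 𝓢(Rn n, ℂ) →ₗ[ℂ] Lp ℂ 2 (volume : Measure (Rn n)) :=
    (toLpCLM ℂ ℂ 2 (volume : Measure (Rn n)) : 𝓢(Rn n, ℂ) →ₗ[ℂ] Lp ℂ 2 volume)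
  have hde : DenseRange e := denseRange_toLpCLM (F := ℂ) (μ := (volume : Measure (Rn n))) (by simp)
  have hn : ∃ C, ∀ u, ‖f u‖ ≤ C * ‖e u‖ := by
    refine ⟨max C 0, fun u => ?_⟩
    have h1 : ‖f u‖ = (eLpNorm (T' u) 2 volume).toReal := Lp.norm_toLp _ (hmem u)
    have h2 : ‖e u‖ = (eLpNorm u 2 volume).toReal := SchwartzMap.norm_toLp
    rw [h1, h2, ← ENNReal.toReal_ofReal (le_max_right C 0), ← ENNReal.toReal_mul]
    refine ENNReal.toReal_mono (ENNReal.mul_ne_top ENNReal.ofReal_ne_top (u.memLp 2 volume).2.ne) ?_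
    refine (hb u).trans ?_
    gcongr
    exact le_max_left _ _
  refine ⟨f.extendOfNorm e, fun u => ?_⟩
  have h1 : f.extendOfNorm e (u.toLp 2 volume) = f u := LinearMap.extendOfNorm_eq hde hn u
  rw [h1]
  exact (MemLp.coeFn_toLp (hmem u)).trans (hT u)

theorem BoundedOnL2.exists_eLpNorm_le {n : ℕ} {T : 𝓢(Rn n, ℂ) → Rn n → ℂ} (h : BoundedOnL2 T) :
    ∃ C : ℝ, 0 ≤ C ∧ ∀ u : 𝓢(Rn n, ℂ),
      eLpNorm (T u) 2 volume ≤ ENNReal.ofReal C * eLpNorm u 2 volume := by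
  obtain ⟨A, hA⟩ := h
  refine ⟨‖A‖, norm_nonneg _, fun u => ?_⟩
  rw [← eLpNorm_congr_ae (hA u)]
  have h1 := A.le_opNorm (u.toLp 2 volume)
  rw [Lp.norm_def, SchwartzMap.norm_toLp, ← ENNReal.toReal_ofReal (norm_nonneg A),
    ← ENNReal.toReal_mul] at h1
  have h2 : ENNReal.ofReal ‖A‖ * eLpNorm u 2 volume ≠ ⊤ :=
    ENNReal.mul_ne_top ENNReal.ofReal_ne_top (u.memLp 2 volume).2.ne
  exact (ENNReal.toReal_le_toReal (Lp.eLpNorm_ne_top _) h2).1 h1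

section Hat

variable {n : ℕ}

/-- Dilation by a nonzero scalar as a continuous linear equivalence. -/
def dilationEquiv (n : ℕ) (r : ℝ) (hr : r ≠ 0) : Rn n ≃L[ℝ] Rn n :=
  (LinearEquiv.smulOfNeZero ℝ (Rn n) r hr).toContinuousLinearEquiv

@[simp] theorem dilationEquiv_apply (r : ℝ) (hr : r ≠ 0) (x : Rn n) :
    dilationEquiv n r hr x = r • x := rfl

/-- The Fourier transform `hat` on Schwartz functions. -/
def hatCLM (n : ℕ) : 𝓢(Rn n, ℂ) →L[ℂ] 𝓢(Rn n, ℂ) :=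
  (compCLMOfContinuousLinearEquiv ℂ (dilationEquiv n (2 * Real.pi)⁻¹
    (inv_ne_zero Real.two_pi_pos.ne'))).comp (fourierTransformCLM ℂ)

theorem hatCLM_eq (u : 𝓢(Rn n, ℂ)) (ξ : Rn n) :
    hatCLM n u ξ = 𝓕 u ((2 * Real.pi)⁻¹ • ξ) := rfl

theorem hat_eq_hatCLM (u : 𝓢(Rn n, ℂ)) : hat u = hatCLM n u := by
  ext ξ
  rw [hatCLM_eq, SchwartzMap.fourier_coe, Real.fourier_eq']
  refine integral_congr_ae (ae_of_all _ fun y => ?_)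
  simp only [smul_eq_mul]
  congr 2
  rw [inner_smul_right]
  push_cast
  field_simp

/-- Lets the counterexample prescribe û instead of u. -/
theorem exists_hat_eq (h : 𝓢(Rn n, ℂ)) : ∃ u : 𝓢(Rn n, ℂ), hatCLM n u = h := by
  refine ⟨𝓕⁻ (compCLMOfContinuousLinearEquiv ℂ
    (dilationEquiv n (2 * Real.pi) Real.two_pi_pos.ne') h), ?_⟩
  ext ξ
  rw [hatCLM_eq, FourierTransform.fourier_fourierInv_eq]
  simp only [compCLMOfContinuousLinearEquiv_apply, Function.comp_apply, dilationEquiv_apply,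
    smul_smul]
  rw [mul_inv_cancel₀ Real.two_pi_pos.ne', one_smul]

theorem lintegral_enorm_sq_eq (u : 𝓢(Rn n, ℂ)) :
    ∫⁻ x, ‖u x‖ₑ ^ 2 = ENNReal.ofReal (∫ x, ‖u x‖ ^ 2) := by
  rw [ofReal_integral_eq_lintegral_ofReal ((u.memLp 2 volume).integrable_norm_pow (by simp))
    (ae_of_all _ fun x => by positivity)]
  refine lintegral_congr fun x => ?_
  rw [ENNReal.ofReal_pow (norm_nonneg _), ofReal_norm]

theorem integral_norm_sq_hatCLM (u : 𝓢(Rn n, ℂ)) :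
    ∫ ξ, ‖hatCLM n u ξ‖ ^ 2 = (2 * Real.pi) ^ n * ∫ x, ‖u x‖ ^ 2 := by
  have h1 := Measure.integral_comp_smul (volume : Measure (Rn n)) (fun ξ => ‖𝓕 u ξ‖ ^ 2)
    (2 * Real.pi)⁻¹
  simp_rw [hatCLM_eq]
  rw [h1, SchwartzMap.integral_norm_sq_fourier, finrank_euclideanSpace_fin, inv_pow, inv_inv,
    abs_of_pos (pow_pos Real.two_pi_pos n), smul_eq_mul]

theorem eLpNorm_hat_sq (u : 𝓢(Rn n, ℂ)) : eLpNorm (hat u) 2 volume ^ 2 =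
    ENNReal.ofReal ((2 * Real.pi) ^ n) * eLpNorm u 2 volume ^ 2 := by
  rw [hat_eq_hatCLM, eLpNorm_two_sq, eLpNorm_two_sq, lintegral_enorm_sq_eq, lintegral_enorm_sq_eq,
    integral_norm_sq_hatCLM, ENNReal.ofReal_mul (by positivity)]

end Hat

end RoughFIO

namespace RoughFIO

open Filter Topology
open scoped ENNReal

variable {n : ℕ}

/-! ### Dyadic partitions and conic cutoffs. -/

section Cutoffs

/-- A smooth bump function equal to `1` on the unit ball and supported in the ball of radius `2`. -/
def cutoff (n : ℕ) (ξ : Rn n) : ℝ := (⟨1, 2, one_pos, one_lt_two⟩ : ContDiffBump (0 : Rn n)) ξ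

theorem contDiff_cutoff : ContDiff ℝ ∞ (cutoff n) := ContDiffBump.contDiff _

theorem cutoff_nonneg (ξ : Rn n) : 0 ≤ cutoff n ξ := ContDiffBump.nonneg _

theorem cutoff_le_one (ξ : Rn n) : cutoff n ξ ≤ 1 := ContDiffBump.le_one _

theorem cutoff_eq_one {ξ : Rn n} (h : ‖ξ‖ ≤ 1) : cutoff n ξ = 1 :=
  ContDiffBump.one_of_mem_closedBall _ (by simpa using h)

theorem cutoff_eq_zero {ξ : Rn n} (h : 2 ≤ ‖ξ‖) : cutoff n ξ = 0 :=
  ContDiffBump.zero_of_le_dist _ (by simpa using h)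

theorem hasCompactSupport_cutoff : HasCompactSupport (cutoff n) := ContDiffBump.hasCompactSupport _

/-- A smooth function supported in the annulus `1 ≤ ‖ξ‖ ≤ 4`, the building block of the
Littlewood-Paley decomposition. -/
def annulus (n : ℕ) (ξ : Rn n) : ℝ := cutoff n ((2 : ℝ)⁻¹ • ξ) - cutoff n ξ

theorem contDiff_annulus : ContDiff ℝ ∞ (annulus n) :=
  (contDiff_cutoff.comp (contDiff_const_smul _)).sub contDiff_cutoff

theorem annulus_eq_zero_of_le {ξ : Rn n} (h : ‖ξ‖ ≤ 1) : annulus n ξ = 0 := by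
  rw [annulus, cutoff_eq_one h, cutoff_eq_one, sub_self]
  rw [norm_smul, norm_inv, Real.norm_of_nonneg (by norm_num)]
  linarith

theorem annulus_eq_zero_of_ge {ξ : Rn n} (h : 4 ≤ ‖ξ‖) : annulus n ξ = 0 := by
  have h1 : 2 ≤ ‖(2 : ℝ)⁻¹ • ξ‖ := by
    rw [norm_smul, norm_inv, Real.norm_of_nonneg (by norm_num)]
    linarith
  rw [annulus, cutoff_eq_zero h1, cutoff_eq_zero (by linarith), sub_self]

theorem mem_annulus_of_ne_zero {ξ : Rn n} (h : annulus n ξ ≠ 0) : 1 ≤ ‖ξ‖ ∧ ‖ξ‖ ≤ 4 :=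
  ⟨le_of_not_ge fun h' => h (annulus_eq_zero_of_le h'),
    le_of_not_ge fun h' => h (annulus_eq_zero_of_ge h')⟩

theorem hasCompactSupport_annulus : HasCompactSupport (annulus n) :=
  HasCompactSupport.intro (isCompact_closedBall (0 : Rn n) 4) fun ξ hξ =>
    annulus_eq_zero_of_ge (by simpa using (not_le.1 (by simpa using hξ)).le)

theorem sum_annulus_high (J : ℕ) (ξ : Rn n) :
    ∑ j ∈ Finset.range J, annulus n (((2 : ℝ) ^ j)⁻¹ • ξ) =
      cutoff n (((2 : ℝ) ^ J)⁻¹ • ξ) - cutoff n ξ := by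
  have h := Finset.sum_range_sub (fun j : ℕ => cutoff n (((2 : ℝ) ^ j)⁻¹ • ξ)) J
  simp only [pow_zero, inv_one, one_smul] at h
  rw [← h]
  refine Finset.sum_congr rfl fun j _ => ?_
  rw [annulus, smul_smul, pow_succ, mul_inv, mul_comm]

theorem sum_annulus_low (J : ℕ) (ξ : Rn n) :
    ∑ j ∈ Finset.range J, annulus n ((2 : ℝ) ^ (j + 1) • ξ) =
      cutoff n ξ - cutoff n ((2 : ℝ) ^ J • ξ) := by
  have h := Finset.sum_range_sub' (fun j : ℕ => cutoff n ((2 : ℝ) ^ j • ξ)) J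
  simp only [pow_zero, one_smul] at h
  rw [← h]
  refine Finset.sum_congr rfl fun j _ => ?_
  rw [annulus, smul_smul, pow_succ]
  congr 3
  ring

theorem tendsto_cutoff_high (ξ : Rn n) :
    Tendsto (fun J : ℕ => cutoff n (((2 : ℝ) ^ J)⁻¹ • ξ)) atTop (𝓝 1) := by
  have h1 : Tendsto (fun J : ℕ => ((2 : ℝ) ^ J)⁻¹) atTop (𝓝 0) :=
    (tendsto_pow_atTop_atTop_of_one_lt one_lt_two).inv_tendsto_atTop
  have h2 := (contDiff_cutoff (n := n)).continuous.tendsto 0 |>.comp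
    (by simpa using h1.smul_const ξ)
  rwa [cutoff_eq_one (by simp)] at h2

theorem tendsto_cutoff_low {ξ : Rn n} (hξ : ξ ≠ 0) :
    Tendsto (fun J : ℕ => cutoff n ((2 : ℝ) ^ J • ξ)) atTop (𝓝 0) := by
  have h1 : Tendsto (fun J : ℕ => (2 : ℝ) ^ J * ‖ξ‖) atTop atTop :=
    (tendsto_pow_atTop_atTop_of_one_lt one_lt_two).atTop_mul_const (norm_pos_iff.2 hξ)
  refine tendsto_const_nhds.congr' ?_
  filter_upwards [h1.eventually_ge_atTop 2] with J hJ
  rw [cutoff_eq_zero]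
  rwa [norm_smul, Real.norm_of_nonneg (by positivity)]

/-- A function homogeneous of degree zero, smooth away from the origin, which vanishes off a cone
around `e`; the functions for `e` and `-e` add up to `1`. -/
def coneCutoff (e ξ : Rn n) : ℝ := Real.smoothTransition (1 / 2 + inner ℝ ξ e / ‖ξ‖)

theorem coneCutoff_nonneg (e ξ : Rn n) : 0 ≤ coneCutoff e ξ := Real.smoothTransition.nonneg _

theorem coneCutoff_le_one (e ξ : Rn n) : coneCutoff e ξ ≤ 1 := Real.smoothTransition.le_one _

theorem coneCutoff_smul (e ξ : Rn n) {t : ℝ} (ht : 0 < t) :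
    coneCutoff e (t • ξ) = coneCutoff e ξ := by
  rw [coneCutoff, coneCutoff, inner_smul_left, norm_smul, Real.norm_of_nonneg ht.le]
  congr 2
  exact mul_div_mul_left _ _ ht.ne'

/-- The smooth transition has the form g(s)/(g(s)+g(1-s)), so its values at 1/2 + s and 1/2 - s add
up to 1. -/
theorem coneCutoff_add_neg (e ξ : Rn n) : coneCutoff e ξ + coneCutoff (-e) ξ = 1 := by
  rw [coneCutoff, coneCutoff, inner_neg_right]
  set s := inner ℝ ξ e / ‖ξ‖ with hs
  rw [neg_div, ← hs, Real.smoothTransition, Real.smoothTransition,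
    show 1 - (1 / 2 + s) = 1 / 2 - s by ring, show 1 - (1 / 2 + -s) = 1 / 2 + s by ring,
    ← sub_eq_add_neg, add_comm (expNegInvGlue (1 / 2 - s)), ← add_div]
  refine div_self ?_
  have := Real.smoothTransition.pos_denom (1 / 2 + s)
  rw [show 1 - (1 / 2 + s) = 1 / 2 - s by ring] at this
  exact this.ne'

theorem mem_cone_of_coneCutoff_ne_zero {e ξ : Rn n} (h : coneCutoff e ξ ≠ 0) :
    -(‖ξ‖ / 2) ≤ inner ℝ ξ e := by
  by_contra hcon
  push Not at hcon
  refine h (Real.smoothTransition.zero_of_nonpos ?_)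
  rcases eq_or_ne ξ 0 with rfl | hξ
  · simp at hcon
  · have hpos := norm_pos_iff.2 hξ
    have : inner ℝ ξ e / ‖ξ‖ ≤ -(1 / 2) := by
      rw [div_le_iff₀ hpos]
      linarith
    linarith

theorem contDiffAt_coneCutoff (e : Rn n) {ξ : Rn n} (hξ : ξ ≠ 0) :
    ContDiffAt ℝ ∞ (coneCutoff e) ξ :=
  Real.smoothTransition.contDiff.contDiffAt.comp ξ
    (contDiffAt_const.add ((contDiffAt_id.inner ℝ contDiffAt_const).div (contDiffAt_norm ℝ hξ)
      (norm_ne_zero_iff.2 hξ)))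

theorem measurable_coneCutoff (e : Rn n) : Measurable (coneCutoff e) := by
  unfold coneCutoff
  have := (Real.smoothTransition.continuous).measurable
  fun_prop

/-- The annular cutoff restricted to a cone. -/
def coneAnnulus (e ξ : Rn n) : ℝ := annulus n ξ * coneCutoff e ξ

/-- The conic factor is singular only at the origin, where the annular factor vanishes on a whole
ball. -/
theorem contDiff_coneAnnulus (e : Rn n) : ContDiff ℝ ∞ (coneAnnulus e) := by
  refine contDiff_iff_contDiffAt.2 fun ξ => ?_
  rcases eq_or_ne ξ 0 with rfl | hξ
  · refine (contDiffAt_const (c := (0 : ℝ))).congr_of_eventuallyEq ?_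
    filter_upwards [Metric.ball_mem_nhds (0 : Rn n) one_pos] with η hη
    rw [coneAnnulus, annulus_eq_zero_of_le (mem_ball_zero_iff.1 hη).le, zero_mul]
  · exact contDiff_annulus.contDiffAt.mul (contDiffAt_coneCutoff e hξ)

theorem hasCompactSupport_coneAnnulus (e : Rn n) : HasCompactSupport (coneAnnulus e) :=
  hasCompactSupport_annulus.mul_right

end Cutoffs

/-! ### Summing pieces with geometrically decaying norms. -/

section Sums

/-- The oscillatory integral with amplitude `b` and phase `φ`. -/
def oscInt (b : Rn n → Rn n → ℂ) (φ : Rn n → Rn n → ℝ) (f : Rn n → ℂ) (x : Rn n) : ℂ :=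
  ∫ ξ, b x ξ * Complex.exp (Complex.I * (φ x ξ : ℝ)) * f ξ

theorem stronglyMeasurable_oscInt {b : Rn n → Rn n → ℂ} {φ : Rn n → Rn n → ℝ} {f : Rn n → ℂ}
    (hb : StronglyMeasurable (Function.uncurry fun x ξ =>
      b x ξ * Complex.exp (Complex.I * (φ x ξ : ℝ)))) (hf : StronglyMeasurable f) :
    StronglyMeasurable (oscInt b φ f) :=
  StronglyMeasurable.integral_prod_right
    (f := fun x ξ => b x ξ * Complex.exp (Complex.I * (φ x ξ : ℝ)) * f ξ)
    (hb.mul (hf.comp_measurable measurable_snd))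

/-- Fatou's lemma for the partial sums, which the triangle inequality bounds by a geometric series.
Pointwise convergence is enough, with no L² limit to identify. -/
theorem eLpNorm_le_of_tendsto_sum {h : ℕ → Rn n → ℂ} {g : Rn n → ℂ}
    (hm : ∀ j, StronglyMeasurable (h j)) {K r : ℝ} (hK : 0 ≤ K) (hr0 : 0 ≤ r) (hr1 : r < 1)
    {Y : ℝ≥0∞} (hb : ∀ j, eLpNorm (h j) 2 volume ≤ ENNReal.ofReal (K * r ^ j) * Y)
    (hlim : ∀ x, Tendsto (fun J => ∑ j ∈ Finset.range J, h j x) atTop (𝓝 (g x))) :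
    StronglyMeasurable g ∧ eLpNorm g 2 volume ≤ ENNReal.ofReal (K * (1 - r)⁻¹) * Y := by
  have hsm : ∀ J, StronglyMeasurable fun x => ∑ j ∈ Finset.range J, h j x := fun J =>
    Finset.stronglyMeasurable_fun_sum _ fun j _ => hm j
  refine ⟨stronglyMeasurable_of_tendsto atTop hsm (tendsto_pi_nhds.2 hlim), ?_⟩
  refine (Lp.eLpNorm_lim_le_liminf_eLpNorm (fun J => (hsm J).aestronglyMeasurable) g
    (ae_of_all _ hlim)).trans ?_
  refine liminf_le_of_le (by isBoundedDefault) fun b hb' => ?_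
  obtain ⟨J, hJ⟩ := hb'.exists
  refine hJ.trans ?_
  have h1 : eLpNorm (fun x => ∑ j ∈ Finset.range J, h j x) 2 volume ≤
      ∑ j ∈ Finset.range J, eLpNorm (h j) 2 volume := by
    have : (fun x => ∑ j ∈ Finset.range J, h j x) = ∑ j ∈ Finset.range J, h j := by
      ext x; simp
    rw [this]
    exact eLpNorm_sum_le (fun j _ => (hm j).aestronglyMeasurable) (by norm_num)
  refine h1.trans ((Finset.sum_le_sum fun j _ => hb j).trans ?_)
  rw [← Finset.sum_mul, ← ENNReal.ofReal_sum_of_nonneg fun j _ => by positivity]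
  gcongr
  rw [← Finset.mul_sum]
  gcongr
  have hs := hasSum_geometric_of_lt_one hr0 hr1
  exact sum_le_hasSum _ (fun j _ => by positivity) hs

theorem oscillatory_eLpNorm_bound {ι : Type*} {S : ι → Set (Rn n)} {t A Vol W : ι → ℝ}
    {φ : ι → Rn n → Rn n → ℝ} {b : ι → Rn n → Rn n → ℂ}
    (ht : ∀ i, 0 < t i) (hA : ∀ i, 0 < A i) (hVol : ∀ i, 0 < Vol i)
    (hS : ∀ i, volume (S i) ≤ ENNReal.ofReal (Vol i))
    (hbm : ∀ i, StronglyMeasurable (Function.uncurry fun x ξ =>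
      b i x ξ * Complex.exp (Complex.I * (φ i x ξ : ℝ))))
    (hb : ∀ N, SymFam (fun p : ι × Rn n => S p.1) (fun p => t p.1) (fun p => A p.1) N
      (fun p => b p.1 p.2))
    (hbc : ∀ i x, HasCompactSupport (b i x)) (hbS : ∀ i x, tsupport (b i x) ⊆ S i)
    (hφ : ∀ i x, ∀ ξ ∈ S i, ContDiffAt ℝ 2 (φ i x) ξ)
    (hgrad : ∀ N (k : Fin n), SymFam (fun p : ι × Rn n × Rn n => S p.1) (fun p => t p.1)
      (fun p => ‖p.2.1 - p.2.2‖) N (fun p ξ => fderiv ℝ (fun η => φ p.1 p.2.1 η - φ p.1 p.2.2 η) ξ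
        (EuclideanSpace.single k 1)))
    {c : ℝ} (hc : 0 < c) (hq : ∀ i x y, ∀ ξ ∈ S i, c * ‖x - y‖ ^ 2 ≤
      ∑ k : Fin n, fderiv ℝ (fun η => φ i x η - φ i y η) ξ (EuclideanSpace.single k 1) ^ 2)
    {K : ℝ} (hK : 0 ≤ K) (hW0 : ∀ i, 0 ≤ W i) (hW : ∀ i, A i ^ 2 * Vol i * t i ^ n ≤ K * W i ^ 2) :
    ∃ C : ℝ, 0 ≤ C ∧ ∀ i, ∀ f : Rn n → ℂ, Integrable f →
      eLpNorm (oscInt (b i) (φ i) f) 2 volume ≤ ENNReal.ofReal (C * W i) * eLpNorm f 2 volume := by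
  obtain ⟨C, hC, h⟩ := oscillatory_bound ht hA hVol hS hbm hb hbc hbS hφ hgrad hc hq
  refine ⟨√(C * K), Real.sqrt_nonneg _, fun i f hf =>
    eLpNorm_two_le_of_sq (mul_nonneg (Real.sqrt_nonneg _) (hW0 i)) ((h i f hf).trans ?_)⟩
  gcongr
  rw [mul_pow, Real.sq_sqrt (by positivity)]
  calc C * A i ^ 2 * Vol i * t i ^ n = C * (A i ^ 2 * Vol i * t i ^ n) := by ring
    _ ≤ C * (K * W i ^ 2) := mul_le_mul_of_nonneg_left (hW i) hC.le
    _ = _ := by ring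

theorem exists_volume_closedBall_le (n : ℕ) : ∃ V : ℝ, 0 < V ∧ ∀ r : ℝ, 0 < r →
    volume (Metric.closedBall (0 : Rn n) r) ≤ ENNReal.ofReal (V * r ^ n) := by
  refine ⟨(volume (Metric.ball (0 : Rn n) 1)).toReal + 1, by positivity, fun r hr => ?_⟩
  rw [Measure.addHaar_closedBall _ _ hr.le, finrank_euclideanSpace_fin, mul_comm,
    ENNReal.ofReal_mul (by positivity)]
  gcongr
  rw [ENNReal.ofReal_add ENNReal.toReal_nonneg zero_le_one,
    ENNReal.ofReal_toReal measure_ball_lt_top.ne]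
  exact le_self_add

/-- The value of a phase at `ξ = 0` is irrelevant, so the phase may be taken measurable. -/
theorem MemPhase.exists_measurable {φ : Rn n → Rn n → ℝ} (hφ : MemPhase 2 φ)
    (hnd : StronglyNondegenerate φ) : ∃ φ' : Rn n → Rn n → ℝ, MemPhase 2 φ' ∧
      StronglyNondegenerate φ' ∧ Measurable (Function.uncurry φ') ∧
      ∀ x ξ, ξ ≠ 0 → φ' x ξ = φ x ξ := by
  classical
  set φ' : Rn n → Rn n → ℝ := fun x ξ => if ξ = 0 then 0 else φ x ξ with hφ'
  have heq : ∀ x ξ, ξ ≠ 0 → φ' x ξ = φ x ξ := fun x ξ hξ => if_neg hξ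
  have hev : ∀ x ξ, ξ ≠ 0 → φ' x =ᶠ[𝓝 ξ] φ x := fun x ξ hξ => by
    filter_upwards [isOpen_ne.mem_nhds hξ] with η hη
    exact heq x η hη
  refine ⟨φ', ⟨?_, ?_, ?_⟩, ?_, ?_, heq⟩
  · exact hφ.smooth.congr fun p hp => heq p.1 p.2 hp
  · intro x ξ hξ t ht
    rw [heq x ξ hξ, heq x _ (smul_ne_zero ht.ne' hξ), hφ.homogeneous x ξ hξ t ht]
  · intro k l hkl
    obtain ⟨C, hC⟩ := hφ.bound k l hkl
    refine ⟨C, fun x ξ hξ => ?_⟩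
    have h1 : (fun η => iteratedFDeriv ℝ l (fun y => φ' y η) x) =ᶠ[𝓝 ξ]
        fun η => iteratedFDeriv ℝ l (fun y => φ y η) x := by
      filter_upwards [isOpen_ne.mem_nhds hξ] with η hη
      have : (fun y => φ' y η) = fun y => φ y η := funext fun y => heq y η hη
      rw [this]
    rw [(h1.iteratedFDeriv ℝ k).eq_of_nhds]
    exact hC x ξ hξ
  · obtain ⟨c, hc, h⟩ := hnd
    refine ⟨c, hc, fun x ξ hξ => ?_⟩
    have : mixedHessian φ' x ξ = mixedHessian φ x ξ := by
      unfold mixedHessian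
      simp_rw [fun y => (hev y ξ hξ).fderiv_eq (𝕜 := ℝ)]
    rw [this]
    exact h x ξ hξ
  · have hcont : ContinuousOn (Function.uncurry φ) {p : Rn n × Rn n | p.2 ≠ 0} :=
      hφ.smooth.continuousOn
    have hms : MeasurableSet {p : Rn n × Rn n | p.2 = 0} :=
      (isClosed_singleton (x := (0 : Rn n))).measurableSet.preimage measurable_snd
    have : Function.uncurry φ' = {p : Rn n × Rn n | p.2 = 0}.piecewise (fun _ => 0)
        (Function.uncurry φ) := by
      ext ⟨x, ξ⟩
      by_cases hξ : ξ = 0 <;> simp [hφ', Set.piecewise, hξ]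
    rw [this]
    refine measurable_of_restrict_of_restrict_compl hms ?_ ?_
    · rw [Set.domRestrict_piecewise]
      exact measurable_const
    · rw [Set.domRestrict_piecewise_compl]
      exact (continuousOn_iff_continuous_domRestrict.1 hcont).measurable

end Sums

end RoughFIO

/-! ### High frequencies. -/

namespace RoughFIO

open Filter Topology
open scoped ENNReal

variable {n : ℕ}

/-- Amplitudes with the symbol estimates at every point and jointly measurable. -/
structure RegularAmplitude (m ρ : ℝ) (a : Rn n → Rn n → ℂ) : Prop where
  smooth : ∀ x, ContDiff ℝ ∞ (a x)
  measurable : StronglyMeasurable (Function.uncurry a)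
  bound : ∀ k : ℕ, ∃ C, 0 ≤ C ∧ ∀ x ξ,
    ‖iteratedFDeriv ℝ k (a x) ξ‖ ≤ C * bracket ξ ^ (m - ρ * k)

theorem RegularAmplitude.norm_le {m ρ : ℝ} {a : Rn n → Rn n → ℂ} (ha : RegularAmplitude m ρ a) :
    ∃ C, 0 ≤ C ∧ ∀ x ξ, ‖a x ξ‖ ≤ C * bracket ξ ^ m := by
  obtain ⟨C, hC, h⟩ := ha.bound 0
  exact ⟨C, hC, fun x ξ => by simpa using h x ξ⟩

theorem RegularAmplitude.symFam {m ρ : ℝ} {a : Rn n → Rn n → ℂ} (ha : RegularAmplitude m ρ a)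
    {ι : Type*} {S : ι → Set (Rn n)} {t A : ι → ℝ} (ht : ∀ i, 0 ≤ t i) (hA : ∀ i, 0 ≤ A i)
    (h : ∀ k : ℕ, ∃ C, 0 ≤ C ∧ ∀ i, ∀ ξ ∈ S i,
      bracket ξ ^ (m - ρ * k) ≤ C * A i * t i ^ k) (N : ℕ) :
    SymFam (fun p : ι × Rn n => S p.1) (fun p => t p.1) (fun p => A p.1) N (fun p => a p.2) := by
  refine SymFam.of_forall (fun p : ι × Rn n => hA p.1) (fun p => ht p.1)
    (fun p ξ _ => (ha.smooth p.2).contDiffAt) (fun k => ?_) N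
  obtain ⟨C, hC, hb⟩ := ha.bound k
  obtain ⟨C', hC', hb'⟩ := h k
  refine ⟨C * C', mul_nonneg hC hC', fun p ξ hξ => (hb p.2 ξ).trans ?_⟩
  calc C * bracket ξ ^ (m - ρ * k) ≤ C * (C' * A p.1 * t p.1 ^ k) :=
        mul_le_mul_of_nonneg_left (hb' p.1 ξ hξ) hC
    _ = _ := by ring

theorem rpow_le_of_comparable {lam b : ℝ} (hlam : 0 < lam) (h1 : lam ≤ b) (h2 : b ≤ 5 * lam)
    (s : ℝ) : b ^ s ≤ 5 ^ |s| * lam ^ s := by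
  rcases le_total 0 s with hs | hs
  · rw [abs_of_nonneg hs, ← Real.mul_rpow (by norm_num) hlam.le]
    exact Real.rpow_le_rpow (hlam.le.trans h1) h2 hs
  · refine (Real.rpow_le_rpow_of_nonpos hlam h1 hs).trans ?_
    exact le_mul_of_one_le_left (Real.rpow_nonneg hlam.le _)
      (Real.one_le_rpow (by norm_num) (abs_nonneg _))

theorem norm_le_bracket (ξ : Rn n) : ‖ξ‖ ≤ bracket ξ :=
  Real.le_sqrt_of_sq_le (by linarith)

theorem bracket_le_one_add_norm (ξ : Rn n) : bracket ξ ≤ 1 + ‖ξ‖ :=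
  Real.sqrt_le_iff.2 ⟨by positivity, by nlinarith [norm_nonneg ξ]⟩

/-- Summation of dyadic pieces of an oscillatory integral operator. -/
theorem eLpNorm_oscInt_le_of_pieces {b : ℕ → Rn n → Rn n → ℂ} {B : Rn n → Rn n → ℂ}
    {φ : Rn n → Rn n → ℝ} {G : Rn n → ℝ} {f : Rn n → ℂ} {C r : ℝ} (hC : 0 ≤ C) (hr0 : 0 ≤ r)
    (hr1 : r < 1)
    (hbm : ∀ j, StronglyMeasurable (Function.uncurry fun x ξ =>
      b j x ξ * Complex.exp (Complex.I * (φ x ξ : ℝ))))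
    (hdom : ∀ J x ξ, ‖∑ j ∈ Finset.range J, b j x ξ‖ ≤ G ξ)
    (hlim : ∀ x, ∀ᵐ ξ, Tendsto (fun J => ∑ j ∈ Finset.range J, b j x ξ) atTop (𝓝 (B x ξ)))
    (hf : StronglyMeasurable f) (hGf : Integrable fun ξ => G ξ * ‖f ξ‖)
    (hb : ∀ j, eLpNorm (oscInt (b j) φ f) 2 volume ≤
      ENNReal.ofReal (C * r ^ j) * eLpNorm f 2 volume) :
    StronglyMeasurable (oscInt B φ f) ∧ eLpNorm (oscInt B φ f) 2 volume ≤
      ENNReal.ofReal (C * (1 - r)⁻¹) * eLpNorm f 2 volume := by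
  have hexp : ∀ x ξ, ‖Complex.exp (Complex.I * (φ x ξ : ℝ))‖ = 1 := fun x ξ => by
    rw [mul_comm, Complex.norm_exp_ofReal_mul_I]
  have hmeas : ∀ j x, StronglyMeasurable fun ξ =>
      b j x ξ * Complex.exp (Complex.I * (φ x ξ : ℝ)) * f ξ := fun j x =>
    ((hbm j).comp_measurable measurable_prodMk_left).mul hf
  have hint : ∀ j x, Integrable fun ξ =>
      b j x ξ * Complex.exp (Complex.I * (φ x ξ : ℝ)) * f ξ := fun j x => by
    refine (hGf.const_mul 2).mono' (hmeas j x).aestronglyMeasurable (ae_of_all _ fun ξ => ?_)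
    rw [norm_mul, norm_mul, hexp, mul_one]
    -- A single piece is the difference of two partial sums, so the domination of the sums gives
    -- integrability of every piece.
    have h1 : b j x ξ = ∑ i ∈ Finset.range (j + 1), b i x ξ - ∑ i ∈ Finset.range j, b i x ξ := by
      rw [Finset.sum_range_succ]; ring
    have h2 : ‖b j x ξ‖ ≤ 2 * G ξ := by
      rw [h1, two_mul]
      exact (norm_sub_le _ _).trans (add_le_add (hdom _ x ξ) (hdom _ x ξ))
    rw [← mul_assoc]
    gcongr
  refine eLpNorm_le_of_tendsto_sum (fun j => stronglyMeasurable_oscInt (hbm j) hf) hC hr0 hr1 hb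
    fun x => ?_
  have hsum : ∀ J, ∑ j ∈ Finset.range J, oscInt (b j) φ f x =
      ∫ ξ, (∑ j ∈ Finset.range J, b j x ξ) * Complex.exp (Complex.I * (φ x ξ : ℝ)) * f ξ := by
    intro J
    simp_rw [oscInt, Finset.sum_mul]
    rw [integral_finsetSum _ fun j _ => hint j x]
  simp_rw [hsum]
  refine tendsto_integral_of_dominated_convergence (fun ξ => G ξ * ‖f ξ‖) (fun J => ?_) hGf
    (fun J => ae_of_all _ fun ξ => ?_) ?_
  · simp_rw [Finset.sum_mul]
    exact (Finset.stronglyMeasurable_fun_sum _ fun j _ => hmeas j x).aestronglyMeasurable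
  · rw [norm_mul, norm_mul, hexp, mul_one]
    gcongr
    exact hdom J x ξ
  · filter_upwards [hlim x] with ξ hξ
    exact (hξ.mul_const _).mul_const _

theorem contDiff_ofReal_comp {g : Rn n → ℝ} (hg : ContDiff ℝ ∞ g) :
    ContDiff ℝ ∞ fun ξ => (g ξ : ℂ) :=
  Complex.ofRealCLM.contDiff.comp hg

theorem hasCompactSupport_ofReal_comp {g : Rn n → ℝ} (hg : HasCompactSupport g) :
    HasCompactSupport fun ξ => (g ξ : ℂ) :=
  hg.comp_left Complex.ofReal_zero

theorem stronglyMeasurable_cexp_phase {φ : Rn n → Rn n → ℝ}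
    (hφ : Measurable (Function.uncurry φ)) : StronglyMeasurable (Function.uncurry fun x ξ =>
      Complex.exp (Complex.I * (φ x ξ : ℝ))) := by
  have : Measurable fun p : Rn n × Rn n => Complex.exp (Complex.I * (φ p.1 p.2 : ℝ)) :=
    Complex.measurable_exp.comp ((Complex.measurable_ofReal.comp hφ).const_mul _)
  exact this.stronglyMeasurable

theorem tsupport_subset_of_isClosed {g : Rn n → ℂ} {S : Set (Rn n)} (hS : IsClosed S)
    (h : ∀ ξ, g ξ ≠ 0 → ξ ∈ S) : tsupport g ⊆ S :=
  closure_minimal (fun ξ hξ => h ξ hξ) hS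

/-- The dyadic pieces at frequencies at least `1`. -/
theorem high_frequency_bound {m ρ : ℝ} (hρ₁ : ρ ≤ 1) (hm : m < (n : ℝ) / 2 * (ρ - 1))
    {a : Rn n → Rn n → ℂ} (ha : RegularAmplitude m ρ a) {φ : Rn n → Rn n → ℝ}
    (hφ : MemPhase 2 φ) (hnd : StronglyNondegenerate φ) (hφm : Measurable (Function.uncurry φ)) :
    ∃ C, 0 ≤ C ∧ ∀ f : Rn n → ℂ, StronglyMeasurable f → Integrable f →
      Integrable (fun ξ => bracket ξ ^ m * ‖f ξ‖) →
      StronglyMeasurable (oscInt (fun x ξ => a x ξ * ((1 - cutoff n ξ : ℝ) : ℂ)) φ f) ∧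
      eLpNorm (oscInt (fun x ξ => a x ξ * ((1 - cutoff n ξ : ℝ) : ℂ)) φ f) 2 volume ≤
        ENNReal.ofReal C * eLpNorm f 2 volume := by
  obtain ⟨Ca, hCa, hab⟩ := ha.norm_le
  obtain ⟨V, hV, hvol⟩ := exists_volume_closedBall_le n
  obtain ⟨c, hc, hgb⟩ := hφ.gradient_bounded_below hnd
  set lam : ℕ → ℝ := fun j => 2 ^ j with hlam
  have hl0 : ∀ j, 0 < lam j := fun j => by positivity
  have hl1 : ∀ j, 1 ≤ lam j := fun j => one_le_pow₀ one_le_two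
  set S : ℕ → Set (Rn n) := fun j => {ξ | lam j ≤ ‖ξ‖ ∧ ‖ξ‖ ≤ 4 * lam j} with hS
  have hSne : ∀ j, ∀ ξ ∈ S j, ξ ≠ 0 := fun j ξ hξ =>
    norm_pos_iff.1 ((hl0 j).trans_le hξ.1)
  have hSc : ∀ j, IsClosed (S j) := fun j =>
    (isClosed_le continuous_const continuous_norm).inter
      (isClosed_le continuous_norm continuous_const)
  -- The amplitude loses λ^{-ρ} per derivative, the cutoff and the phase only λ⁻¹, which is no
  -- larger because ρ ≤ 1 and λ ≥ 1.
  set t : ℕ → ℝ := fun j => lam j ^ (-ρ) with ht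
  have ht0 : ∀ j, 0 < t j := fun j => Real.rpow_pos_of_pos (hl0 j) _
  have hinvt : ∀ j, (lam j)⁻¹ ≤ t j := fun j => by
    rw [← Real.rpow_neg_one]
    exact Real.rpow_le_rpow_of_exponent_le (hl1 j) (by linarith)
  set A : ℕ → ℝ := fun j => lam j ^ m with hA
  have hA0 : ∀ j, 0 < A j := fun j => Real.rpow_pos_of_pos (hl0 j) _
  set b : ℕ → Rn n → Rn n → ℂ := fun j x ξ => a x ξ * ((annulus n ((lam j)⁻¹ • ξ) : ℝ) : ℂ) with hb
  have hbne : ∀ j x ξ, b j x ξ ≠ 0 → ξ ∈ S j := by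
    intro j x ξ h
    have h1 : annulus n ((lam j)⁻¹ • ξ) ≠ 0 := fun h0 => h (by simp [hb, h0])
    have h2 := mem_annulus_of_ne_zero h1
    rw [norm_smul, norm_inv, Real.norm_of_nonneg (hl0 j).le, le_inv_mul_iff₀ (hl0 j),
      inv_mul_le_iff₀ (hl0 j)] at h2
    exact ⟨by linarith [h2.1], by linarith [h2.2]⟩
  have hbS : ∀ j x, tsupport (b j x) ⊆ S j := fun j x =>
    tsupport_subset_of_isClosed (hSc j) (hbne j x)
  have hScomp : ∀ j, S j ⊆ Metric.closedBall 0 (4 * lam j) := fun j ξ hξ => by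
    simpa using hξ.2
  have hbc : ∀ j x, HasCompactSupport (b j x) := fun j x =>
    HasCompactSupport.of_support_subset_isCompact (isCompact_closedBall (0 : Rn n) (4 * lam j))
      fun ξ hξ => hScomp j (hbne j x ξ hξ)
  have hbm : ∀ j, StronglyMeasurable (Function.uncurry fun x ξ =>
      b j x ξ * Complex.exp (Complex.I * (φ x ξ : ℝ))) := by
    intro j
    refine (ha.measurable.mul ?_).mul (stronglyMeasurable_cexp_phase hφm)
    have : Continuous fun p : Rn n × Rn n => ((annulus n ((lam j)⁻¹ • p.2) : ℝ) : ℂ) :=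
      Complex.continuous_ofReal.comp (contDiff_annulus.continuous.comp (by fun_prop))
    exact this.stronglyMeasurable
  have hbsym : ∀ N, SymFam (fun p : ℕ × Rn n => S p.1) (fun p => t p.1) (fun p => A p.1) N
      (fun p => b p.1 p.2) := by
    intro N
    have h1 := ha.symFam (S := S) (t := t) (A := A) (fun j => (ht0 j).le) (fun j => (hA0 j).le)
      (fun k => ⟨5 ^ |m - ρ * k|, by positivity, fun j ξ hξ => by
        have h2 : bracket ξ ≤ 5 * lam j := by
          have := bracket_le_one_add_norm ξ
          have := hξ.2
          have := hl1 j
          linarith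
        refine (rpow_le_of_comparable (hl0 j) (hξ.1.trans (norm_le_bracket ξ)) h2 _).trans_eq ?_
        rw [mul_assoc, hA, ht]
        simp only
        rw [← Real.rpow_natCast (lam j ^ (-ρ)), ← Real.rpow_mul (hl0 j).le,
          ← Real.rpow_add (hl0 j)]
        ring_nf⟩) N
    have h2 : SymFam (fun p : ℕ × Rn n => S p.1) (fun p => t p.1) (fun _ => 1) N
        (fun p ξ => ((annulus n ((lam p.1)⁻¹ • ξ) : ℝ) : ℂ)) :=
      (SymFam.dilation (S := fun p : ℕ × Rn n => S p.1) (t := fun p => (lam p.1)⁻¹) (k := N)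
        (contDiff_ofReal_comp contDiff_annulus)
        (hasCompactSupport_ofReal_comp hasCompactSupport_annulus)
        (fun p => (inv_pos.2 (hl0 p.1)).le)).weaken (fun p => (inv_pos.2 (hl0 p.1)).le)
        (fun p => hinvt p.1) (fun _ => zero_le_one) zero_le_one (fun _ => by norm_num)
    simpa using h1.mul h2
  -- The squared norm of a piece is of order λ^{2m} λⁿ λ^{-ρn} = r^{2j}; the condition r < 1 is
  -- exactly m < n(ρ-1)/2.
  set r : ℝ := 2 ^ (m - (n : ℝ) / 2 * (ρ - 1)) with hr
  have hr0 : 0 < r := Real.rpow_pos_of_pos two_pos _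
  have hr1 : r < 1 := Real.rpow_lt_one_of_one_lt_of_neg one_lt_two (by linarith)
  obtain ⟨C, hC, hosc⟩ := oscillatory_eLpNorm_bound (S := S) (t := t) (A := A)
    (Vol := fun j => V * (4 * lam j) ^ n) (W := fun j => r ^ j) (φ := fun _ => φ) (b := b)
    ht0 hA0 (fun j => by have := hl0 j; positivity)
    (fun j => (measure_mono (hScomp j)).trans (hvol _ (by have := hl0 j; positivity)))
    hbm hbsym hbc hbS
    (fun j x ξ hξ => (hφ.contDiffAt x (hSne j ξ hξ)).of_le ENat.LEInfty.out)
    (fun N k => hφ.symFam_fderiv_sub (fun j => (ht0 j).le) (K := 1) (fun j ξ hξ =>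
      ⟨hSne j ξ hξ, by
        rw [one_mul]
        exact (inv_anti₀ (hl0 j) hξ.1).trans (hinvt j)⟩) N _)
    hc (fun j x y ξ hξ => (hgb x y ξ (hSne j ξ hξ)).trans_eq (Finset.sum_congr rfl fun k _ => by
      rw [fderiv_fun_sub ((hφ.contDiffAt x (hSne j ξ hξ)).differentiableAt (by simp))
        ((hφ.contDiffAt y (hSne j ξ hξ)).differentiableAt (by simp))]
      rfl))
    (K := V * 4 ^ n) (by positivity) (fun j => by positivity) (fun j => by
      have hkey : A j ^ 2 * lam j ^ n * t j ^ n = (r ^ j) ^ 2 := by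
        have e1 : lam j = (2 : ℝ) ^ (j : ℝ) := by simp [hlam]
        simp only [hA, ht, hr]
        rw [e1]
        simp only [← Real.rpow_natCast, ← Real.rpow_mul two_pos.le, ← Real.rpow_add two_pos]
        congr 1
        push_cast
        ring
      refine le_of_eq ?_
      rw [← hkey, mul_pow]
      ring)
  refine ⟨C * (1 - r)⁻¹, mul_nonneg hC (inv_nonneg.2 (by linarith)), fun f hfm hfi hfb => ?_⟩
  have hsum : ∀ J x ξ, ∑ j ∈ Finset.range J, b j x ξ =
      a x ξ * ((cutoff n (((2 : ℝ) ^ J)⁻¹ • ξ) - cutoff n ξ : ℝ) : ℂ) := fun J x ξ => by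
    rw [← sum_annulus_high, Complex.ofReal_sum, Finset.mul_sum]
  refine eLpNorm_oscInt_le_of_pieces (G := fun ξ => Ca * bracket ξ ^ m) hC hr0.le hr1 hbm
    (fun J x ξ => ?_) (fun x => ae_of_all _ fun ξ => ?_) hfm ?_ (fun j => hosc j f hfi)
  · rw [hsum, norm_mul, Complex.norm_real]
    refine (mul_le_of_le_one_right (norm_nonneg _) ?_).trans (hab x ξ)
    rw [Real.norm_eq_abs, abs_le]
    have h1 := cutoff_nonneg ξ
    have h2 := cutoff_le_one ξ
    have h3 := cutoff_nonneg (((2 : ℝ) ^ J)⁻¹ • ξ)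
    have h4 := cutoff_le_one (((2 : ℝ) ^ J)⁻¹ • ξ)
    constructor <;> linarith
  · simp_rw [hsum]
    exact tendsto_const_nhds.mul ((Complex.continuous_ofReal.tendsto _).comp
      ((tendsto_cutoff_high ξ).sub_const _))
  · simpa only [mul_assoc] using hfb.const_mul Ca

end RoughFIO

/-! ### Low frequencies: linearised phase and remainder. -/

namespace RoughFIO

open Filter Topology
open scoped ENNReal

variable {n : ℕ}

/-- The linear phase `ξ ↦ ⟨∇_ξ φ(x, e), ξ⟩`. -/
def linearPhase (φ : Rn n → Rn n → ℝ) (e x ξ : Rn n) : ℝ := fderiv ℝ (φ x) e ξ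

theorem MemPhase.measurable_linearPhase {φ : Rn n → Rn n → ℝ} (hφ : MemPhase 2 φ) {e : Rn n}
    (he : e ≠ 0) : Measurable (Function.uncurry (linearPhase φ e)) := by
  have h1 : Continuous fun x : Rn n => fderiv ℝ (φ x) e := by
    refine continuous_iff_continuousAt.2 fun x => ?_
    have h2 := (contDiffAt_fderiv_param (g := φ) (p := (x, e))
      (hφ.contDiffAt_uncurry (x, e) he)).continuousAt
    exact h2.comp (f := fun y : Rn n => (y, e)) (by fun_prop)
  exact ((h1.comp continuous_fst).clm_apply continuous_snd).measurable

theorem contDiff_linearPhase (φ : Rn n → Rn n → ℝ) (e x : Rn n) :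
    ContDiff ℝ ∞ (linearPhase φ e x) := (fderiv ℝ (φ x) e).contDiff

theorem fderiv_linearPhase_sub (φ : Rn n → Rn n → ℝ) (e x y ξ : Rn n) :
    fderiv ℝ (fun η => linearPhase φ e x η - linearPhase φ e y η) ξ =
      fderiv ℝ (φ x) e - fderiv ℝ (φ y) e :=
  (fderiv ℝ (φ x) e - fderiv ℝ (φ y) e).fderiv

theorem MemPhase.norm_fderiv_sub_le {φ : Rn n → Rn n → ℝ} (hφ : MemPhase 2 φ) : ∃ C, 0 ≤ C ∧
    ∀ x y e : Rn n, e ≠ 0 → ‖fderiv ℝ (φ x) e - fderiv ℝ (φ y) e‖ ≤ C * ‖x - y‖ := by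
  obtain ⟨C, hC, h⟩ := hφ.norm_iteratedFDeriv_sub_le le_rfl
  refine ⟨C, hC, fun x y e he => ContinuousLinearMap.opNorm_le_bound _ (by positivity) fun v => ?_⟩
  have h1 := h x y e he
  simp only [Nat.cast_one, sub_self, zpow_zero, mul_one] at h1
  have h2 := (iteratedFDeriv ℝ 1 (φ x) e - iteratedFDeriv ℝ 1 (φ y) e).le_opNorm fun _ => v
  simp only [_root_.sub_apply, iteratedFDeriv_one_apply, Finset.univ_unique,
    Finset.prod_const, Finset.card_singleton, pow_one] at h2
  exact h2.trans (by gcongr)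

/-- The gradient of a difference of linear phases is constant in ξ, so only its size matters and any
rate t is admissible. -/
theorem MemPhase.symFam_linearPhase {φ : Rn n → Rn n → ℝ} (hφ : MemPhase 2 φ) {e : Rn n}
    (he : e ≠ 0) {ι : Type*} (S : ι → Set (Rn n)) {t : ι → ℝ} (ht : ∀ i, 0 ≤ t i) (N : ℕ)
    (v : Rn n) :
    SymFam (fun p : ι × Rn n × Rn n => S p.1) (fun p => t p.1) (fun p => ‖p.2.1 - p.2.2‖) N
      (fun p ξ => fderiv ℝ (fun η => linearPhase φ e p.2.1 η - linearPhase φ e p.2.2 η) ξ v) := by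
  obtain ⟨C, hC, h⟩ := hφ.norm_fderiv_sub_le
  simp_rw [fderiv_linearPhase_sub]
  refine SymFam.const (fun _ => norm_nonneg _) (fun p : ι × Rn n × Rn n => ht p.1) (K := C * ‖v‖) (by positivity)
    fun p => ?_
  refine (ContinuousLinearMap.le_opNorm _ v).trans ?_
  calc _ ≤ (C * ‖p.2.1 - p.2.2‖) * ‖v‖ := by
        gcongr
        exact h _ _ e he
    _ = _ := by ring

theorem MemPhase.linearPhase_gradient_bounded_below {φ : Rn n → Rn n → ℝ} (hφ : MemPhase 2 φ)
    (hnd : StronglyNondegenerate φ) : ∃ c, 0 < c ∧ ∀ e x y ξ : Rn n, e ≠ 0 →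
      c * ‖x - y‖ ^ 2 ≤ ∑ k : Fin n, fderiv ℝ (fun η => linearPhase φ e x η - linearPhase φ e y η) ξ
        (EuclideanSpace.single k 1) ^ 2 := by
  obtain ⟨c, hc, h⟩ := hφ.gradient_bounded_below hnd
  refine ⟨c, hc, fun e x y ξ he => ?_⟩
  rw [fderiv_linearPhase_sub]
  exact h x y e he

/-- The low-frequency part, with the phase replaced by its linearisation at `e`. -/
theorem low_frequency_linear_bound {m ρ : ℝ} {a : Rn n → Rn n → ℂ} (ha : RegularAmplitude m ρ a)
    {φ : Rn n → Rn n → ℝ} (hφ : MemPhase 2 φ) (hnd : StronglyNondegenerate φ) {e : Rn n}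
    (he : e ≠ 0) : ∃ C, 0 ≤ C ∧ ∀ f : Rn n → ℂ, StronglyMeasurable f → Integrable f →
      StronglyMeasurable (oscInt (fun x ξ => a x ξ * (cutoff n ξ : ℂ)) (linearPhase φ e) f) ∧
      eLpNorm (oscInt (fun x ξ => a x ξ * (cutoff n ξ : ℂ)) (linearPhase φ e) f) 2 volume ≤
        ENNReal.ofReal C * eLpNorm f 2 volume := by
  obtain ⟨V, hV, hvol⟩ := exists_volume_closedBall_le n
  obtain ⟨c, hc, hgb⟩ := hφ.linearPhase_gradient_bounded_below hnd
  set b : Rn n → Rn n → ℂ := fun x ξ => a x ξ * (cutoff n ξ : ℂ) with hb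
  set S : Unit → Set (Rn n) := fun _ => Metric.closedBall 0 2 with hS
  have hbne : ∀ x ξ, b x ξ ≠ 0 → ξ ∈ Metric.closedBall (0 : Rn n) 2 := by
    intro x ξ h
    by_contra hcon
    rw [mem_closedBall_zero_iff, not_le] at hcon
    exact h (by simp [hb, cutoff_eq_zero hcon.le])
  have hbm : StronglyMeasurable (Function.uncurry fun x ξ =>
      b x ξ * Complex.exp (Complex.I * (linearPhase φ e x ξ : ℝ))) := by
    refine (ha.measurable.mul ?_).mul (stronglyMeasurable_cexp_phase (hφ.measurable_linearPhase he))
    have : Continuous fun p : Rn n × Rn n => ((cutoff n p.2 : ℝ) : ℂ) :=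
      Complex.continuous_ofReal.comp (contDiff_cutoff.continuous.comp continuous_snd)
    exact this.stronglyMeasurable
  have hbsym : ∀ N, SymFam (fun p : Unit × Rn n => S p.1) (fun _ => 1) (fun _ => 1) N
      (fun p => b p.2) := by
    intro N
    have h1 := ha.symFam (S := S) (t := fun _ => 1) (A := fun _ => 1) (fun _ => zero_le_one)
      (fun _ => zero_le_one) (fun k => ⟨5 ^ |m - ρ * k|, by positivity, fun j ξ hξ => by
        have h2 : bracket ξ ≤ 5 * 1 := by
          have := bracket_le_one_add_norm ξ
          have : ‖ξ‖ ≤ 2 := mem_closedBall_zero_iff.1 hξ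
          linarith
        simpa using rpow_le_of_comparable one_pos (one_le_bracket ξ) h2 (m - ρ * k)⟩) N
    have h2 : SymFam (fun p : Unit × Rn n => S p.1) (fun _ => 1) (fun _ => 1) N
        (fun _ ξ => (cutoff n ((1 : ℝ) • ξ) : ℂ)) :=
      SymFam.dilation (contDiff_ofReal_comp contDiff_cutoff)
        (hasCompactSupport_ofReal_comp hasCompactSupport_cutoff) (fun _ => zero_le_one)
    simpa using h1.mul h2
  obtain ⟨C, hC, hosc⟩ := oscillatory_eLpNorm_bound (S := S) (t := fun _ => 1) (A := fun _ => 1)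
    (Vol := fun _ => V * 2 ^ n) (W := fun _ => 1) (φ := fun _ => linearPhase φ e) (b := fun _ => b)
    (fun _ => one_pos) (fun _ => one_pos) (fun _ => by positivity) (fun _ => hvol 2 two_pos)
    (fun _ => hbm) hbsym
    (fun _ x => HasCompactSupport.of_support_subset_isCompact (isCompact_closedBall (0 : Rn n) 2)
      fun ξ hξ => hbne x ξ hξ)
    (fun _ x => tsupport_subset_of_isClosed Metric.isClosed_closedBall (hbne x))
    (fun _ x ξ _ => (contDiff_linearPhase φ e x).contDiffAt.of_le ENat.LEInfty.out)
    (fun N k => hφ.symFam_linearPhase he S (fun _ => zero_le_one) N _)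
    hc (fun _ x y ξ _ => hgb e x y ξ he)
    (K := V * 2 ^ n) (by positivity) (fun _ => zero_le_one) (fun _ => by simp)
  refine ⟨C, hC, fun f hfm hfi => ⟨stronglyMeasurable_oscInt hbm hfm, ?_⟩⟩
  simpa using hosc () f hfi

/-- The dyadic pieces at frequencies at most `1` of the error made in replacing the phase by its
linearisation at `e`, in a cone around `e`. -/
theorem low_frequency_remainder_bound {m ρ : ℝ} {a : Rn n → Rn n → ℂ}
    (ha : RegularAmplitude m ρ a) {φ : Rn n → Rn n → ℝ} (hφ : MemPhase 2 φ)
    (hnd : StronglyNondegenerate φ) (hφm : Measurable (Function.uncurry φ)) {e : Rn n}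
    (he : ‖e‖ = 1) : ∃ C, 0 ≤ C ∧ ∀ f : Rn n → ℂ, StronglyMeasurable f → Integrable f →
      Integrable (fun ξ => bracket ξ ^ m * ‖f ξ‖) →
      ∀ b : Rn n → Rn n → ℂ, (∀ x ξ, b x ξ = a x ξ * (cutoff n ξ * coneCutoff e ξ : ℝ) *
        (Complex.exp (Complex.I * (φ x ξ - linearPhase φ e x ξ : ℝ)) - 1)) →
      StronglyMeasurable (oscInt b (linearPhase φ e) f) ∧
      eLpNorm (oscInt b (linearPhase φ e) f) 2 volume ≤
        ENNReal.ofReal C * eLpNorm f 2 volume := by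
  have he0 : e ≠ 0 := norm_ne_zero_iff.1 (by rw [he]; exact one_ne_zero)
  obtain ⟨Ca, hCa, hab⟩ := ha.norm_le
  obtain ⟨V, hV, hvol⟩ := exists_volume_closedBall_le n
  obtain ⟨c, hc, hgb⟩ := hφ.linearPhase_gradient_bounded_below hnd
  -- Starting at 1/2 matches the telescoping sum for the cutoff, whose support is the ball of radius
  -- 2 ≥ 4λ, and keeps the weight λ of θ below 1, as the estimate of e^{iθ} - 1 requires.
  set lam : ℕ → ℝ := fun j => ((2 : ℝ) ^ (j + 1))⁻¹ with hlam
  have hl0 : ∀ j, 0 < lam j := fun j => by positivity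
  have hl1 : ∀ j, lam j ≤ 1 / 2 := fun j => by
    simp only [hlam, pow_succ, mul_inv]
    have : ((2 : ℝ) ^ j)⁻¹ ≤ 1 := inv_le_one_of_one_le₀ (one_le_pow₀ one_le_two)
    linarith
  set S : ℕ → Set (Rn n) := fun j =>
    {ξ | (lam j ≤ ‖ξ‖ ∧ ‖ξ‖ ≤ 4 * lam j) ∧ -(‖ξ‖ / 2) ≤ inner ℝ ξ e} with hS
  have hSne : ∀ j, ∀ ξ ∈ S j, ξ ≠ 0 := fun j ξ hξ =>
    norm_pos_iff.1 ((hl0 j).trans_le hξ.1.1)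
  have hSc : ∀ j, IsClosed (S j) := fun j =>
    ((isClosed_le continuous_const continuous_norm).inter
      (isClosed_le continuous_norm continuous_const)).inter
      (isClosed_le (f := fun ξ : Rn n => -(‖ξ‖ / 2)) (g := fun ξ => inner ℝ ξ e) (by fun_prop)
        (by fun_prop))
  set θ : Rn n → Rn n → ℝ := fun x ξ => φ x ξ - linearPhase φ e x ξ with hθ
  set b : ℕ → Rn n → Rn n → ℂ := fun j x ξ => a x ξ * (coneAnnulus e ((lam j)⁻¹ • ξ) : ℂ) *
    (Complex.exp (Complex.I * (θ x ξ : ℝ)) - 1) with hb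
  have hcone : ∀ j ξ, coneAnnulus e ((lam j)⁻¹ • ξ) =
      annulus n ((lam j)⁻¹ • ξ) * coneCutoff e ξ := fun j ξ => by
    rw [coneAnnulus, coneCutoff_smul _ _ (inv_pos.2 (hl0 j))]
  have hbne : ∀ j x ξ, b j x ξ ≠ 0 → ξ ∈ S j := by
    intro j x ξ h
    have h1 : annulus n ((lam j)⁻¹ • ξ) ≠ 0 := fun h0 => h (by simp [hb, hcone, h0])
    have h3 : coneCutoff e ξ ≠ 0 := fun h0 => h (by simp [hb, hcone, h0])
    have h2 := mem_annulus_of_ne_zero h1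
    rw [norm_smul, norm_inv, Real.norm_of_nonneg (hl0 j).le, le_inv_mul_iff₀ (hl0 j),
      inv_mul_le_iff₀ (hl0 j)] at h2
    exact ⟨⟨by linarith [h2.1], by linarith [h2.2]⟩, mem_cone_of_coneCutoff_ne_zero h3⟩
  have hScomp : ∀ j, S j ⊆ Metric.closedBall 0 (4 * lam j) := fun j ξ hξ => by
    simpa using hξ.1.2
  have hbc : ∀ j x, HasCompactSupport (b j x) := fun j x =>
    HasCompactSupport.of_support_subset_isCompact (isCompact_closedBall (0 : Rn n) (4 * lam j))
      fun ξ hξ => hScomp j (hbne j x ξ hξ)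
  have hθm : Measurable (Function.uncurry θ) := hφm.sub (hφ.measurable_linearPhase he0)
  have hbm : ∀ j, StronglyMeasurable (Function.uncurry fun x ξ =>
      b j x ξ * Complex.exp (Complex.I * (linearPhase φ e x ξ : ℝ))) := by
    intro j
    refine ((ha.measurable.mul ?_).mul ((stronglyMeasurable_cexp_phase hθm).sub
      stronglyMeasurable_const)).mul (stronglyMeasurable_cexp_phase (hφ.measurable_linearPhase he0))
    have : Continuous fun p : Rn n × Rn n => ((coneAnnulus e ((lam j)⁻¹ • p.2) : ℝ) : ℂ) :=
      Complex.continuous_ofReal.comp ((contDiff_coneAnnulus e).continuous.comp (by fun_prop))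
    exact this.stronglyMeasurable
  have ht0 : ∀ j, 0 < (lam j)⁻¹ := fun j => inv_pos.2 (hl0 j)
  have hbsym : ∀ N, SymFam (fun p : ℕ × Rn n => S p.1) (fun p => (lam p.1)⁻¹) (fun p => lam p.1) N
      (fun p => b p.1 p.2) := by
    intro N
    have h1 := ha.symFam (S := S) (t := fun j => (lam j)⁻¹) (A := fun _ => 1)
      (fun j => (ht0 j).le) (fun _ => zero_le_one)
      (fun k => ⟨5 ^ |m - ρ * k|, by positivity, fun j ξ hξ => by
        have h2 : bracket ξ ≤ 5 * 1 := by
          have := bracket_le_one_add_norm ξ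
          have := hξ.1.2
          have := hl1 j
          linarith
        have h3 := rpow_le_of_comparable one_pos (one_le_bracket ξ) h2 (m - ρ * k)
        rw [Real.one_rpow, mul_one] at h3
        rw [mul_one]
        refine h3.trans (le_mul_of_one_le_right (by positivity) (one_le_pow₀ ?_))
        exact (one_le_inv₀ (hl0 j)).2 (by linarith [hl1 j])⟩) N
    have h2 : SymFam (fun p : ℕ × Rn n => S p.1) (fun p => (lam p.1)⁻¹) (fun _ => 1) N
        (fun p ξ => (coneAnnulus e ((lam p.1)⁻¹ • ξ) : ℂ)) :=
      SymFam.dilation (S := fun p : ℕ × Rn n => S p.1) (t := fun p => (lam p.1)⁻¹) (k := N)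
        (contDiff_ofReal_comp (contDiff_coneAnnulus e))
        (hasCompactSupport_ofReal_comp (hasCompactSupport_coneAnnulus e))
        (fun p => (ht0 p.1).le)
    have h3 : SymFam (fun p : ℕ × Rn n => S p.1) (fun p => (lam p.1)⁻¹) (fun p => lam p.1) N
        (fun p => θ p.2) := by
      refine SymFam.of_forall (fun p : ℕ × Rn n => (hl0 p.1).le) (fun p => (ht0 p.1).le)
        (fun p ξ hξ => hφ.contDiffAt_remainder p.2 e (hSne p.1 ξ hξ)) (fun k => ?_) N
      obtain ⟨C, hC, hr⟩ := hφ.norm_iteratedFDeriv_remainder_le k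
      refine ⟨C * 4, by positivity, fun p ξ hξ => (hr p.2 e ξ he (hSne _ ξ hξ) hξ.2).trans ?_⟩
      rw [mul_assoc, mul_assoc]
      refine mul_le_mul_of_nonneg_left ?_ hC
      have hξ0 : 0 < ‖ξ‖ := norm_pos_iff.2 (hSne _ ξ hξ)
      rw [zpow_sub₀ hξ0.ne', zpow_one, zpow_natCast, div_eq_mul_inv, ← inv_pow, ← mul_assoc]
      have h5 : ‖ξ‖⁻¹ ≤ (lam p.1)⁻¹ := inv_anti₀ (hl0 p.1) hξ.1.1
      have h6 := hξ.1.2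
      have h7 := (hl0 p.1).le
      gcongr
    have h4 := (h1.mul h2).mul (h3.cexp_sub_one (fun p => (hl0 p.1).le)
      (fun p => by linarith [hl1 p.1]) (fun p => (ht0 p.1).le))
    simpa using h4
  -- Volume λⁿ and rate λ⁻¹ cancel exactly, so the squared norm of a piece is governed by the factor
  -- λ² gained from e^{iθ} - 1.
  obtain ⟨C, hC, hosc⟩ := oscillatory_eLpNorm_bound (S := S) (t := fun j => (lam j)⁻¹)
    (A := lam) (Vol := fun j => V * (4 * lam j) ^ n) (W := fun j => (1 / 2 : ℝ) ^ j)
    (φ := fun _ => linearPhase φ e) (b := b)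
    ht0 hl0 (fun j => by have := hl0 j; positivity)
    (fun j => (measure_mono (hScomp j)).trans (hvol _ (by have := hl0 j; positivity)))
    hbm hbsym hbc (fun j x => tsupport_subset_of_isClosed (hSc j) (hbne j x))
    (fun j x ξ _ => (contDiff_linearPhase φ e x).contDiffAt.of_le ENat.LEInfty.out)
    (fun N k => hφ.symFam_linearPhase he0 S (fun j => (ht0 j).le) N _)
    hc (fun j x y ξ _ => hgb e x y ξ he0)
    (K := V * 4 ^ n) (by positivity) (fun j => by positivity) (fun j => by
      have h1 : lam j ^ n * (lam j)⁻¹ ^ n = 1 := by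
        rw [← mul_pow, mul_inv_cancel₀ (hl0 j).ne', one_pow]
      have h2 : lam j ≤ (1 / 2 : ℝ) ^ j := by
        rw [one_div, inv_pow]
        exact inv_anti₀ (by positivity) (pow_le_pow_right₀ one_le_two (Nat.le_succ j))
      calc lam j ^ 2 * (V * (4 * lam j) ^ n) * (lam j)⁻¹ ^ n
          = V * 4 ^ n * lam j ^ 2 * (lam j ^ n * (lam j)⁻¹ ^ n) := by rw [mul_pow]; ring
        _ = V * 4 ^ n * lam j ^ 2 := by rw [h1, mul_one]
        _ ≤ _ := by
          have := (hl0 j).le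
          gcongr)
  refine ⟨C * (1 - 1 / 2)⁻¹, by positivity, fun f hfm hfi hfb B hB => ?_⟩
  have hsum : ∀ J x ξ, ∑ j ∈ Finset.range J, b j x ξ = a x ξ *
      (((cutoff n ξ - cutoff n ((2 : ℝ) ^ J • ξ)) * coneCutoff e ξ : ℝ) : ℂ) *
        (Complex.exp (Complex.I * (θ x ξ : ℝ)) - 1) := fun J x ξ => by
    simp only [hb]
    rw [← Finset.sum_mul, ← Finset.mul_sum, ← Complex.ofReal_sum]
    simp_rw [hcone]
    rw [← Finset.sum_mul]
    simp only [hlam, inv_inv]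
    rw [sum_annulus_low]
  refine eLpNorm_oscInt_le_of_pieces (G := fun ξ => 2 * Ca * bracket ξ ^ m) hC (by norm_num)
    (by norm_num) hbm (fun J x ξ => ?_) (fun x => ?_) hfm ?_ (fun j => hosc j f hfi)
  · rw [hsum, norm_mul, norm_mul, Complex.norm_real]
    have h5 : ‖Complex.exp (Complex.I * (θ x ξ : ℝ)) - 1‖ ≤ 2 := by
      refine (norm_sub_le _ _).trans ?_
      rw [mul_comm, Complex.norm_exp_ofReal_mul_I, norm_one]
      norm_num
    have h6 : ‖(cutoff n ξ - cutoff n ((2 : ℝ) ^ J • ξ)) * coneCutoff e ξ‖ ≤ 1 := by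
      rw [norm_mul, Real.norm_of_nonneg (coneCutoff_nonneg e ξ)]
      refine mul_le_one₀ ?_ (coneCutoff_nonneg e ξ) (coneCutoff_le_one e ξ)
      rw [Real.norm_eq_abs, abs_le]
      have h1 := cutoff_nonneg ξ
      have h2 := cutoff_le_one ξ
      have h3 := cutoff_nonneg ((2 : ℝ) ^ J • ξ)
      have h4 := cutoff_le_one ((2 : ℝ) ^ J • ξ)
      constructor <;> linarith
    calc _ ≤ (Ca * bracket ξ ^ m) * 1 * 2 := by
          have := (bracket_pos ξ).le
          gcongr
          exact hab x ξ
      _ = _ := by ring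
  -- At ξ = 0 the annular sums are identically 0 and do not recover the cutoff, so convergence holds
  -- only almost everywhere.
  · have hne : ∀ᵐ ξ : Rn n, ξ ≠ 0 := by
      have : Nontrivial (Rn n) := ⟨e, 0, he0⟩
      exact Measure.ae_ne volume 0
    filter_upwards [hne] with ξ hξ
    simp_rw [hsum, hB]
    refine (tendsto_const_nhds.mul ((Complex.continuous_ofReal.tendsto _).comp ?_)).mul_const _
    simpa using ((tendsto_cutoff_low hξ).const_sub (cutoff n ξ)).mul_const (coneCutoff e ξ)
  · simpa only [mul_assoc] using hfb.const_mul (2 * Ca)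

end RoughFIO

/-! ### Assembling the L² bound. -/

namespace RoughFIO

open Filter Topology
open scoped ENNReal

variable {n : ℕ}

theorem integrable_bracket_rpow_mul_norm (m : ℝ) (f : 𝓢(Rn n, ℂ)) :
    Integrable fun ξ => bracket ξ ^ m * ‖f ξ‖ := by
  set k := ⌈|m|⌉₊ with hk
  have h1 : Integrable fun ξ => 2 ^ (k - 1) * (‖f ξ‖ + ‖ξ‖ ^ k * ‖f ξ‖) :=
    (f.integrable.norm.add (f.integrable_pow_mul volume k)).const_mul _
  have hc : Continuous fun ξ : Rn n => bracket ξ ^ m * ‖f ξ‖ :=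
    (continuous_bracket.rpow_const fun ξ => Or.inl (bracket_pos ξ).ne').mul f.continuous.norm
  refine h1.mono' hc.aestronglyMeasurable (ae_of_all _ fun ξ => ?_)
  have hb := bracket_pos ξ
  rw [Real.norm_of_nonneg (by positivity)]
  have h2 : bracket ξ ^ m ≤ 2 ^ (k - 1) * (1 + ‖ξ‖ ^ k) :=
    calc bracket ξ ^ m ≤ bracket ξ ^ (k : ℝ) :=
          Real.rpow_le_rpow_of_exponent_le (one_le_bracket ξ)
            ((le_abs_self m).trans (Nat.le_ceil _))
      _ = bracket ξ ^ k := Real.rpow_natCast _ _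
      _ ≤ (1 + ‖ξ‖) ^ k := pow_le_pow_left₀ hb.le (bracket_le_one_add_norm ξ) k
      _ ≤ 2 ^ (k - 1) * (1 ^ k + ‖ξ‖ ^ k) := add_pow_le zero_le_one (norm_nonneg ξ) k
      _ = _ := by rw [one_pow]
  calc _ ≤ (2 ^ (k - 1) * (1 + ‖ξ‖ ^ k)) * ‖f ξ‖ := by gcongr
    _ = _ := by ring

theorem integrable_oscInt_integrand {b : Rn n → Rn n → ℂ} {φ : Rn n → Rn n → ℝ} {f : Rn n → ℂ}
    {C m : ℝ} (hb : ∀ x ξ, ‖b x ξ‖ ≤ C * bracket ξ ^ m)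
    (hbm : StronglyMeasurable (Function.uncurry b)) (hφm : Measurable (Function.uncurry φ))
    (hf : StronglyMeasurable f) (hfb : Integrable fun ξ => bracket ξ ^ m * ‖f ξ‖) (x : Rn n) :
    Integrable fun ξ => b x ξ * Complex.exp (Complex.I * (φ x ξ : ℝ)) * f ξ := by
  refine (hfb.const_mul C).mono' ((((hbm.mul (stronglyMeasurable_cexp_phase hφm)).comp_measurable
    measurable_prodMk_left).mul hf).aestronglyMeasurable) (ae_of_all _ fun ξ => ?_)
  rw [norm_mul, norm_mul, mul_comm Complex.I, Complex.norm_exp_ofReal_mul_I, mul_one, ← mul_assoc]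
  exact mul_le_mul_of_nonneg_right (hb x ξ) (norm_nonneg _)

/-- The splitting e^{iφ} = e^{iL} + e^{iL}(e^{iθ} - 1), where L is the linearisation at e and θ = φ
- L. -/
theorem low_frequency_cone_bound {m ρ : ℝ} {a : Rn n → Rn n → ℂ}
    (ha : RegularAmplitude m ρ a) {φ : Rn n → Rn n → ℝ} (hφ : MemPhase 2 φ)
    (hnd : StronglyNondegenerate φ) (hφm : Measurable (Function.uncurry φ)) {e : Rn n}
    (he : ‖e‖ = 1) : ∃ C, 0 ≤ C ∧ ∀ f : Rn n → ℂ, StronglyMeasurable f → Integrable f →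
      Integrable (fun ξ => bracket ξ ^ m * ‖f ξ‖) →
      StronglyMeasurable (oscInt (fun x ξ => a x ξ * (cutoff n ξ * coneCutoff e ξ : ℝ)) φ f) ∧
      eLpNorm (oscInt (fun x ξ => a x ξ * (cutoff n ξ * coneCutoff e ξ : ℝ)) φ f) 2 volume ≤
        ENNReal.ofReal C * eLpNorm f 2 volume := by
  have he0 : e ≠ 0 := norm_ne_zero_iff.1 (by rw [he]; exact one_ne_zero)
  obtain ⟨Ca, hCa, hab⟩ := ha.norm_le
  obtain ⟨C₁, hC₁, h₁⟩ := low_frequency_linear_bound ha hφ hnd he0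
  obtain ⟨C₂, hC₂, h₂⟩ := low_frequency_remainder_bound ha hφ hnd hφm he
  refine ⟨C₁ + C₂, add_nonneg hC₁ hC₂, fun f hfm hfi hfb => ?_⟩
  have hLm := hφ.measurable_linearPhase he0
  have hgm : Measurable fun ξ : Rn n => (coneCutoff e ξ : ℂ) :=
    Complex.measurable_ofReal.comp (measurable_coneCutoff e)
  have hg1 : ∀ ξ, ‖(coneCutoff e ξ : ℂ)‖ ≤ 1 := fun ξ => by
    rw [Complex.norm_real, Real.norm_of_nonneg (coneCutoff_nonneg e ξ)]
    exact coneCutoff_le_one e ξ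
  have hχ1 : ∀ ξ, ‖(cutoff n ξ : ℂ)‖ ≤ 1 := fun ξ => by
    rw [Complex.norm_real, Real.norm_of_nonneg (cutoff_nonneg ξ)]
    exact cutoff_le_one ξ
  -- The conic cutoff is not smooth at 0, so in the main term it cannot belong to the amplitude. It
  -- is independent of x and bounded by 1, hence it may be absorbed into f.
  set f' : Rn n → ℂ := fun ξ => coneCutoff e ξ * f ξ with hf'
  have hf'm : StronglyMeasurable f' := hgm.stronglyMeasurable.mul hfm
  have hf'le : ∀ ξ, ‖f' ξ‖ ≤ ‖f ξ‖ := fun ξ => by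
    rw [hf', norm_mul]
    exact mul_le_of_le_one_left (norm_nonneg _) (hg1 ξ)
  have hf'i : Integrable f' := hfi.mono hf'm.aestronglyMeasurable (ae_of_all _ hf'le)
  have hbrm : Measurable fun ξ : Rn n => bracket ξ ^ m :=
    continuous_bracket.measurable.pow_const m
  have hf'b : Integrable fun ξ => bracket ξ ^ m * ‖f' ξ‖ := by
    refine hfb.mono (hbrm.stronglyMeasurable.mul hf'm.norm).aestronglyMeasurable
      (ae_of_all _ fun ξ => ?_)
    have hbp := bracket_pos ξ
    rw [Real.norm_of_nonneg (by positivity), Real.norm_of_nonneg (by positivity)]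
    exact mul_le_mul_of_nonneg_left (hf'le ξ) (by positivity)
  set B : Rn n → Rn n → ℂ := fun x ξ => a x ξ * (cutoff n ξ * coneCutoff e ξ : ℝ) *
    (Complex.exp (Complex.I * (φ x ξ - linearPhase φ e x ξ : ℝ)) - 1) with hB
  obtain ⟨hm₁, hb₁⟩ := h₁ f' hf'm hf'i
  obtain ⟨hm₂, hb₂⟩ := h₂ f hfm hfi hfb B fun _ _ => rfl
  have hχm : StronglyMeasurable (Function.uncurry fun (_ ξ : Rn n) => (cutoff n ξ : ℂ)) :=
    ((Complex.continuous_ofReal.comp (contDiff_cutoff.continuous.comp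
      (continuous_snd (X := Rn n)))).stronglyMeasurable)
  have hint₁ : ∀ x, Integrable fun ξ => a x ξ * (cutoff n ξ : ℂ) *
      Complex.exp (Complex.I * (linearPhase φ e x ξ : ℝ)) * f' ξ := by
    refine integrable_oscInt_integrand (b := fun x ξ => a x ξ * (cutoff n ξ : ℂ)) (C := Ca)
      (fun x ξ => ?_) (ha.measurable.mul hχm) hLm hf'm hf'b
    rw [norm_mul]
    exact (mul_le_of_le_one_right (norm_nonneg _) (hχ1 ξ)).trans (hab x ξ)
  have hint₂ : ∀ x, Integrable fun ξ => B x ξ *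
      Complex.exp (Complex.I * (linearPhase φ e x ξ : ℝ)) * f ξ := by
    refine integrable_oscInt_integrand (b := B) (C := Ca * 2) (fun x ξ => ?_) ?_ hLm hfm hfb
    · have h5 : ‖Complex.exp (Complex.I * (φ x ξ - linearPhase φ e x ξ : ℝ)) - 1‖ ≤ 2 := by
        refine (norm_sub_le _ _).trans ?_
        rw [mul_comm, Complex.norm_exp_ofReal_mul_I, norm_one]
        norm_num
      simp only [hB, Complex.ofReal_mul]
      rw [norm_mul, norm_mul, norm_mul]
      have h6 : ‖(cutoff n ξ : ℂ)‖ * ‖(coneCutoff e ξ : ℂ)‖ ≤ 1 :=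
        mul_le_one₀ (hχ1 ξ) (norm_nonneg _) (hg1 ξ)
      calc _ ≤ (Ca * bracket ξ ^ m) * 1 * 2 := by
            have := (bracket_pos ξ).le
            gcongr
            exact hab x ξ
        _ = _ := by ring
    · refine (ha.measurable.mul ?_).mul ((stronglyMeasurable_cexp_phase
        (φ := fun x ξ => φ x ξ - linearPhase φ e x ξ) (hφm.sub hLm)).sub
        stronglyMeasurable_const)
      have : Measurable fun p : Rn n × Rn n => ((cutoff n p.2 * coneCutoff e p.2 : ℝ) : ℂ) :=
        Complex.measurable_ofReal.comp ((contDiff_cutoff.continuous.measurable.mul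
          (measurable_coneCutoff e)).comp measurable_snd)
      exact this.stronglyMeasurable
  have hsplit : oscInt (fun x ξ => a x ξ * (cutoff n ξ * coneCutoff e ξ : ℝ)) φ f =
      oscInt (fun x ξ => a x ξ * (cutoff n ξ : ℂ)) (linearPhase φ e) f' +
        oscInt B (linearPhase φ e) f := by
    ext x
    rw [Pi.add_apply, oscInt, oscInt, oscInt, ← integral_add]
    · refine integral_congr_ae (ae_of_all _ fun ξ => ?_)
      have hexp : Complex.exp (Complex.I * (φ x ξ : ℝ)) =
          Complex.exp (Complex.I * (φ x ξ - linearPhase φ e x ξ : ℝ)) *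
            Complex.exp (Complex.I * (linearPhase φ e x ξ : ℝ)) := by
        rw [← Complex.exp_add]
        congr 1
        push_cast
        ring
      simp only [hB, hf', hexp, Complex.ofReal_mul]
      ring
    · exact hint₁ x
    · exact hint₂ x
  rw [hsplit]
  refine ⟨hm₁.add hm₂, (eLpNorm_add_le hm₁.aestronglyMeasurable hm₂.aestronglyMeasurable
    (by norm_num)).trans ?_⟩
  rw [ENNReal.ofReal_add hC₁ hC₂, add_mul]
  refine add_le_add (hb₁.trans ?_) hb₂
  gcongr
  exact eLpNorm_mono hf'le

/-- The partition 1 = (1-χ) + χ κ_e + χ κ_{-e}, with χ the cutoff and κ the conic cutoffs, where e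
is any unit vector. -/
theorem RegularAmplitude.eLpNorm_oscInt_le {m ρ : ℝ} (hn : 1 ≤ n) (hρ₁ : ρ ≤ 1)
    (hm : m < (n : ℝ) / 2 * (ρ - 1)) {a : Rn n → Rn n → ℂ} (ha : RegularAmplitude m ρ a)
    {φ : Rn n → Rn n → ℝ} (hφ : MemPhase 2 φ) (hnd : StronglyNondegenerate φ)
    (hφm : Measurable (Function.uncurry φ)) :
    ∃ C, 0 ≤ C ∧ ∀ f : Rn n → ℂ, StronglyMeasurable f → Integrable f →
      Integrable (fun ξ => bracket ξ ^ m * ‖f ξ‖) →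
      StronglyMeasurable (oscInt a φ f) ∧
      eLpNorm (oscInt a φ f) 2 volume ≤ ENNReal.ofReal C * eLpNorm f 2 volume := by
  set e : Rn n := EuclideanSpace.single ⟨0, hn⟩ 1 with he
  have he1 : ‖e‖ = 1 := by simp [he]
  obtain ⟨Ca, hCa, hab⟩ := ha.norm_le
  obtain ⟨C₀, hC₀, h₀⟩ := high_frequency_bound hρ₁ hm ha hφ hnd hφm
  obtain ⟨C₁, hC₁, h₁⟩ := low_frequency_cone_bound ha hφ hnd hφm he1
  obtain ⟨C₂, hC₂, h₂⟩ := low_frequency_cone_bound ha hφ hnd hφm (e := -e) (by rwa [norm_neg])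
  refine ⟨C₀ + (C₁ + C₂), by positivity, fun f hfm hfi hfb => ?_⟩
  obtain ⟨hm₀, hb₀⟩ := h₀ f hfm hfi hfb
  obtain ⟨hm₁, hb₁⟩ := h₁ f hfm hfi hfb
  obtain ⟨hm₂, hb₂⟩ := h₂ f hfm hfi hfb
  have hint : ∀ g : Rn n → ℝ, Measurable g → (∀ ξ, ‖g ξ‖ ≤ 1) → ∀ x, Integrable fun ξ =>
      a x ξ * (g ξ : ℂ) * Complex.exp (Complex.I * (φ x ξ : ℝ)) * f ξ := fun g hg hg1 x => by
    refine integrable_oscInt_integrand (b := fun x ξ => a x ξ * (g ξ : ℂ)) (C := Ca)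
      (fun x ξ => ?_) (ha.measurable.mul ?_) hφm hfm hfb x
    · rw [norm_mul, Complex.norm_real]
      exact (mul_le_of_le_one_right (norm_nonneg _) (hg1 ξ)).trans (hab x ξ)
    · exact (Complex.measurable_ofReal.comp (hg.comp measurable_snd)).stronglyMeasurable
  have hcm : Measurable (cutoff n) := contDiff_cutoff.continuous.measurable
  have hlow : ∀ e' : Rn n, ∀ x, Integrable fun ξ => a x ξ * ((cutoff n ξ * coneCutoff e' ξ : ℝ) : ℂ)
      * Complex.exp (Complex.I * (φ x ξ : ℝ)) * f ξ := fun e' =>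
    hint (fun ξ => cutoff n ξ * coneCutoff e' ξ) (hcm.mul (measurable_coneCutoff e')) fun ξ => by
      rw [norm_mul, Real.norm_of_nonneg (cutoff_nonneg ξ),
        Real.norm_of_nonneg (coneCutoff_nonneg e' ξ)]
      exact mul_le_one₀ (cutoff_le_one ξ) (coneCutoff_nonneg e' ξ) (coneCutoff_le_one e' ξ)
  have hsplit : oscInt a φ f = oscInt (fun x ξ => a x ξ * ((1 - cutoff n ξ : ℝ) : ℂ)) φ f +
      (oscInt (fun x ξ => a x ξ * (cutoff n ξ * coneCutoff e ξ : ℝ)) φ f +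
        oscInt (fun x ξ => a x ξ * (cutoff n ξ * coneCutoff (-e) ξ : ℝ)) φ f) := by
    ext x
    rw [Pi.add_apply, Pi.add_apply, oscInt, oscInt, oscInt, oscInt,
      ← integral_add (hlow e x) (hlow (-e) x), ← integral_add]
    · refine integral_congr_ae (ae_of_all _ fun ξ => ?_)
      have h : ((coneCutoff e ξ : ℝ) : ℂ) + ((coneCutoff (-e) ξ : ℝ) : ℂ) = 1 := by
        rw [← Complex.ofReal_add, coneCutoff_add_neg, Complex.ofReal_one]
      have h' : ((coneCutoff e ξ : ℝ) : ℂ) = 1 - ((coneCutoff (-e) ξ : ℝ) : ℂ) := by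
        rw [← h]; ring
      simp only [Complex.ofReal_mul, Complex.ofReal_sub, Complex.ofReal_one, h']
      ring
    · refine hint (fun ξ => 1 - cutoff n ξ) (measurable_const.sub hcm) (fun ξ => ?_) x
      rw [Real.norm_eq_abs, abs_le]
      constructor <;> linarith [cutoff_nonneg ξ, cutoff_le_one ξ]
    · exact (hlow e x).add (hlow (-e) x)
  rw [hsplit]
  refine ⟨hm₀.add (hm₁.add hm₂), (eLpNorm_add_le hm₀.aestronglyMeasurable
    (hm₁.add hm₂).aestronglyMeasurable (by norm_num)).trans ?_⟩
  rw [ENNReal.ofReal_add hC₀ (by positivity), ENNReal.ofReal_add hC₁ hC₂, add_mul, add_mul]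
  exact add_le_add hb₀ ((eLpNorm_add_le hm₁.aestronglyMeasurable hm₂.aestronglyMeasurable
    (by norm_num)).trans (add_le_add hb₁ hb₂))

/-- Fourier integral operators with rough amplitudes of order `m < n(ρ - 1)/2` and strongly
non-degenerate phases are bounded on `L²`. -/
theorem boundedOnL2_fio {m ρ : ℝ} (hn : 1 ≤ n) (hρ₁ : ρ ≤ 1)
    (hm : m < (n : ℝ) / 2 * (ρ - 1)) {a : Rn n → Rn n → ℂ} (ha : MemRoughAmplitude m ρ a)
    {φ : Rn n → Rn n → ℝ} (hφ : MemPhase 2 φ) (hnd : StronglyNondegenerate φ) :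
    BoundedOnL2 (fio a φ) := by
  obtain ⟨a', hs, hm', hb, hae⟩ := ha.exists_regular
  obtain ⟨φ', hφ', hnd', hφm, hφeq⟩ := hφ.exists_measurable hnd
  have ha' : RegularAmplitude m ρ a' := ⟨hs, hm', hb⟩
  obtain ⟨Ca, -, hab⟩ := ha'.norm_le
  obtain ⟨C, hC, h⟩ := ha'.eLpNorm_oscInt_le hn hρ₁ hm hφ' hnd' hφm
  set c : ℂ := ((2 * Real.pi : ℝ) ^ n : ℂ)⁻¹ with hc
  have hfm : ∀ u : 𝓢(Rn n, ℂ), StronglyMeasurable (u : Rn n → ℂ) := fun u =>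
    u.continuous.stronglyMeasurable
  have hbd : ∀ u : 𝓢(Rn n, ℂ), StronglyMeasurable (oscInt a' φ' (hatCLM n u)) ∧
      eLpNorm (oscInt a' φ' (hatCLM n u)) 2 volume ≤
        ENNReal.ofReal C * eLpNorm (hatCLM n u) 2 volume := fun u =>
    h _ (hfm _) (hatCLM n u).integrable (integrable_bracket_rpow_mul_norm m _)
  have hint : ∀ (u : 𝓢(Rn n, ℂ)) x, Integrable fun ξ =>
      a' x ξ * Complex.exp (Complex.I * (φ' x ξ : ℝ)) * hatCLM n u ξ := fun u =>
    integrable_oscInt_integrand hab ha'.measurable hφm (hfm _)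
      (integrable_bracket_rpow_mul_norm m _)
  have hne : ∀ᵐ ξ : Rn n, ξ ≠ 0 := by
    have : Nontrivial (Rn n) := ⟨EuclideanSpace.single ⟨0, hn⟩ 1, 0, by simp⟩
    exact Measure.ae_ne volume 0
  -- The operator with the regular amplitude and the measurable phase has absolutely convergent
  -- integrals for every x, hence is linear pointwise; it differs from the original one only on a
  -- null set of x.
  refine boundedOnL2_of_eLpNorm_le (T' := fun u => c • oscInt a' φ' (hatCLM n u))
    (fun u => ?_) (fun u v => ?_) (fun z u => ?_)
    (fun u => ((hbd u).1.const_smul c).aestronglyMeasurable)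
    (C := ‖c‖ * (C * √((2 * Real.pi) ^ n))) fun u => ?_
  · filter_upwards [hae] with x hx
    rw [Pi.smul_apply, smul_eq_mul, fio, oscInt, ← hat_eq_hatCLM, hx]
    congr 1
    refine integral_congr_ae ?_
    filter_upwards [hne] with ξ hξ
    rw [hφeq x ξ hξ]
  · ext x
    simp only [Pi.smul_apply, Pi.add_apply, ← smul_add]
    congr 1
    rw [oscInt, oscInt, oscInt, ← integral_add (hint u x) (hint v x)]
    refine integral_congr_ae (ae_of_all _ fun ξ => ?_)
    simp only [map_add, _root_.add_apply]
    ring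
  · ext x
    simp only [Pi.smul_apply]
    rw [smul_comm]
    congr 1
    rw [oscInt, oscInt, smul_eq_mul, ← integral_const_mul]
    refine integral_congr_ae (ae_of_all _ fun ξ => ?_)
    simp only [map_smul, _root_.smul_apply, smul_eq_mul]
    ring
  · have h1 : eLpNorm (hatCLM n u) 2 volume ≤
        ENNReal.ofReal (√((2 * Real.pi) ^ n)) * eLpNorm u 2 volume := by
      refine eLpNorm_two_le_of_sq (Real.sqrt_nonneg _) (le_of_eq ?_)
      rw [Real.sq_sqrt (by positivity), ← eLpNorm_two_sq, ← eLpNorm_two_sq, ← hat_eq_hatCLM]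
      exact eLpNorm_hat_sq u
    rw [eLpNorm_const_smul, ENNReal.ofReal_mul (norm_nonneg _), ofReal_norm,
      ENNReal.ofReal_mul hC, mul_assoc, mul_assoc]
    gcongr
    exact (hbd u).2.trans (by gcongr)

end RoughFIO

namespace RoughFIO

open Filter Topology
open scoped ENNReal

variable {n : ℕ}

/-! ### Sharpness: the phase ⟨x,ξ⟩ is admissible. -/

section LinearPhase

theorem iteratedFDeriv_clm_of_two_le {E F : Type*} [NormedAddCommGroup E] [NormedSpace ℝ E]
    [NormedAddCommGroup F] [NormedSpace ℝ F] (L : E →L[ℝ] F) {k : ℕ} (hk : 2 ≤ k) (ξ : E) :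
    iteratedFDeriv ℝ k L ξ = 0 := by
  obtain ⟨j, rfl⟩ := Nat.exists_eq_add_of_le hk
  rw [← norm_eq_zero, show 2 + j = (j + 1) + 1 by ring, ← norm_iteratedFDeriv_fderiv]
  have : fderiv ℝ (L : E → F) = fun _ => L := funext fun x => L.fderiv
  rw [this, iteratedFDeriv_const_of_ne (Nat.succ_ne_zero j), Pi.zero_apply, norm_zero]

/-- Bilinearity leaves a single nonzero derivative of total order at least 2, namely one in x and
one in ξ; it is constant, matching |ξ|⁰. -/
theorem memPhase_inner : MemPhase 2 (fun x ξ : Rn n => inner ℝ x ξ) := by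
  refine ⟨contDiff_inner.contDiffOn, fun x ξ _ t _ => inner_smul_right x ξ t, fun k l hkl => ?_⟩
  have hfun : ∀ η : Rn n, (fun y : Rn n => inner ℝ y η) = innerSL ℝ η := fun η => by
    ext y
    exact real_inner_comm _ _
  simp_rw [hfun]
  rcases lt_or_ge l 2 with hl | hl
  · interval_cases l
    · refine ⟨0, fun x ξ _ => ?_⟩
      have hL : (fun η : Rn n => iteratedFDeriv ℝ 0 (innerSL ℝ η) x) =
          ((continuousMultilinearCurryFin0 ℝ (Rn n) ℝ).symm.toContinuousLinearEquiv :
            ℝ →L[ℝ] (Rn n [×0]→L[ℝ] ℝ)) ∘L innerSL ℝ x := by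
        ext η v
        exact real_inner_comm x η
      rw [hL, iteratedFDeriv_clm_of_two_le _ (by simpa using hkl), norm_zero, zero_mul]
    · set L := ((continuousMultilinearCurryFin1 ℝ (Rn n) ℝ).symm.toContinuousLinearEquiv :
            (Rn n →L[ℝ] ℝ) →L[ℝ] (Rn n [×1]→L[ℝ] ℝ)) ∘L innerSL ℝ with hLdef
      have hL : ∀ x : Rn n, (fun η : Rn n => iteratedFDeriv ℝ 1 (innerSL ℝ η) x) = L := by
        intro x
        ext η v
        rw [iteratedFDeriv_one_apply, ContinuousLinearMap.fderiv]
        rfl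
      refine ⟨‖L‖, fun x ξ hξ => ?_⟩
      rw [hL]
      rcases (show 1 ≤ k by omega).eq_or_lt with rfl | hk
      · rw [norm_iteratedFDeriv_one, ContinuousLinearMap.fderiv]
        simp
      · rw [iteratedFDeriv_clm_of_two_le _ hk, norm_zero]
        positivity
  · simp_rw [iteratedFDeriv_clm_of_two_le _ hl]
    refine ⟨0, fun x ξ _ => ?_⟩
    rw [show (fun _ : Rn n => (0 : Rn n [×l]→L[ℝ] ℝ)) = 0 from rfl]
    simp

theorem stronglyNondegenerate_inner : StronglyNondegenerate (fun x ξ : Rn n => inner ℝ x ξ) := by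
  refine ⟨1, one_pos, fun x ξ _ => ?_⟩
  have h : mixedHessian (fun x ξ : Rn n => inner ℝ x ξ) x ξ = 1 := by
    ext j k
    have h1 : ∀ y : Rn n, fderiv ℝ (fun η : Rn n => inner ℝ y η) ξ (EuclideanSpace.single k 1) =
        innerSL ℝ (EuclideanSpace.single k (1 : ℝ)) y := fun y => by
      exact (congrArg (fun T : Rn n →L[ℝ] ℝ => T (EuclideanSpace.single k 1))
        (innerSL ℝ y).fderiv).trans (real_inner_comm (EuclideanSpace.single k (1 : ℝ)) y)
    simp only [mixedHessian, Matrix.of_apply, h1, ContinuousLinearMap.fderiv]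
    rw [Matrix.one_apply, innerSL_apply_apply]
    simp [EuclideanSpace.inner_single_left, eq_comm]
  rw [h, Matrix.det_one, abs_one]

end LinearPhase

/-! ### Sharpness: amplitudes made of modulated bumps. -/

section Lattice

variable {I : Type*} {z : I → Rn n} {r w : I → ℝ}

/-- The `i`-th wave packet of `packetAmplitude`. -/
def packet (z : I → Rn n) (r w : I → ℝ) (i : I) (x ξ : Rn n) : ℂ :=
  (w i * Complex.exp (-Complex.I * (inner ℝ x (z i) : ℝ))) *
    (cutoff n ((16 / r i) • (ξ - z i)) : ℂ)

/-- An amplitude consisting of bumps of radius comparable to `r i` around the points `z i`, of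
height `w i`, each modulated by the character of frequency `-z i`. -/
def packetAmplitude (z : I → Rn n) (r w : I → ℝ) (x ξ : Rn n) : ℂ := ∑' i, packet z r w i x ξ

theorem packet_eq_zero (hr : ∀ i, 1 ≤ r i) {i : I} {ξ : Rn n} (h : r i / 8 ≤ ‖ξ - z i‖) (x : Rn n) :
    packet z r w i x ξ = 0 := by
  have hri : 0 < r i := one_pos.trans_le (hr i)
  rw [packet, cutoff_eq_zero, Complex.ofReal_zero, mul_zero]
  rw [norm_smul, Real.norm_of_nonneg (by positivity), div_mul_eq_mul_div, le_div_iff₀ hri]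
  linarith

/-- Were two supports, of radii r_i/8 and r_j/8, to meet one ball of radius 1/16, the centres would
be at distance less than r_i/8 + r_j/8 + 1/8. This contradicts separation by r_i/2 and r_j/2, given
r ≥ 1. Locally the series is thus one packet, for all x at once. -/
theorem exists_forall_ne_packet_far [Nonempty I] (hr : ∀ i, 1 ≤ r i)
    (hsep : ∀ i j, i ≠ j → r i / 2 ≤ ‖z i - z j‖) (ξ : Rn n) :
    ∃ i₀, ∀ i, i ≠ i₀ → ∀ η ∈ Metric.ball ξ (1 / 16), r i / 8 ≤ ‖η - z i‖ := by
  by_cases h : ∃ i, ∃ η ∈ Metric.ball ξ (1 / 16), ‖η - z i‖ < r i / 8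
  · obtain ⟨i₀, η₀, hη₀, hlt⟩ := h
    refine ⟨i₀, fun i hi η hη => ?_⟩
    by_contra! hcon
    have h1 := hsep i i₀ hi
    have h2 := hsep i₀ i hi.symm
    have h3 : ‖z i - z i₀‖ ≤ ‖η - z i‖ + ‖η - ξ‖ + ‖η₀ - ξ‖ + ‖η₀ - z i₀‖ := by
      have e : z i - z i₀ = -(η - z i) + (η - ξ) - (η₀ - ξ) + (η₀ - z i₀) := by abel
      rw [e]
      refine (norm_add_le _ _).trans (add_le_add_left ?_ _)
      refine (norm_sub_le _ _).trans (add_le_add_left ?_ _)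
      refine (norm_add_le _ _).trans (add_le_add_left ?_ _)
      rw [norm_neg]
    rw [norm_sub_rev (z i₀)] at h2
    rw [mem_ball_iff_norm] at hη hη₀
    linarith [hr i, hr i₀]
  · push Not at h
    exact ⟨Classical.arbitrary I, fun i _ η hη => h i η hη⟩

theorem exists_packetAmplitude_eq [Nonempty I] (hr : ∀ i, 1 ≤ r i)
    (hsep : ∀ i j, i ≠ j → r i / 2 ≤ ‖z i - z j‖) (ξ : Rn n) :
    ∃ i₀, ∀ x, ∀ η ∈ Metric.ball ξ (1 / 16), packetAmplitude z r w x η = packet z r w i₀ x η := by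
  obtain ⟨i₀, h⟩ := exists_forall_ne_packet_far hr hsep ξ
  exact ⟨i₀, fun x η hη => tsum_eq_single i₀ fun i hi => packet_eq_zero hr (h i hi η hη) x⟩

theorem eq_of_norm_sub_lt (hsep : ∀ i j, i ≠ j → r i / 2 ≤ ‖z i - z j‖) {i j : I} {ξ : Rn n}
    (hi : ‖ξ - z i‖ < r i / 8) (hj : ‖ξ - z j‖ < r j / 8) : i = j := by
  by_contra hij
  have h1 := hsep i j hij
  have h2 := hsep j i (Ne.symm hij)
  have h3 : ‖z i - z j‖ ≤ ‖ξ - z i‖ + ‖ξ - z j‖ := by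
    rw [← norm_sub_rev (z i) ξ]
    exact (norm_sub_le_norm_sub_add_norm_sub (z i) ξ (z j))
  rw [norm_sub_rev (z j)] at h2
  have h4 := norm_nonneg (ξ - z i)
  have h5 := norm_nonneg (ξ - z j)
  linarith

theorem packetAmplitude_eq_of_norm_sub_le (hr : ∀ i, 1 ≤ r i)
    (hsep : ∀ i j, i ≠ j → r i / 2 ≤ ‖z i - z j‖) {i : I} {ξ : Rn n} (h : ‖ξ - z i‖ ≤ 1 / 16)
    (x : Rn n) : packetAmplitude z r w x ξ =
      w i * Complex.exp (-Complex.I * (inner ℝ x (z i) : ℝ)) := by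
  have hri := hr i
  have h0 : 0 < r i := one_pos.trans_le hri
  rw [packetAmplitude, tsum_eq_single i, packet, cutoff_eq_one, Complex.ofReal_one, mul_one]
  · rw [norm_smul, Real.norm_of_nonneg (by positivity), div_mul_eq_mul_div, div_le_iff₀ h0]
    linarith
  · intro j hj
    refine packet_eq_zero hr (le_of_not_gt fun hcon => hj ?_) x
    exact eq_of_norm_sub_lt hsep hcon (by linarith)

theorem contDiff_packet (i : I) (x : Rn n) : ContDiff ℝ ∞ (packet z r w i x) :=
  contDiff_const.mul ((contDiff_ofReal_comp contDiff_cutoff).comp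
    ((contDiff_id.sub contDiff_const).const_smul (16 / r i)))

/-- The modulation is a function of x alone, so ξ-derivatives see only the dilated bump and cost 1/r
each. This is where the roughness in x is exploited. -/
theorem exists_norm_iteratedFDeriv_packet_le (hr : ∀ i, 1 ≤ r i) (k : ℕ) : ∃ C, 0 ≤ C ∧
    ∀ i x ξ, ‖iteratedFDeriv ℝ k (packet z r w i x) ξ‖ ≤ C * (|w i| * (r i ^ k)⁻¹) := by
  have h0 : ∀ i, 0 < r i := fun i => one_pos.trans_le (hr i)
  obtain ⟨C, hC, h⟩ := (SymFam.dilation (S := fun _ : I => (Set.univ : Set (Rn n)))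
    (t := fun i => 16 / r i) (k := k) (contDiff_ofReal_comp contDiff_cutoff)
    (hasCompactSupport_ofReal_comp (hasCompactSupport_cutoff (n := n)))
    (fun i => by have := h0 i; positivity)).bound
  refine ⟨C * 16 ^ k, by positivity, fun i x ξ => ?_⟩
  set G : Rn n → ℂ := fun η => (cutoff n ((16 / r i) • η) : ℂ) with hG
  have hGs : ContDiff ℝ ∞ G := (contDiff_ofReal_comp contDiff_cutoff).comp (contDiff_const_smul _)
  set c : ℂ := w i * Complex.exp (-Complex.I * (inner ℝ x (z i) : ℝ)) with hc
  have hcn : ‖c‖ = |w i| := by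
    rw [hc, norm_mul, Complex.norm_real, Real.norm_eq_abs, neg_mul, ← mul_neg, ← Complex.ofReal_neg,
      mul_comm Complex.I, Complex.norm_exp_ofReal_mul_I, mul_one]
  have e : packet z r w i x = fun ξ => c • G (ξ - z i) := rfl
  have hGs' : ContDiff ℝ ∞ fun ξ => G (ξ - z i) := hGs.comp (contDiff_id.sub contDiff_const)
  rw [e, iteratedFDeriv_const_smul_apply' (hGs'.of_le (by exact_mod_cast le_top)).contDiffAt,
    norm_smul, hcn, iteratedFDeriv_comp_sub]
  calc |w i| * ‖iteratedFDeriv ℝ k G (ξ - z i)‖ ≤ |w i| * (C * 1 * (16 / r i) ^ k) := by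
        gcongr
        exact h i _ (Set.mem_univ _) k le_rfl
    _ = _ := by rw [div_pow, div_eq_mul_inv]; ring

theorem memRoughAmplitude_packetAmplitude [Nonempty I] {m ρ : ℝ} (hr : ∀ i, 1 ≤ r i)
    (hsep : ∀ i j, i ≠ j → r i / 2 ≤ ‖z i - z j‖)
    (hw : ∀ k : ℕ, ∃ C, 0 ≤ C ∧ ∀ i ξ, ‖ξ - z i‖ ≤ r i / 8 →
      |w i| * (r i ^ k)⁻¹ ≤ C * bracket ξ ^ (m - ρ * k)) :
    MemRoughAmplitude m ρ (packetAmplitude z r w) := by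
  refine ⟨fun x => contDiff_iff_contDiffAt.2 fun ξ => ?_, fun ξ => ?_, fun k => ?_⟩
  · obtain ⟨i, hi⟩ := exists_packetAmplitude_eq (w := w) hr hsep ξ
    refine (contDiff_packet (z := z) (r := r) (w := w) i x).contDiffAt.congr_of_eventuallyEq ?_
    filter_upwards [Metric.ball_mem_nhds ξ (by norm_num : (0 : ℝ) < 1 / 16)] with η hη
    exact hi x η hη
  · obtain ⟨i, hi⟩ := exists_packetAmplitude_eq (w := w) hr hsep ξ
    have : (fun x => packetAmplitude z r w x ξ) = fun x => packet z r w i x ξ :=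
      funext fun x => hi x ξ (Metric.mem_ball_self (by norm_num))
    rw [this]
    have hc : Continuous fun x => packet z r w i x ξ := by
      unfold packet
      have : Continuous fun x : Rn n => ((inner ℝ x (z i) : ℝ) : ℂ) :=
        Complex.continuous_ofReal.comp (by fun_prop)
      fun_prop
    exact hc.aestronglyMeasurable
  · obtain ⟨C, hC, h⟩ := exists_norm_iteratedFDeriv_packet_le (z := z) (w := w) hr k
    obtain ⟨C', hC', h'⟩ := hw k
    refine ⟨C * C', fun ξ => ae_of_all _ fun x => ?_⟩
    obtain ⟨i, hi⟩ := exists_packetAmplitude_eq (w := w) hr hsep ξ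
    have hev : packetAmplitude z r w x =ᶠ[𝓝 ξ] packet z r w i x := by
      filter_upwards [Metric.ball_mem_nhds ξ (by norm_num : (0 : ℝ) < 1 / 16)] with η hη
      exact hi x η hη
    rw [(hev.iteratedFDeriv ℝ k).eq_of_nhds]
    by_cases hξ : ‖ξ - z i‖ ≤ r i / 8
    · refine (h i x ξ).trans ?_
      rw [mul_assoc]
      exact mul_le_mul_of_nonneg_left (h' i ξ hξ) hC
    · have hb := bracket_pos ξ
      have hz : iteratedFDeriv ℝ k (packet z r w i x) ξ = 0 := by
        by_contra hne
        refine hξ ?_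
        have h1 : tsupport (packet z r w i x) ⊆ Metric.closedBall (z i) (r i / 8) :=
          tsupport_subset_of_isClosed Metric.isClosed_closedBall fun η hη => by
            rw [mem_closedBall_iff_norm]
            exact le_of_not_ge fun hge => hη (packet_eq_zero hr hge x)
        exact mem_closedBall_iff_norm.1 (h1 (support_iteratedFDeriv_subset k hne))
      rw [hz, norm_zero]
      positivity

end Lattice

end RoughFIO

/-! ### Sharpness: test functions adapted to the packets. -/

namespace RoughFIO

open Filter Topology
open scoped ENNReal

variable {n : ℕ} {I : Type*} {z : I → Rn n} {r w : I → ℝ}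

/-- A fixed bump function supported in the ball of radius `1 / 16`. -/
def smallBump (n : ℕ) (ξ : Rn n) : ℂ := (cutoff n ((32 : ℝ) • ξ) : ℂ)

theorem contDiff_smallBump : ContDiff ℝ ∞ (smallBump n) :=
  (contDiff_ofReal_comp contDiff_cutoff).comp (contDiff_const_smul _)

theorem norm_le_of_smallBump_ne_zero {ξ : Rn n} (h : smallBump n ξ ≠ 0) : ‖ξ‖ ≤ 1 / 16 := by
  by_contra! hcon
  refine h ?_
  rw [smallBump, cutoff_eq_zero, Complex.ofReal_zero]
  rw [norm_smul, Real.norm_of_nonneg (by norm_num)]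
  linarith

theorem hasCompactSupport_smallBump : HasCompactSupport (smallBump n) :=
  HasCompactSupport.of_support_subset_isCompact (isCompact_closedBall (0 : Rn n) (1 / 16))
    fun ξ hξ => by simpa using norm_le_of_smallBump_ne_zero hξ

/-- `smallBump` as a Schwartz function. -/
def smallBumpS (n : ℕ) : 𝓢(Rn n, ℂ) := hasCompactSupport_smallBump.toSchwartzMap contDiff_smallBump

theorem integral_norm_sq_smallBump_pos : 0 < ∫ ξ : Rn n, ‖smallBumpS n ξ‖ ^ 2 := by
  have hc : Continuous fun ξ : Rn n => ‖smallBumpS n ξ‖ ^ 2 := (smallBumpS n).continuous.norm.pow 2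
  refine hc.integral_pos_of_hasCompactSupport_nonneg_nonzero ?_ (fun ξ => by positivity) (x := 0) ?_
  · exact hasCompactSupport_smallBump.comp_left (g := fun c : ℂ => ‖c‖ ^ 2) (by simp)
  · change ‖smallBump n 0‖ ^ 2 ≠ 0
    rw [smallBump, cutoff_eq_one (by simp)]
    simp

/-- A sum of translated bumps. -/
def packetSum (z : I → Rn n) (w : I → ℝ) (F : Finset I) (ξ : Rn n) : ℂ :=
  ∑ i ∈ F, w i * smallBump n (ξ - z i)

theorem contDiff_packetSum (F : Finset I) : ContDiff ℝ ∞ (packetSum z w F) :=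
  ContDiff.sum fun _ _ =>
    contDiff_const.mul (contDiff_smallBump.comp (contDiff_id.sub contDiff_const))

theorem hasCompactSupport_packetSum (F : Finset I) : HasCompactSupport (packetSum z w F) := by
  refine HasCompactSupport.of_support_subset_isCompact
    (F.isCompact_biUnion fun i _ => isCompact_closedBall (z i) (1 / 16)) fun ξ hξ => ?_
  obtain ⟨i, hi, hne⟩ := Finset.exists_ne_zero_of_sum_ne_zero hξ
  simp only [Set.mem_iUnion]
  exact ⟨i, hi, mem_closedBall_iff_norm.2 (norm_le_of_smallBump_ne_zero (right_ne_zero_of_mul hne))⟩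

/-- The bumps have radius 1/16 and disjoint supports, so there are no cross terms. -/
theorem norm_sq_packetSum (hr : ∀ i, 1 ≤ r i) (hsep : ∀ i j, i ≠ j → r i / 2 ≤ ‖z i - z j‖)
    (F : Finset I) (ξ : Rn n) :
    ‖packetSum z w F ξ‖ ^ 2 = ∑ i ∈ F, w i ^ 2 * ‖smallBump n (ξ - z i)‖ ^ 2 := by
  by_cases h : ∃ i ∈ F, smallBump n (ξ - z i) ≠ 0
  · obtain ⟨i, hi, hne⟩ := h
    have hz : ∀ j ∈ F, j ≠ i → smallBump n (ξ - z j) = 0 := fun j _ hj => by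
      by_contra hne'
      have h1 := norm_le_of_smallBump_ne_zero hne
      have h2 := norm_le_of_smallBump_ne_zero hne'
      exact hj (eq_of_norm_sub_lt (ξ := ξ) hsep (by linarith [hr j]) (by linarith [hr i]))
    rw [packetSum, Finset.sum_eq_single_of_mem i hi fun j hj hji => by rw [hz j hj hji, mul_zero],
      Finset.sum_eq_single_of_mem i hi fun j hj hji => by rw [hz j hj hji]; simp, norm_mul, mul_pow,
      Complex.norm_real, Real.norm_eq_abs, sq_abs]
  · push Not at h
    rw [packetSum, Finset.sum_eq_zero fun i hi => by rw [h i hi, mul_zero],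
      Finset.sum_eq_zero fun i hi => by rw [h i hi]; simp]
    simp

theorem integral_norm_sq_packetSum (hr : ∀ i, 1 ≤ r i)
    (hsep : ∀ i j, i ≠ j → r i / 2 ≤ ‖z i - z j‖) (F : Finset I) :
    ∫ ξ, ‖packetSum z w F ξ‖ ^ 2 = (∑ i ∈ F, w i ^ 2) * ∫ ξ, ‖smallBumpS n ξ‖ ^ 2 := by
  have hc : Continuous fun ξ : Rn n => ‖smallBump n ξ‖ ^ 2 :=
    contDiff_smallBump.continuous.norm.pow 2
  have hi : Integrable fun ξ : Rn n => ‖smallBump n ξ‖ ^ 2 :=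
    hc.integrable_of_hasCompactSupport
      (hasCompactSupport_smallBump.comp_left (g := fun c : ℂ => ‖c‖ ^ 2) (by simp))
  simp_rw [norm_sq_packetSum hr hsep]
  rw [integral_finsetSum _ fun i _ => (hi.comp_sub_right (z i)).const_mul _, Finset.sum_mul]
  refine Finset.sum_congr rfl fun i _ => ?_
  rw [integral_const_mul, integral_sub_right_eq_self (fun ξ => ‖smallBump n ξ‖ ^ 2)]
  rfl

/-- On the support of the i-th test bump the amplitude is exactly w_i e^{-i⟨x,z_i⟩}, which cancels
the phase produced by translating the bump to z_i. All packets give the same function of x and add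
up coherently. -/
theorem integral_packetAmplitude_mul_packetSum (hr : ∀ i, 1 ≤ r i)
    (hsep : ∀ i j, i ≠ j → r i / 2 ≤ ‖z i - z j‖) (F : Finset I) (x : Rn n) :
    ∫ ξ, packetAmplitude z r w x ξ * Complex.exp (Complex.I * (inner ℝ x ξ : ℝ)) *
      packetSum z w F ξ = ((∑ i ∈ F, w i ^ 2 : ℝ) : ℂ) * hat (smallBumpS n) (-x) := by
  set g : Rn n → ℂ := fun η => Complex.exp (Complex.I * (inner ℝ x η : ℝ)) * smallBump n η with hg
  have hgc : Continuous g := by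
    have h1 : Continuous fun η : Rn n => ((inner ℝ x η : ℝ) : ℂ) :=
      Complex.continuous_ofReal.comp (by fun_prop)
    exact (Complex.continuous_exp.comp (continuous_const.mul h1)).mul contDiff_smallBump.continuous
  have hgi : Integrable g :=
    hgc.integrable_of_hasCompactSupport hasCompactSupport_smallBump.mul_left
  have hpt : ∀ ξ, packetAmplitude z r w x ξ * Complex.exp (Complex.I * (inner ℝ x ξ : ℝ)) *
      packetSum z w F ξ = ∑ i ∈ F, ((w i ^ 2 : ℝ) : ℂ) * g (ξ - z i) := by
    intro ξ
    rw [packetSum, Finset.mul_sum]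
    refine Finset.sum_congr rfl fun i _ => ?_
    by_cases h : smallBump n (ξ - z i) = 0
    · simp [hg, h]
    · rw [packetAmplitude_eq_of_norm_sub_le hr hsep (norm_le_of_smallBump_ne_zero h)]
      have he : Complex.exp (Complex.I * (inner ℝ x (ξ - z i) : ℝ)) =
          Complex.exp (-Complex.I * (inner ℝ x (z i) : ℝ)) *
            Complex.exp (Complex.I * (inner ℝ x ξ : ℝ)) := by
        rw [← Complex.exp_add, inner_sub_right]
        congr 1
        push_cast
        ring
      simp only [hg, he]
      push_cast
      ring
  simp_rw [hpt]
  rw [integral_finsetSum _ fun i _ => (hgi.comp_sub_right (z i)).const_mul _, Complex.ofReal_sum,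
    Finset.sum_mul]
  refine Finset.sum_congr rfl fun i _ => ?_
  rw [integral_const_mul, integral_sub_right_eq_self g, hat]
  congr 1
  refine integral_congr_ae (ae_of_all _ fun η => ?_)
  simp only [hg, inner_neg_right, real_inner_comm x η]
  push_cast
  rw [neg_mul_neg]
  rfl

/-- The square-summability of the heights of the packets is necessary for boundedness. -/
theorem not_boundedOnL2_packetAmplitude (hr : ∀ i, 1 ≤ r i)
    (hsep : ∀ i j, i ≠ j → r i / 2 ≤ ‖z i - z j‖)
    (hw : ∀ B : ℝ, ∃ F : Finset I, B < ∑ i ∈ F, w i ^ 2) :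
    ¬ BoundedOnL2 (fio (packetAmplitude z r w) fun x ξ => inner ℝ x ξ) := by
  intro hb
  obtain ⟨C, hC, h⟩ := hb.exists_eLpNorm_le
  -- The test function gives ‖Tu‖² = W‖u‖² with u ≠ 0, so an operator bound C forces W ≤ C².
  obtain ⟨F, hF⟩ := hw (C ^ 2)
  set W := ∑ i ∈ F, w i ^ 2 with hW
  have hWpos : 0 < W := (sq_nonneg C).trans_lt hF
  obtain ⟨u, hu⟩ := exists_hat_eq
    ((hasCompactSupport_packetSum (z := z) (w := w) F).toSchwartzMap (contDiff_packetSum F))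
  have hhat : hat u = packetSum z w F := by rw [hat_eq_hatCLM, hu]; rfl
  set Q : ℝ := ∫ ξ, ‖smallBumpS n ξ‖ ^ 2 with hQ
  have hQpos : 0 < Q := integral_norm_sq_smallBump_pos
  set P : ℝ := (2 * Real.pi) ^ n with hP
  have hPpos : 0 < P := by positivity
  have hQu : P * ∫ x, ‖u x‖ ^ 2 = W * Q := by
    rw [← integral_norm_sq_hatCLM, ← integral_norm_sq_packetSum hr hsep F, ← hhat, hat_eq_hatCLM]
  obtain ⟨D, hD⟩ : ∃ D : ℝ, D = P⁻¹ * W := ⟨_, rfl⟩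
  have hT : fio (packetAmplitude z r w) (fun x ξ => inner ℝ x ξ) u =
      fun x => (D : ℂ) • hatCLM n (smallBumpS n) (-x) := by
    ext x
    rw [fio, hhat, integral_packetAmplitude_mul_packetSum hr hsep, hat_eq_hatCLM, ← hW, smul_eq_mul,
      ← mul_assoc, hD, hP]
    push_cast
    rfl
  have hTsq : eLpNorm (fio (packetAmplitude z r w) (fun x ξ => inner ℝ x ξ) u) 2 volume ^ 2 =
      ENNReal.ofReal (D ^ 2 * (P * Q)) := by
    rw [hT, eLpNorm_two_sq]
    simp_rw [enorm_smul, mul_pow]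
    rw [lintegral_const_mul' _ _ (by finiteness),
      lintegral_neg_eq_self (fun x => ‖hatCLM n (smallBumpS n) x‖ₑ ^ 2), lintegral_enorm_sq_eq,
      integral_norm_sq_hatCLM, ENNReal.ofReal_mul (sq_nonneg _), ← ofReal_norm, Complex.norm_real,
      Real.norm_eq_abs, ← ENNReal.ofReal_pow (abs_nonneg _), sq_abs]
  have hle := pow_le_pow_left' (h u) 2
  rw [hTsq, mul_pow, eLpNorm_two_sq, lintegral_enorm_sq_eq, ← ENNReal.ofReal_pow hC,
    ← ENNReal.ofReal_mul (sq_nonneg _), ENNReal.ofReal_le_ofReal_iff (by positivity)] at hle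
  have hu' : ∫ x, ‖u x‖ ^ 2 = P⁻¹ * (W * Q) := by rw [← hQu, inv_mul_cancel_left₀ hPpos.ne']
  rw [hu', hD] at hle
  have e1 : (P⁻¹ * W) ^ 2 * (P * Q) = W * (P⁻¹ * (W * Q)) := by
    field_simp
  rw [e1] at hle
  exact absurd (le_of_mul_le_mul_right hle (by positivity)) (not_le.2 hF)

end RoughFIO

/-! ### Sharpness: the lattice and the divergent sum. -/

namespace RoughFIO

open Filter Topology

/-- The spacing `2 ^ (jρ)` of the lattice points at frequency `2 ^ j`. -/
def spacing (ρ : ℝ) (j : ℕ) : ℝ := ((2 : ℝ) ^ j) ^ ρ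

/-- The number of lattice points in each direction at frequency `2 ^ j`. -/
def latticeSize (ρ : ℝ) (j : ℕ) : ℕ := ⌊((2 : ℝ) ^ j) ^ (1 - ρ)⌋₊

/-- The index set of all the lattice points. -/
abbrev LatticeIndex (n : ℕ) (ρ : ℝ) : Type := Σ j : ℕ, Fin n → Fin (latticeSize ρ j)

/-- Lattice points filling the cubes `[2 ^ j, 2 ^ (j + 1)]ⁿ` with spacing `2 ^ (jρ)`. -/
def latticePoint (n : ℕ) (ρ : ℝ) (p : LatticeIndex n ρ) : Rn n :=
  WithLp.toLp 2 fun i => (2 : ℝ) ^ p.1 + spacing ρ p.1 * (p.2 i : ℕ)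

variable {n : ℕ} {ρ : ℝ}

theorem one_le_spacing (hρ₀ : 0 ≤ ρ) (j : ℕ) : 1 ≤ spacing ρ j :=
  Real.one_le_rpow (one_le_pow₀ one_le_two) hρ₀

theorem spacing_le (hρ₁ : ρ ≤ 1) (j : ℕ) : spacing ρ j ≤ 2 ^ j := by
  have h := Real.rpow_le_rpow_of_exponent_le (one_le_pow₀ one_le_two (n := j) (M₀ := ℝ)) hρ₁
  rwa [Real.rpow_one] at h

theorem spacing_succ_le (hρ₁ : ρ ≤ 1) (j : ℕ) : spacing ρ (j + 1) ≤ 2 * spacing ρ j := by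
  rw [spacing, pow_succ, Real.mul_rpow (by positivity) two_pos.le, mul_comm, ← spacing]
  have h := Real.rpow_le_rpow_of_exponent_le one_le_two hρ₁
  rw [Real.rpow_one] at h
  have : 0 ≤ spacing ρ j := Real.rpow_nonneg (by positivity) _
  gcongr

theorem spacing_mul_latticeSize_le (j : ℕ) : spacing ρ j * latticeSize ρ j ≤ 2 ^ j := by
  have h1 : (latticeSize ρ j : ℝ) ≤ ((2 : ℝ) ^ j) ^ (1 - ρ) := Nat.floor_le (by positivity)
  have h2 : 0 ≤ spacing ρ j := Real.rpow_nonneg (by positivity) _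
  calc spacing ρ j * latticeSize ρ j ≤ ((2 : ℝ) ^ j) ^ ρ * ((2 : ℝ) ^ j) ^ (1 - ρ) :=
        mul_le_mul_of_nonneg_left h1 h2
    _ = 2 ^ j := by
      rw [← Real.rpow_add (by positivity), add_sub_cancel, Real.rpow_one]

theorem le_latticePoint_apply (hρ₀ : 0 ≤ ρ) (p : LatticeIndex n ρ) (i : Fin n) :
    (2 : ℝ) ^ p.1 ≤ latticePoint n ρ p i := by
  have := one_le_spacing hρ₀ p.1
  change _ ≤ (2 : ℝ) ^ p.1 + spacing ρ p.1 * (p.2 i : ℕ)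
  have : 0 ≤ spacing ρ p.1 * (p.2 i : ℕ) := by positivity
  linarith

/-- Indices stop at one less than the lattice size, so the last point stays a full spacing below
2^{j+1}; this gap separates consecutive shells. -/
theorem latticePoint_apply_le (hρ₀ : 0 ≤ ρ) (p : LatticeIndex n ρ) (i : Fin n) :
    latticePoint n ρ p i ≤ 2 * 2 ^ p.1 - spacing ρ p.1 := by
  have h1 := one_le_spacing hρ₀ p.1
  change (2 : ℝ) ^ p.1 + spacing ρ p.1 * (p.2 i : ℕ) ≤ _
  have h2 : ((p.2 i : ℕ) : ℝ) + 1 ≤ latticeSize ρ p.1 := by exact_mod_cast (p.2 i).2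
  have h3 := spacing_mul_latticeSize_le (ρ := ρ) p.1
  have h4 : spacing ρ p.1 * ((p.2 i : ℕ) + 1) ≤ spacing ρ p.1 * latticeSize ρ p.1 :=
    mul_le_mul_of_nonneg_left h2 (by linarith)
  linarith

theorem norm_latticePoint_le (hρ₀ : 0 ≤ ρ) (p : LatticeIndex n ρ) :
    ‖latticePoint n ρ p‖ ≤ n * (2 * 2 ^ p.1) := by
  refine (norm_le_sum_abs _).trans ?_
  have h : ∀ i ∈ (Finset.univ : Finset (Fin n)), |latticePoint n ρ p i| ≤ 2 * 2 ^ p.1 := by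
    intro i _
    have h1 := le_latticePoint_apply hρ₀ p i
    have h2 := latticePoint_apply_le hρ₀ p i
    have h3 := one_le_spacing hρ₀ p.1
    have h4 : (0 : ℝ) < 2 ^ p.1 := by positivity
    rw [abs_of_nonneg (by linarith)]
    linarith
  simpa using Finset.sum_le_card_nsmul _ _ _ h

/-- The first coordinates suffice. For consecutive shells the gap is at least the smaller shell's
spacing, and the next spacing is at most twice that, whence the factor 1/2. For shells further apart
the gap is at least half of 2^j for the larger j, and spacings are at most 2^j. -/
theorem latticePoint_separated_of_lt (hn : 1 ≤ n) (hρ₀ : 0 ≤ ρ) (hρ₁ : ρ ≤ 1)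
    {p q : LatticeIndex n ρ} (hpq : p.1 < q.1) :
    spacing ρ p.1 / 2 ≤ ‖latticePoint n ρ q - latticePoint n ρ p‖ ∧
      spacing ρ q.1 / 2 ≤ ‖latticePoint n ρ q - latticePoint n ρ p‖ := by
  have h0 := (le_abs_self _).trans
    (abs_apply_le_norm (latticePoint n ρ q - latticePoint n ρ p) ⟨0, hn⟩)
  rw [PiLp.sub_apply] at h0
  have h1 := le_latticePoint_apply hρ₀ q ⟨0, hn⟩
  have h2 := latticePoint_apply_le hρ₀ p ⟨0, hn⟩
  have h3 := one_le_spacing hρ₀ p.1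
  have h4 := one_le_spacing hρ₀ q.1
  have h5 := spacing_le hρ₁ q.1
  rcases (Nat.succ_le_of_lt hpq).eq_or_lt with h | h
  · have h6 : (2 : ℝ) ^ q.1 = 2 * 2 ^ p.1 := by rw [← h, Nat.succ_eq_add_one, pow_succ, mul_comm]
    have h7 : spacing ρ q.1 ≤ 2 * spacing ρ p.1 := by rw [← h]; exact spacing_succ_le hρ₁ _
    constructor <;> linarith
  · have h6 : 4 * (2 : ℝ) ^ p.1 ≤ 2 ^ q.1 := by
      have : (2 : ℝ) ^ (p.1 + 2) ≤ 2 ^ q.1 := pow_le_pow_right₀ one_le_two h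
      rw [pow_add] at this
      linarith
    have h8 : (0 : ℝ) < 2 ^ p.1 := by positivity
    constructor <;> linarith

theorem latticePoint_separated (hn : 1 ≤ n) (hρ₀ : 0 ≤ ρ) (hρ₁ : ρ ≤ 1)
    (p q : LatticeIndex n ρ) (hpq : p ≠ q) :
    spacing ρ p.1 / 2 ≤ ‖latticePoint n ρ p - latticePoint n ρ q‖ := by
  rcases lt_trichotomy p.1 q.1 with h | h | h
  · rw [norm_sub_rev]
    exact (latticePoint_separated_of_lt hn hρ₀ hρ₁ h).1
  · obtain ⟨j, k⟩ := p
    obtain ⟨j', k'⟩ := q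
    obtain rfl : j = j' := h
    obtain ⟨i, hi⟩ : ∃ i, k i ≠ k' i := by
      by_contra! hcon
      exact hpq (by rw [funext hcon])
    have h1 : (1 : ℝ) ≤ |((k i : ℕ) : ℝ) - (k' i : ℕ)| := by
      have : (1 : ℤ) ≤ |((k i : ℕ) : ℤ) - (k' i : ℕ)| := by
        refine Int.one_le_abs (sub_ne_zero.2 ?_)
        exact_mod_cast fun h => hi (Fin.ext h)
      exact_mod_cast this
    have h2 := abs_apply_le_norm (latticePoint n ρ ⟨j, k⟩ - latticePoint n ρ ⟨j, k'⟩) i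
    have h3 : (latticePoint n ρ ⟨j, k⟩ - latticePoint n ρ ⟨j, k'⟩) i =
        spacing ρ j * (((k i : ℕ) : ℝ) - (k' i : ℕ)) := by
      change ((2 : ℝ) ^ j + spacing ρ j * (k i : ℕ)) - ((2 : ℝ) ^ j + spacing ρ j * (k' i : ℕ)) = _
      ring
    have h4 := one_le_spacing hρ₀ j
    rw [h3, abs_mul, abs_of_nonneg (by linarith)] at h2
    have h5 := mul_le_mul_of_nonneg_left h1 (by linarith : 0 ≤ spacing ρ j)
    change spacing ρ j / 2 ≤ _
    linarith
  · exact (latticePoint_separated_of_lt hn hρ₀ hρ₁ h).2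

/-- The heights `2 ^ (jm)` of the wave packets. -/
def packetHeight (n : ℕ) (ρ m : ℝ) (p : LatticeIndex n ρ) : ℝ := ((2 : ℝ) ^ p.1) ^ m

theorem packetHeight_mul_le (hρ₀ : 0 ≤ ρ) (hρ₁ : ρ ≤ 1) {m : ℝ} (hm : m ≤ 0) (k : ℕ) :
    ∃ C, 0 ≤ C ∧ ∀ (p : LatticeIndex n ρ) (ξ : Rn n),
      ‖ξ - latticePoint n ρ p‖ ≤ spacing ρ p.1 / 8 →
      |packetHeight n ρ m p| * (spacing ρ p.1 ^ k)⁻¹ ≤ C * bracket ξ ^ (m - ρ * k) := by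
  set s : ℝ := m - ρ * k with hs
  have hs0 : s ≤ 0 := by
    have : 0 ≤ ρ * k := by positivity
    linarith
  -- The exponent m - ρk is not positive, so only an upper bound on ⟨ξ⟩ is needed: at most 1 for the
  -- bracket, 2n · 2^j for the lattice point, and 2^j/8 for the radius of the bump.
  set D : ℝ := 2 * n + 2 with hD
  have hD0 : 0 < D := by positivity
  refine ⟨(D ^ s)⁻¹, by positivity, fun p ξ hξ => ?_⟩
  have h2 : (1 : ℝ) ≤ 2 ^ p.1 := one_le_pow₀ one_le_two
  have h2' : (0 : ℝ) < 2 ^ p.1 := by positivity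
  have hb : bracket ξ ≤ D * 2 ^ p.1 := by
    have h3 := bracket_le_one_add_norm ξ
    have h4 := norm_latticePoint_le hρ₀ p
    have h5 := spacing_le hρ₁ p.1
    have h6 := norm_le_norm_sub_add ξ (latticePoint n ρ p)
    rw [hD]
    nlinarith
  have h7 : |packetHeight n ρ m p| * (spacing ρ p.1 ^ k)⁻¹ = ((2 : ℝ) ^ p.1) ^ s := by
    rw [packetHeight, abs_of_nonneg (by positivity), spacing]
    generalize (2 : ℝ) ^ p.1 = X at h2'
    rw [← Real.rpow_natCast, ← Real.rpow_mul h2'.le, ← Real.rpow_neg h2'.le, ← Real.rpow_add h2',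
      hs, sub_eq_add_neg]
  rw [h7, le_inv_mul_iff₀ (Real.rpow_pos_of_pos hD0 s), ← Real.mul_rpow hD0.le h2'.le]
  exact Real.rpow_le_rpow_of_nonpos (bracket_pos ξ) hb hs0

/-- For x ≥ 1 the integer part of x is at least x/2. This keeps the count nontrivial for ρ = 1 too,
with one point per shell. -/
theorem half_le_latticeSize_mul (hρ₁ : ρ ≤ 1) (j : ℕ) :
    (1 / 2 : ℝ) ≤ latticeSize ρ j * ((2 : ℝ) ^ j) ^ (ρ - 1) := by
  have h1 : (1 : ℝ) ≤ ((2 : ℝ) ^ j) ^ (1 - ρ) :=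
    Real.one_le_rpow (one_le_pow₀ one_le_two) (by linarith)
  have h2 : ((2 : ℝ) ^ j) ^ (1 - ρ) / 2 ≤ latticeSize ρ j := by
    have h3 := Nat.lt_floor_add_one (((2 : ℝ) ^ j) ^ (1 - ρ))
    have h4 : (1 : ℝ) ≤ latticeSize ρ j := by
      exact_mod_cast Nat.le_floor (by exact_mod_cast h1)
    change _ < (latticeSize ρ j : ℝ) + 1 at h3
    linarith
  have h5 : ((2 : ℝ) ^ j) ^ (1 - ρ) * ((2 : ℝ) ^ j) ^ (ρ - 1) = 1 := by
    rw [← Real.rpow_add (by positivity)]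
    simp
  calc (1 / 2 : ℝ) = ((2 : ℝ) ^ j) ^ (1 - ρ) / 2 * ((2 : ℝ) ^ j) ^ (ρ - 1) := by
        rw [div_mul_eq_mul_div, h5]
    _ ≤ _ := mul_le_mul_of_nonneg_right h2 (Real.rpow_nonneg (by positivity) _)

theorem exists_lt_sum_packetHeight_sq (hρ₁ : ρ ≤ 1) (B : ℝ) : ∃ F : Finset (LatticeIndex n ρ),
    B < ∑ p ∈ F, packetHeight n ρ ((n : ℝ) / 2 * (ρ - 1)) p ^ 2 := by
  -- A shell has N_jⁿ points of squared height 2^{jn(ρ-1)}, with N_j 2^{j(ρ-1)} ≥ 1/2, so it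
  -- contributes at least 2^{-n}; more than 2ⁿB shells exceed B.
  obtain ⟨J, hJ⟩ := exists_nat_gt (B * 2 ^ n)
  refine ⟨(Finset.range J).sigma fun _ => Finset.univ, ?_⟩
  rw [Finset.sum_sigma]
  have h : ∀ j ∈ Finset.range J, ((1 / 2 : ℝ)) ^ n ≤ ∑ k : Fin n → Fin (latticeSize ρ j),
      packetHeight n ρ ((n : ℝ) / 2 * (ρ - 1)) ⟨j, k⟩ ^ 2 := by
    intro j _
    have h1 : ∀ k : Fin n → Fin (latticeSize ρ j),
        packetHeight n ρ ((n : ℝ) / 2 * (ρ - 1)) ⟨j, k⟩ ^ 2 = (((2 : ℝ) ^ j) ^ (ρ - 1)) ^ n := by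
      intro k
      have hX : (0 : ℝ) < 2 ^ j := by positivity
      simp only [packetHeight]
      generalize (2 : ℝ) ^ j = X at hX
      rw [← Real.rpow_natCast, ← Real.rpow_natCast, ← Real.rpow_mul hX.le, ← Real.rpow_mul hX.le]
      congr 1
      push_cast
      ring
    simp_rw [h1]
    rw [Finset.sum_const, Finset.card_univ, Fintype.card_fun, Fintype.card_fin, Fintype.card_fin,
      nsmul_eq_mul, Nat.cast_pow, ← mul_pow]
    exact pow_le_pow_left₀ (by norm_num) (half_le_latticeSize_mul hρ₁ j) n
  refine lt_of_lt_of_le ?_ (Finset.card_nsmul_le_sum _ _ _ h)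
  rw [Finset.card_range, nsmul_eq_mul, div_pow, one_pow, mul_one_div]
  exact (lt_div_iff₀ (by positivity)).2 hJ

theorem MemRoughAmplitude.mono {m m' : ℝ} {a : Rn n → Rn n → ℂ} (ha : MemRoughAmplitude m ρ a)
    (hm : m ≤ m') : MemRoughAmplitude m' ρ a := by
  refine ⟨ha.smooth, ha.measurable, fun k => ?_⟩
  obtain ⟨C, hC⟩ := ha.bound k
  refine ⟨|C|, fun ξ => (hC ξ).mono fun x hx => hx.trans ?_⟩
  have hb := bracket_pos ξ
  calc C * bracket ξ ^ (m - ρ * k) ≤ |C| * bracket ξ ^ (m - ρ * k) := by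
        gcongr
        exact le_abs_self C
    _ ≤ _ := mul_le_mul_of_nonneg_left
        (Real.rpow_le_rpow_of_exponent_le (one_le_bracket ξ) (by linarith)) (abs_nonneg C)

/-- Sharpness of the order `n(ρ - 1)/2`. -/
theorem exists_not_boundedOnL2_fio (hn : 1 ≤ n) (hρ₀ : 0 ≤ ρ) (hρ₁ : ρ ≤ 1) {m : ℝ}
    (hm : (n : ℝ) / 2 * (ρ - 1) ≤ m) : ∃ (a : Rn n → Rn n → ℂ) (φ : Rn n → Rn n → ℝ),
      MemRoughAmplitude m ρ a ∧ MemPhase 2 φ ∧ StronglyNondegenerate φ ∧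
        ¬ BoundedOnL2 (fio a φ) := by
  have hm0 : (n : ℝ) / 2 * (ρ - 1) ≤ 0 := mul_nonpos_of_nonneg_of_nonpos (by positivity)
    (by linarith)
  have hsep := latticePoint_separated hn hρ₀ hρ₁
  have : Nonempty (LatticeIndex n ρ) := by
    obtain ⟨F, hF⟩ := exists_lt_sum_packetHeight_sq (n := n) hρ₁ 0
    obtain ⟨p, -, -⟩ := Finset.exists_ne_zero_of_sum_ne_zero hF.ne'
    exact ⟨p⟩
  have hr : ∀ p : LatticeIndex n ρ, 1 ≤ spacing ρ p.1 := fun p => one_le_spacing hρ₀ p.1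
  have ha : MemRoughAmplitude ((n : ℝ) / 2 * (ρ - 1)) ρ
      (packetAmplitude (latticePoint n ρ) (fun p => spacing ρ p.1)
        (packetHeight n ρ ((n : ℝ) / 2 * (ρ - 1)))) :=
    memRoughAmplitude_packetAmplitude hr hsep (packetHeight_mul_le hρ₀ hρ₁ hm0)
  exact ⟨_, _, ha.mono hm, memPhase_inner, stronglyNondegenerate_inner,
    not_boundedOnL2_packetAmplitude hr hsep (exists_lt_sum_packetHeight_sq hρ₁)⟩

end RoughFIO

end

theorem mainTheorem7 (n : ℕ) (hn : 1 ≤ n) (ρ : ℝ) (hρ₀ : 0 ≤ ρ) (hρ₁ : ρ ≤ 1) :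
    (∀ m : ℝ, m < (n : ℝ) / 2 * (ρ - 1) →
      ∀ (a : RoughFIO.Rn n → RoughFIO.Rn n → ℂ) (φ : RoughFIO.Rn n → RoughFIO.Rn n → ℝ),
        RoughFIO.MemRoughAmplitude m ρ a → RoughFIO.MemPhase 2 φ →
        RoughFIO.StronglyNondegenerate φ →
        RoughFIO.BoundedOnL2 (RoughFIO.fio a φ)) ∧
    (∀ m : ℝ, (n : ℝ) / 2 * (ρ - 1) ≤ m →
      ∃ (a : RoughFIO.Rn n → RoughFIO.Rn n → ℂ) (φ : RoughFIO.Rn n → RoughFIO.Rn n → ℝ),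
        RoughFIO.MemRoughAmplitude m ρ a ∧ RoughFIO.MemPhase 2 φ ∧
        RoughFIO.StronglyNondegenerate φ ∧
        ¬ RoughFIO.BoundedOnL2 (RoughFIO.fio a φ)) :=
  ⟨fun _ hm _ _ ha hφ hnd => RoughFIO.boundedOnL2_fio hn hρ₁ hm ha hφ hnd,
    fun _ hm => RoughFIO.exists_not_boundedOnL2_fio hn hρ₀ hρ₁ hm⟩
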